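/- **Setting.** Let $R=\mathbb C[x]$ and let $W\in R$ satisfy $\dim_{\mathbb C}R/(W')<\infty$. Identify $R$-bimodules with modules over $R\otimes_{\mathbb C}R=\mathbb C[a,b]$, where $a$ is the left and $b$ the right action of $x$. A *factorisation* of $W$ is $X=(X_0,X_1,d_0,d_1)$ with $R$-bimodules $X_i$ and bimodule maps $d_0:X_0\to X_1$, $d_1:X_1\to X_0$ such that $d_1d_0$ and $d_0d_1$ are $m\mapsto W.m-m.W$. Even morphisms are pairs $(f_0,f_1)$ of bimodule maps $f_i:X_i\to Y_i$. Closed ones commute with the $d_i$, and closed $f,g$ are homotopic if there are bimodule maps $h_0:X_0\to Y_1$, $h_1:X_1\to Y_0$ with $f_0-g_0=d_1h_0+h_1d_0$ and $f_1-g_1=d_0h_1+h_0d_1$. The homotopy category has closed even morphisms modulo homotopy as morphisms. $\mathrm{MF}_{\mathrm{bi}}(W)$ is its full subcategory of objects isomorphic (in the homotopy category) to some factorisation of *finite rank*, i.e. with $X_0,X_1$ free over $\mathbb C[a,b]$ of finite rank. **Monoidal structure.** $X\otimes Y$ is $$\Big(X_0\otimes_RY_0\oplus X_1\otimes_RY_1,\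 X_1\otimes_RY_0\oplus X_0\otimes_RY_1,\ \begin{pmatrix}d_0\otimes 1&-1\otimes d_1\\1\otimes d_0&d_1\otimes1\end{pmatrix},\ \begin{pmatrix}d_1\otimes 1&1\otimes d_1\\-1\otimes d_0&d_0\otimes1\end{pmatrix}\Big),$$ even morphisms are tensored componentwise, $\alpha$ is the canonical rearrangement $(X\otimes Y)\otimes Z\to X\otimes(Y\otimes Z)$, the unit is $I=(R\otimes R,R\otimes R,\tfrac{W(a)-W(b)}{a-b},a-b)$, and $\lambda_X:I\otimes X\to X$, $\rho_X:X\otimes I\to X$ are induced by the multiplication $\mu:R\otimes R\to R$ on the summands $I_0\otimes_R X_i$, resp. $X_i\otimes_R I_0$, and are $0$ on the other summands. The dual of a bimodule $M$ is $M^\vee=\mathrm{Hom}(M,R\otimes R)$ (bimodule maps) with $(s.\varphi.r)(m)=\varphi(r.m.s)$, $f^\vee=(-)\circ f$, and $$X^\vee=(X_1^\vee,X_0^\vee,d_0^\vee,-d_1^\vee),\qquad \varphi^\vee=(\varphi_1^\vee,\varphi_0^\vee).$$ **Explicit maps.** Let $Z$ be of finite rank, with chosen finite bases $(e^0_j)$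 of $Z_0$ and $(e^1_j)$ of $Z_1$, dual bases $(e^{0*}_j)$ and $(e^{1*}_j)$ (with $e^{i*}_j(e^i_k)=\delta_{jk}$), and matrices $D_0(a,b)$, $D_1(a,b)$ of $d_0,d_1$ over $\mathbb C[a,b]$. On a tensor product $M\otimes_RN$ let $\mathbb C[a,x,b]$ act by $a$ on the left of $M$, $x$ in the middle, $b$ on the right of $N$. * Coevaluation, $\mathrm{coev}_Z:I\to Z\otimes Z^\vee$: in degree $0$, $1\mapsto\big(\sum_{i,j}\tfrac{D_1(a,x)_{ij}-D_1(b,x)_{ij}}{a-b}\,e^0_i\otimes e^{1*}_j,\ \sum_{i,j}\tfrac{D_0(a,x)_{ij}-D_0(b,x)_{ij}}{a-b}\,e^1_i\otimes e^{0*}_j\big)$; in degree $1$, $1\mapsto\big(\sum_je^1_j\otimes e^{1*}_j,\ \sum_je^0_j\otimes e^{0*}_j\big)$. * Let $\mathcal F:\mathbb C[a,x,b]\to\mathbb C[a,b]$ be the $\mathbb C[a,b]$-linear map sending $x^k$ to the coefficient of $x^{-1}$ in $(a-b-x)x^{k-1}\sum_{n\ge0}W(b)^n/W(x)^{n+1}$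 expanded at $x=\infty$, i.e. $\mathcal F=\frac1{2\pi i}\oint\frac{(a-b-x)\,dx}{x(W(x)-W(b))}$ along a contour around all poles. Evaluation, $\mathrm{ev}_Z:Z^\vee\otimes Z\to I$: on $Z_1^\vee\otimes_RZ_0\oplus Z_0^\vee\otimes_RZ_1$ it is $(A,0)$ and on $Z_0^\vee\otimes_RZ_0\oplus Z_1^\vee\otimes_RZ_1$ it is $(B,C)$, with $$A(\varphi\otimes m)=-\mathcal F\big(\varphi(x,a)\,D_0(x,b)\,m(x,b)\big),$$ $$B(\varphi\otimes m)=\tfrac1{a-b}\mathcal F\big(\varphi(x,a)\,D_1(x,a)D_0(x,b)\,m(x,b)\big),$$ $$C(\varphi\otimes m)=-\big(\varphi(x,a)\,m(x,b)\big)\big|_{x=0},$$ where $m(a,b)$ is the column of coordinates of $m$ and $\varphi(a,b)$ the row of values of $\varphi$ on the basis. (In particular the contraction with $\mathcal F$ that defines $B$ is divisible by $a-b$.) * $\lambda_Z^{-1}:Z\to I\otimes Z$: $e^0_j\mapsto\big(1\otimes e^0_j,\sum_i\tfrac{D_0(a,b)_{ij}-D_0(x,b)_{ij}}{a-x}1\otimes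 e^1_i\big)$ and $e^1_j\mapsto\big(\sum_i\tfrac{D_1(a,b)_{ij}-D_1(x,b)_{ij}}{a-x}1\otimes e^0_i,\,1\otimes e^1_j\big)$. * $\rho_Z^{-1}:Z\to Z\otimes I$: $e^0_j\mapsto\big(e^0_j\otimes1,\sum_i\tfrac{D_0(a,x)_{ij}-D_0(a,b)_{ij}}{x-b}e^1_i\otimes1\big)$ and $e^1_j\mapsto\big(e^1_j\otimes1,-\sum_i\tfrac{D_1(a,x)_{ij}-D_1(a,b)_{ij}}{x-b}e^0_i\otimes1\big)$. **Theorem 2.6.** 1. For all factorisations $X,Y,Z$, $\alpha_{X,Y,Z}$ is an isomorphism with the reverse rearrangement as inverse. For all $Z$ of finite rank (and all bases) the maps $\lambda_Z^{-1},\rho_Z^{-1}$ above are closed and are two-sided inverses of $\lambda_Z,\rho_Z$ in the homotopy category. 2. For all $Z$ of finite rank (and all bases) $\mathrm{ev}_Z$ and $\mathrm{coev}_Z$ are well-defined closed morphisms. If all entries of $D_0$ and $D_1$ have degree less than $\deg W$ in each of $a$ and $b$, then $$\rho_Z\circ(\mathrm{id}_Z\otimes\mathrm{ev}_Z)\circ\alpha_{Z,Z^\vee,Z}\circ(\mathrm{coev}_Z\otimes\mathrm{id}_Z)\circ\lambda_Z^{-1}=\mathrm{id}_Z,$$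 $$\lambda_{Z^\vee}\circ(\mathrm{ev}_Z\otimes\mathrm{id}_{Z^\vee})\circ\alpha^{-1}_{Z^\vee,Z,Z^\vee}\circ(\mathrm{id}_{Z^\vee}\otimes\mathrm{coev}_Z)\circ\rho_{Z^\vee}^{-1}=\mathrm{id}_{Z^\vee}$$ hold strictly, as equalities of even morphisms (with $\rho_{Z^\vee}^{-1}$ formed with the dual bases), not only up to homotopy. 3. For $X\in\mathrm{MF}_{\mathrm{bi}}(W)$ put $\mathrm{ev}_X=\mathrm{ev}_Z\circ((\theta^{-1})^\vee\otimes\theta)$ and $\mathrm{coev}_X=(\theta^{-1}\otimes\theta^\vee)\circ\mathrm{coev}_Z$ for an isomorphism $\theta:X\to Z$ in the homotopy category to an object $Z$ of finite rank with chosen bases. These morphisms of the homotopy category do not depend on $Z$, the bases or $\theta$. For every $X\in\mathrm{MF}_{\mathrm{bi}}(W)$ one has $X^\vee\in\mathrm{MF}_{\mathrm{bi}}(W)$, the morphisms $\lambda_X$ and $\rho_{X^\vee}$ are invertible in the homotopy category, and there $$\rho_X\circ(\mathrm{id}_X\otimes\mathrm{ev}_X)\circ\alpha_{X,X^\vee,X}\circ(\mathrm{coev}_X\otimes\mathrm{id}_X)\circ\lambda_X^{-1}=\mathrm{id}_X,$$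 $$\lambda_{X^\vee}\circ(\mathrm{ev}_X\otimes\mathrm{id}_{X^\vee})\circ\alpha^{-1}_{X^\vee,X,X^\vee}\circ(\mathrm{id}_{X^\vee}\otimes\mathrm{coev}_X)\circ\rho_{X^\vee}^{-1}=\mathrm{id}_{X^\vee}.$$ That is, $\mathrm{MF}_{\mathrm{bi}}(W)$ has right duals. -/

import Mathlib

open Polynomial TensorProduct CategoryTheory

noncomputable section

set_option linter.unusedSimpArgs false
set_option linter.unusedVariables false

namespace BiFact

/-- The ring `R = ℂ[x]`. -/
abbrev R : Type := ℂ[X]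
/-- `S = R ⊗ R = ℂ[a, b]`.  An `R`-bimodule (with both actions of `ℂ` equal) is the same thing as an
`S`-module: `p ⊗ q` acts by `m ↦ p.m.q`. -/
def S : Type := R ⊗[ℂ] R

instance : CommRing S := inferInstanceAs (CommRing (R ⊗[ℂ] R))
instance : Algebra ℂ S := inferInstanceAs (Algebra ℂ (R ⊗[ℂ] R))

/-- `S` is by definition `R ⊗ R`. -/
def S.equiv : R ⊗[ℂ] R ≃ₐ[ℂ] S := AlgEquiv.refl

/-- `p ⊠ q` is the pure tensor `p ⊗ q`, i.e. the polynomial `p(a) q(b)`. -/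
def el (p q : R) : S := S.equiv (p ⊗ₜ q)

infixl:100 "⊠" => el

theorem add_el (p p' q : R) : (p + p')⊠q = p⊠q + p'⊠q := TensorProduct.add_tmul p p' q
theorem el_add (p q q' : R) : p⊠(q + q') = p⊠q + p⊠q' := TensorProduct.tmul_add p q q'
theorem zero_el (q : R) : (0 : R)⊠q = 0 := TensorProduct.zero_tmul R q
theorem el_zero (p : R) : p⊠(0 : R) = 0 := TensorProduct.tmul_zero R p
theorem smul_el (c : ℂ) (p q : R) : (c • p)⊠q = c • (p⊠q) := rfl
theorem el_smul (c : ℂ) (p q : R) : p⊠(c • q) = c • (p⊠q) := TensorProduct.tmul_smul c p q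
theorem el_mul_el (p q p' q' : R) : (p⊠q) * (p'⊠q') = (p * p')⊠(q * q') :=
  Algebra.TensorProduct.tmul_mul_tmul p p' q q'
theorem one_el_one : (1 : R)⊠(1 : R) = 1 := rfl
theorem one_el_algebraMap (c : ℂ) : (1 : R)⊠(algebraMap ℂ R c) = algebraMap ℂ S c := by
  rw [Algebra.algebraMap_eq_smul_one, Algebra.algebraMap_eq_smul_one, el_smul, one_el_one]
theorem el_pow (p q : R) (n : ℕ) : (p⊠q) ^ n = (p ^ n)⊠(q ^ n) :=
  Algebra.TensorProduct.tmul_pow p q n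

/-- `p ↦ p(a)`. -/
def leftIncl : R →ₐ[ℂ] S :=
  S.equiv.toAlgHom.comp (Algebra.TensorProduct.includeLeft : R →ₐ[ℂ] R ⊗[ℂ] R)
/-- `p ↦ p(b)`. -/
def rightIncl : R →ₐ[ℂ] S :=
  S.equiv.toAlgHom.comp (Algebra.TensorProduct.includeRight : R →ₐ[ℂ] R ⊗[ℂ] R)

/-- `T = ℂ[a, x, b]`; the pure tensor `(p ⊠ q) ⊗ r` is `p(a) q(x) r(b)`. -/
abbrev T : Type := S ⊗[ℂ] R

@[elab_as_elim]
theorem S_induct {C : S → Prop} (s : S) (ht : ∀ p q : R, C (p⊠q))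
    (ha : ∀ x y, C x → C y → C (x + y)) : C s :=
  TensorProduct.induction_on (motive := C) (show R ⊗[ℂ] R from s)
    (by have := ht 0 0; rwa [zero_el] at this) ht ha

/-- `M` regarded as an `R`-module through its right action. -/
def RightMod (M : Type) : Type := M
/-- `M` regarded as an `R`-module through its left action. -/
def LeftMod (M : Type) : Type := M

section Mods
variable (M : Type) [AddCommGroup M] [Module S M]

instance : AddCommGroup (RightMod M) := inferInstanceAs (AddCommGroup M)
instance : AddCommGroup (LeftMod M) := inferInstanceAs (AddCommGroup M)
instance : Module S (RightMod M) := inferInstanceAs (Module S M)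
instance : Module S (LeftMod M) := inferInstanceAs (Module S M)
instance : Module R (RightMod M) :=
  Module.compHom M rightIncl.toRingHom
instance : Module R (LeftMod M) :=
  Module.compHom M leftIncl.toRingHom
instance : Module ℂ (RightMod M) := Module.compHom M (algebraMap ℂ S)
instance : Module ℂ (LeftMod M) := Module.compHom M (algebraMap ℂ S)

theorem right_smul_def (r : R) (m : RightMod M) :
    r • m = ((1 : R)⊠r) • m := rfl
theorem left_smul_def (r : R) (m : LeftMod M) :
    r • m = (r⊠(1 : R)) • m := rfl

instance : IsScalarTower ℂ S (RightMod M) :=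
  ⟨fun c s m => by
    have h : c • s = algebraMap ℂ S c * s := Algebra.smul_def c s
    rw [h, mul_smul]; rfl⟩
instance : IsScalarTower ℂ R (RightMod M) :=
  ⟨fun c r m => by
    rw [right_smul_def, right_smul_def, el_smul, smul_assoc]⟩
instance : SMulCommClass R S (RightMod M) :=
  ⟨fun r s m => by rw [right_smul_def, right_smul_def, smul_smul, smul_smul, mul_comm]⟩
instance : SMulCommClass R ℂ (RightMod M) :=
  ⟨fun r c m => by
    rw [right_smul_def, right_smul_def, smul_comm]⟩
end Mods

section BTensor
variable (M N P : Type) [AddCommGroup M] [Module S M] [AddCommGroup N] [Module S N]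
  [AddCommGroup P] [Module S P]

/-- The tensor product of bimodules `M ⊗_R N`: the right action on `M` is balanced against the left
action on `N`. -/
def BTensor : Type := RightMod M ⊗[R] LeftMod N

instance : AddCommGroup (BTensor M N) :=
  inferInstanceAs (AddCommGroup (RightMod M ⊗[R] LeftMod N))

/-- The right action of `R` on `M ⊗_R N`, through the right action on `N`. -/
def actR : R →ₐ[ℂ] Module.End ℂ (RightMod M ⊗[R] LeftMod N) where
  toFun r := 
    { toFun := LinearMap.lTensor (RightMod M)
        ({ toFun := fun n => ((1 : R)⊠r) • n
           map_add' := fun _ _ => smul_add _ _ _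
           map_smul' := fun p n => by
            simp only [left_smul_def, smul_smul, mul_comm, RingHom.id_apply] } :
          LeftMod N →ₗ[R] LeftMod N)
      map_add' := map_add _
      map_smul' := fun c t => by
        induction t with
        | zero => simp
        | add x y hx hy => simp only [smul_add, map_add, hx, hy]
        | tmul m n => rfl }
  map_one' := by
    ext t
    induction t with
    | zero => simp
    | add x y hx hy => simp only [map_add, hx, hy]
    | tmul m n =>
      exact congrArg (fun z => m ⊗ₜ[R] z) (one_smul S n)
  map_mul' p q := by
    ext t
    induction t with
    | zero => simp
    | add x y hx hy => simp only [map_add, hx, hy]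
    | tmul m n =>
      refine congrArg (fun z => m ⊗ₜ[R] z) ?_
      have : ((1 : R)⊠(p * q)) = (1⊠p) * (1⊠q) := by
        rw [el_mul_el, one_mul]
      change ((1 : R)⊠(p * q)) • n = _
      rw [this, mul_smul]; rfl
  map_zero' := by
    ext t
    induction t with
    | zero => simp
    | add x y hx hy => simp only [map_add, hx, hy]
    | tmul m n =>
      change m ⊗ₜ[R] (((1 : R)⊠(0 : R)) • n) = 0
      have h : ((1 : R)⊠(0 : R)) • n = 0 := by
        rw [el_zero]; exact zero_smul S n
      rw [h, TensorProduct.tmul_zero]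
  map_add' p q := by
    ext t
    induction t with
    | zero => simp
    | add x y hx hy => simp only [map_add, hx, hy]
    | tmul m n =>
      change m ⊗ₜ[R] (((1 : R)⊠(p + q)) • n) =
        m ⊗ₜ[R] (((1 : R)⊠p) • n) + m ⊗ₜ[R] (((1 : R)⊠q) • n)
      rw [el_add, add_smul, TensorProduct.tmul_add]
  commutes' c := by
    ext t
    induction t with
    | zero => simp
    | add x y hx hy => simp only [map_add, hx, hy]
    | tmul m n =>
      change m ⊗ₜ[R] (((1 : R)⊠(algebraMap ℂ R c)) • n) = (c • m) ⊗ₜ[R] n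
      have h1 : ((1 : R)⊠(algebraMap ℂ R c)) = algebraMap ℂ S c := one_el_algebraMap c
      have h2 : c • m = (algebraMap ℂ R c) • m := by
        rw [right_smul_def, h1]; rfl
      rw [h2, TensorProduct.smul_tmul, left_smul_def]
      congr 2

theorem act_comm (s : S) (r : R) :
    Commute (Algebra.lsmul ℂ ℂ (RightMod M ⊗[R] LeftMod N) s) (actR M N r) := by
  refine LinearMap.ext fun t => ?_
  induction t with
  | zero => simp
  | add x y hx hy => simp only [map_add, hx, hy]
  | tmul m n => rfl

/-- The action of `ℂ[a, x, b]` on `M ⊗_R N`: `a` acts on the left of `M`, `x` in the middle and `b` on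
the right of `N`. -/
def act : T →ₐ[ℂ] Module.End ℂ (RightMod M ⊗[R] LeftMod N) :=
  Algebra.TensorProduct.lift (Algebra.lsmul ℂ ℂ (RightMod M ⊗[R] LeftMod N)) (actR M N)
    (fun s r => act_comm M N s r)

instance : Module T (BTensor M N) :=
  Module.compHom (RightMod M ⊗[R] LeftMod N) (act M N).toRingHom

/-- The inclusion `ℂ[a, b] → ℂ[a, x, b]`. -/
def outer : S →ₐ[ℂ] T :=
  (Algebra.TensorProduct.map leftIncl (AlgHom.id ℂ R)).comp S.equiv.symm.toAlgHom

/-- The bimodule structure of `M ⊗_R N`: outer left and outer right action. -/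
instance : Module S (BTensor M N) := Module.compHom (BTensor M N) outer.toRingHom

variable {M N P}

/-- The pure tensor `m ⊗ n` in `M ⊗_R N`. -/
def tmul (m : M) (n : N) : BTensor M N := (show RightMod M from m) ⊗ₜ[R] (show LeftMod N from n)

theorem T_smul_tmul (s : S) (r : R) (m : M) (n : N) :
    (s ⊗ₜ[ℂ] r : T) • tmul m n = tmul (s • m) (((1 : R)⊠r) • n) := by
  change act M N (s ⊗ₜ[ℂ] r) (tmul m n) = _
  have h : act M N (s ⊗ₜ[ℂ] r) =
      Algebra.lsmul ℂ ℂ (RightMod M ⊗[R] LeftMod N) s * actR M N r :=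
    Algebra.TensorProduct.lift_tmul _ _ _ _ _
  rw [h]
  rfl

theorem smul_tmul (p q : R) (m : M) (n : N) :
    (p⊠q) • tmul m n =
      tmul ((p⊠(1 : R)) • m) (((1 : R)⊠q) • n) := by
  change (outer (p⊠q)) • tmul m n = _
  rw [← T_smul_tmul]; rfl

theorem tmul_middle (r : R) (m : M) (n : N) :
    tmul (((1 : R)⊠r) • m) n = tmul m ((r⊠(1 : R)) • n) :=
  TensorProduct.smul_tmul (R := R) r (show RightMod M from m) (show LeftMod N from n)

theorem tmul_add (m : M) (n n' : N) : tmul m (n + n') = tmul m n + tmul m n' :=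
  TensorProduct.tmul_add _ _ _
theorem add_tmul (m m' : M) (n : N) : tmul (m + m') n = tmul m n + tmul m' n :=
  TensorProduct.add_tmul _ _ _
theorem tmul_sub (m : M) (n n' : N) : tmul m (n - n') = tmul m n - tmul m n' :=
  TensorProduct.tmul_sub _ _ _
theorem sub_tmul (m m' : M) (n : N) : tmul (m - m') n = tmul m n - tmul m' n :=
  TensorProduct.sub_tmul _ _ _
theorem tmul_zero (m : M) : tmul m (0 : N) = 0 := TensorProduct.tmul_zero _ _
theorem zero_tmul (n : N) : tmul (0 : M) n = 0 := TensorProduct.zero_tmul _ _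
theorem tmul_neg (m : M) (n : N) : tmul m (-n) = -tmul m n :=
  TensorProduct.tmul_neg _ _
theorem neg_tmul (m : M) (n : N) : tmul (-m) n = -tmul m n :=
  TensorProduct.neg_tmul _ _

@[elab_as_elim]
theorem BTensor.induct {C : BTensor M N → Prop} (t : BTensor M N) (h0 : C 0)
    (ht : ∀ m n, C (tmul m n)) (ha : ∀ x y, C x → C y → C (x + y)) : C t :=
  TensorProduct.induction_on (R := R) (M := RightMod M) (N := LeftMod N) (motive := C) t h0 ht ha

theorem BTensor.hom_ext {f g : BTensor M N →ₗ[S] P} (h : ∀ m n, f (tmul m n) = g (tmul m n)) :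
    f = g :=
  LinearMap.ext fun t => BTensor.induct t (by simp) h
    fun x y hx hy => by rw [map_add, map_add, hx, hy]

/-- Additive maps out of `M ⊗_R N`. -/
def BTensor.liftAdd {P : Type} [AddCommGroup P] (f : M → N → P)
    (hl : ∀ m m' n, f (m + m') n = f m n + f m' n)
    (hr : ∀ m n n', f m (n + n') = f m n + f m n')
    (hm : ∀ (r : R) m n,
      f (((1 : R)⊠r) • m) n = f m ((r⊠(1 : R)) • n)) :
    BTensor M N →+ P :=
  TensorProduct.liftAddHom (R := R) (M := RightMod M) (N := LeftMod N)
    (AddMonoidHom.mk' (fun m => AddMonoidHom.mk' (f m) (hr m))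
      (fun m m' => AddMonoidHom.ext (hl m m'))) hm

theorem BTensor.liftAdd_tmul {P : Type} [AddCommGroup P] (f : M → N → P) (hl hr hm) (m : M)
    (n : N) : BTensor.liftAdd f hl hr hm (tmul m n) = f m n := rfl

/-- Bimodule maps out of `M ⊗_R N`. -/
def BTensor.lift (f : M → N → P)
    (hl : ∀ m m' n, f (m + m') n = f m n + f m' n)
    (hr : ∀ m n n', f m (n + n') = f m n + f m n')
    (hm : ∀ (r : R) m n,
      f (((1 : R)⊠r) • m) n = f m ((r⊠(1 : R)) • n))
    (hs : ∀ (p q : R) m n,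
      f ((p⊠(1 : R)) • m) (((1 : R)⊠q) • n) = (p⊠q) • f m n) :
    BTensor M N →ₗ[S] P :=
  { BTensor.liftAdd f hl hr hm with
    map_smul' := fun s t => by
      change BTensor.liftAdd f hl hr hm (s • t) = s • BTensor.liftAdd f hl hr hm t
      induction t using BTensor.induct with
      | h0 => simp
      | ha x y hx hy => simp only [smul_add, map_add, hx, hy]
      | ht m n =>
        induction s using S_induct with
        | ha x y hx hy => simp only [add_smul, map_add, hx, hy]
        | ht p q => rw [smul_tmul, BTensor.liftAdd_tmul, hs, BTensor.liftAdd_tmul] }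

theorem BTensor.lift_tmul (f : M → N → P) (hl hr hm hs) (m : M) (n : N) :
    BTensor.lift f hl hr hm hs (tmul m n) = f m n := rfl

theorem smul_one_tmul (p : R) (m : M) (n : N) :
    (p⊠(1 : R)) • tmul m n = tmul ((p⊠(1 : R)) • m) n := by
  rw [smul_tmul, one_el_one, one_smul]
theorem one_smul_tmul (q : R) (m : M) (n : N) :
    ((1 : R)⊠q) • tmul m n = tmul m (((1 : R)⊠q) • n) := by
  rw [smul_tmul, one_el_one, one_smul]

section
variable {M' N' : Type} [AddCommGroup M'] [Module S M'] [AddCommGroup N'] [Module S N']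

/-- `f ⊗_R g` for bimodule maps `f`, `g`. -/
def BTensor.map (f : M →ₗ[S] M') (g : N →ₗ[S] N') : BTensor M N →ₗ[S] BTensor M' N' :=
  BTensor.lift (fun m n => tmul (f m) (g n))
    (fun m m' n => by rw [map_add, add_tmul])
    (fun m n n' => by rw [map_add, tmul_add])
    (fun r m n => by rw [map_smul, map_smul, tmul_middle])
    (fun p q m n => by rw [map_smul, map_smul, smul_tmul])

@[simp] theorem BTensor.map_tmul (f : M →ₗ[S] M') (g : N →ₗ[S] N') (m : M) (n : N) :
    BTensor.map f g (tmul m n) = tmul (f m) (g n) := rfl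
end

/-- The multiplication map `R ⊗ R → R`. -/
def mu : S →ₐ[ℂ] R := (Algebra.TensorProduct.lmul' ℂ).comp S.equiv.symm.toAlgHom

theorem mu_tmul (p q : R) : mu (p⊠q) = p * q := Algebra.TensorProduct.lmul'_apply_tmul p q

/-- The map `(R ⊗ R) ⊗_R M → M`, `(p ⊗ q) ⊗ m ↦ (p q).m`, i.e. `μ ⊗_R id`. -/
def lUnit (M : Type) [AddCommGroup M] [Module S M] : BTensor S M →ₗ[S] M :=
  BTensor.lift (fun s m => ((mu s)⊠(1 : R)) • m)
    (fun s s' m => by rw [map_add, add_el, add_smul])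
    (fun s m m' => smul_add _ _ _)
    (fun r s m => by
      rw [smul_eq_mul, map_mul, mu_tmul, smul_smul, el_mul_el]
      simp only [mul_one, mul_comm])
    (fun p q s m => by
      rw [smul_eq_mul, map_mul, mu_tmul, smul_smul, smul_smul,
        el_mul_el, el_mul_el]
      simp only [one_mul, mul_one])

/-- The map `M ⊗_R (R ⊗ R) → M`, `m ⊗ (p ⊗ q) ↦ m.(p q)`, i.e. `id ⊗_R μ`. -/
def rUnit (M : Type) [AddCommGroup M] [Module S M] : BTensor M S →ₗ[S] M :=
  BTensor.lift (fun m s => ((1 : R)⊠(mu s)) • m)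
    (fun m m' s => smul_add _ _ _)
    (fun m s s' => by rw [map_add, el_add, add_smul])
    (fun r m s => by
      rw [smul_eq_mul, map_mul, mu_tmul, smul_smul, el_mul_el]
      simp only [mul_one, mul_comm])
    (fun p q m s => by
      rw [smul_eq_mul, map_mul, mu_tmul, smul_smul, smul_smul,
        el_mul_el, el_mul_el]
      simp only [one_mul, mul_one, mul_comm])

def assocAux (p : P) : BTensor M N →+ BTensor M (BTensor N P) :=
  BTensor.liftAdd (fun m n => tmul m (tmul n p))
    (fun m m' n => add_tmul _ _ _)
    (fun m n n' => by rw [add_tmul, tmul_add])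
    (fun r m n => by rw [tmul_middle, smul_one_tmul])

theorem assocAux_tmul (p : P) (m : M) (n : N) :
    assocAux p (tmul m n) = tmul m (tmul n p) := rfl

/-- The canonical map `(M ⊗ N) ⊗ P → M ⊗ (N ⊗ P)`. -/
def assocFun : BTensor (BTensor M N) P →ₗ[S] BTensor M (BTensor N P) :=
  BTensor.lift (fun t p => assocAux p t)
    (fun t t' p => map_add _ _ _)
    (fun t p p' => by
      induction t using BTensor.induct with
      | h0 => simp only [map_zero, add_zero]
      | ha x y hx hy => rw [map_add, map_add, map_add, hx, hy]; abel
      | ht m n => rw [assocAux_tmul, assocAux_tmul, assocAux_tmul, tmul_add, tmul_add])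
    (fun r t p => by
      induction t using BTensor.induct with
      | h0 => simp only [smul_zero, map_zero]
      | ha x y hx hy => rw [smul_add, map_add, map_add, hx, hy]
      | ht m n => rw [one_smul_tmul, assocAux_tmul, assocAux_tmul, tmul_middle])
    (fun a b t p => by
      induction t using BTensor.induct with
      | h0 => simp only [smul_zero, map_zero]
      | ha x y hx hy => rw [smul_add, map_add, map_add, hx, hy, smul_add]
      | ht m n => rw [smul_one_tmul, assocAux_tmul, assocAux_tmul, smul_tmul, one_smul_tmul])

def assocAux' (m : M) : BTensor N P →+ BTensor (BTensor M N) P :=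
  BTensor.liftAdd (fun n p => tmul (tmul m n) p)
    (fun n n' p => by rw [tmul_add, add_tmul])
    (fun n p p' => tmul_add _ _ _)
    (fun r n p => by rw [← tmul_middle, one_smul_tmul])

theorem assocAux'_tmul (m : M) (n : N) (p : P) :
    assocAux' m (tmul n p) = tmul (tmul m n) p := rfl

/-- The canonical map `M ⊗ (N ⊗ P) → (M ⊗ N) ⊗ P`. -/
def assocInv : BTensor M (BTensor N P) →ₗ[S] BTensor (BTensor M N) P :=
  BTensor.lift (fun m t => assocAux' m t)
    (fun m m' t => by
      induction t using BTensor.induct with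
      | h0 => simp only [map_zero, add_zero]
      | ha x y hx hy => rw [map_add, map_add, map_add, hx, hy]; abel
      | ht n p => rw [assocAux'_tmul, assocAux'_tmul, assocAux'_tmul, add_tmul, add_tmul])
    (fun m t t' => map_add _ _ _)
    (fun r m t => by
      induction t using BTensor.induct with
      | h0 => simp only [smul_zero, map_zero]
      | ha x y hx hy => rw [smul_add, map_add, map_add, hx, hy]
      | ht n p => rw [smul_one_tmul, assocAux'_tmul, assocAux'_tmul, tmul_middle])
    (fun a b m t => by
      induction t using BTensor.induct with
      | h0 => simp only [smul_zero, map_zero]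
      | ha x y hx hy => rw [smul_add, map_add, map_add, hx, hy, smul_add]
      | ht n p => rw [one_smul_tmul, assocAux'_tmul, assocAux'_tmul, smul_tmul, smul_one_tmul])

@[simp] theorem assocFun_tmul (m : M) (n : N) (p : P) :
    assocFun (tmul (tmul m n) p) = tmul m (tmul n p) := rfl
@[simp] theorem assocInv_tmul (m : M) (n : N) (p : P) :
    assocInv (tmul m (tmul n p)) = tmul (tmul m n) p := rfl


/-- The exchange of the tensor factors, `p(a, b) ↦ p(b, a)`. -/
def swap : S ≃ₐ[ℂ] S :=
  (S.equiv.symm.trans (Algebra.TensorProduct.comm ℂ R R)).trans S.equiv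

/-- The dual bimodule `M^∨`: bimodule maps `φ : M → R ⊗ R` with the action
`(s.φ.r)(m) = φ(r.m.s)`. -/
def BDual (M : Type) [AddCommGroup M] [Module S M] : Type := M →ₗ[S] S

instance : AddCommGroup (BDual M) := inferInstanceAs (AddCommGroup (M →ₗ[S] S))
/-- `p ⊗ q` sends `φ` to `m ↦ φ(q.m.p) = (q ⊗ p) φ(m)`. -/
instance : Module S (BDual M) :=
  Module.compHom (M →ₗ[S] S) (swap : S ≃ₐ[ℂ] S).toAlgHom.toRingHom
instance : FunLike (BDual M) M S := inferInstanceAs (FunLike (M →ₗ[S] S) M S)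
instance : LinearMapClass (BDual M) S M S := inferInstanceAs (LinearMapClass (M →ₗ[S] S) S M S)

theorem BDual.ext {φ ψ : BDual M} (h : ∀ m, φ m = ψ m) : φ = ψ := LinearMap.ext h
theorem BDual.add_apply (φ ψ : BDual M) (m : M) : (φ + ψ) m = φ m + ψ m := rfl
theorem BDual.smul_apply (s : S) (φ : BDual M) (m : M) : (s • φ) m = swap s * φ m := rfl
theorem swap_tmul (p q : R) : swap (p⊠q) = q⊠p := rfl

/-- The dual `f^∨ : φ ↦ φ ∘ f`. -/
def BDual.map (f : M →ₗ[S] N) : BDual N →ₗ[S] BDual M where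
  toFun φ := LinearMap.comp (show N →ₗ[S] S from φ) f
  map_add' _ _ := rfl
  map_smul' _ _ := rfl

theorem BDual.map_apply (f : M →ₗ[S] N) (φ : BDual N) (m : M) : BDual.map f φ m = φ (f m) := rfl


/-- The element `a - b`. -/
def ab : S := (X : R)⊠(1 : R) - (1 : R)⊠(X : R)

/-- `p ↦ (p(a) - p(b)) / (a - b)`. -/
def dd : R →ₗ[ℂ] S :=
  (Polynomial.basisMonomials ℂ).constr ℂ
    (fun n => ∑ i ∈ Finset.range n, ((X : R) ^ i)⊠((X : R) ^ (n - 1 - i)))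

theorem ab_mul_dd (p : R) : ab * dd p = p⊠1 - 1⊠p := by
  induction p using Polynomial.induction_on' with
  | add p q hp hq =>
    rw [map_add, mul_add, hp, hq, add_el, el_add]; abel
  | monomial n c =>
    have h1 : (monomial n c : R) = c • (X : R) ^ n := by
      rw [← Polynomial.C_mul_X_pow_eq_monomial, Polynomial.smul_eq_C_mul]
    have h2 : dd ((X : R) ^ n) =
        ∑ i ∈ Finset.range n, ((X : R) ^ i)⊠((X : R) ^ (n - 1 - i)) := by
      rw [dd, Polynomial.X_pow_eq_monomial]
      have h3 : (monomial n (1 : ℂ) : R) = Polynomial.basisMonomials ℂ n := by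
        rw [Polynomial.coe_basisMonomials]
      rw [h3, Module.Basis.constr_basis]
    have h4 : ∀ i j : ℕ, ((X : R) ^ i)⊠((X : R) ^ j) =
        ((X : R)⊠(1 : R)) ^ i * ((1 : R)⊠(X : R)) ^ j := by
      intro i j
      rw [el_pow, el_pow, el_mul_el, one_pow, one_pow, mul_one, one_mul]
    rw [h1, map_smul, mul_smul_comm, h2, smul_el, el_smul, ← smul_sub]
    congr 1
    simp only [h4]
    rw [ab, (Commute.all _ _).mul_geom_sum₂]
    rw [el_pow, el_pow, one_pow]

/-- `D ↦ (D(a, b) - D(x, b)) / (a - x)`. -/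
def ddL : S →ₗ[ℂ] T :=
  (TensorProduct.map dd (LinearMap.id : R →ₗ[ℂ] R)).comp S.equiv.symm.toLinearMap

/-- `D ↦ (D(a, x) - D(a, b)) / (x - b)`. -/
def ddR : S →ₗ[ℂ] T :=
  ((TensorProduct.map S.equiv.toLinearMap (LinearMap.id : R →ₗ[ℂ] R)).comp
    ((TensorProduct.assoc ℂ R R R).symm.toLinearMap.comp
      (TensorProduct.map (LinearMap.id : R →ₗ[ℂ] R) (S.equiv.symm.toLinearMap.comp dd)))).comp
    S.equiv.symm.toLinearMap

/-- The exchange of `x` and `b` in `ℂ[a, x, b]`. -/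
def swapMiddle : T →ₗ[ℂ] T :=
  (TensorProduct.map S.equiv.toLinearMap (LinearMap.id : R →ₗ[ℂ] R)).comp
    ((TensorProduct.rightComm ℂ R R R).toLinearMap.comp
      (TensorProduct.map S.equiv.symm.toLinearMap (LinearMap.id : R →ₗ[ℂ] R)))

theorem swapMiddle_tmul (p q r : R) : swapMiddle ((p⊠q) ⊗ₜ[ℂ] r) = (p⊠r) ⊗ₜ[ℂ] q := rfl

/-- `D ↦ (D(a, x) - D(b, x)) / (a - b)`. -/
def ddO : S →ₗ[ℂ] T := swapMiddle.comp ddL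

theorem ddL_el (p q : R) : ddL (p⊠q) = dd p ⊗ₜ[ℂ] q := rfl
theorem ddO_el (p q : R) : ddO (p⊠q) = swapMiddle (dd p ⊗ₜ[ℂ] q) := rfl


/-- The `ℂ[a, b]`-linear map `ℂ[a, x, b] → ℂ[a, b]` which extends the linear map `G` on `ℂ[x]`. -/
def extAB (G : R →ₗ[ℂ] S) : T →ₗ[ℂ] S :=
  TensorProduct.lift ((LinearMap.mul ℂ S).compl₁₂
    ((TensorProduct.lift ((LinearMap.mul ℂ S).compl₁₂ G leftIncl.toLinearMap)).comp
      S.equiv.symm.toLinearMap)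
    rightIncl.toLinearMap)

theorem extAB_tmul (G : R →ₗ[ℂ] S) (p q r : R) :
    extAB G ((p⊠q) ⊗ₜ r) = G p * (q⊠r) := by
  change G p * (q⊠1) * (1⊠r) = _
  rw [mul_assoc, el_mul_el, one_mul, mul_one]

@[elab_as_elim]
theorem T_induct {C : T → Prop} (t : T) (ht : ∀ p q r : R, C ((p⊠q) ⊗ₜ[ℂ] r))
    (ha : ∀ x y, C x → C y → C (x + y)) : C t :=
  TensorProduct.induction_on t
    (by have := ht 0 0 0; rwa [TensorProduct.tmul_zero] at this)
    (fun s r => by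
      induction s using S_induct with
      | ht p q => exact ht p q r
      | ha x y hx hy => rw [TensorProduct.add_tmul]; exact ha _ _ hx hy) ha

theorem extAB_mul (G : R →ₗ[ℂ] S) (q r : R) (t : T) :
    extAB G (((1⊠q) ⊗ₜ r) * t) = (q⊠r) * extAB G t := by
  induction t using T_induct with
  | ha x y hx hy => rw [mul_add, map_add, map_add, mul_add, hx, hy]
  | ht p q' r' =>
    rw [Algebra.TensorProduct.tmul_mul_tmul, el_mul_el, extAB_tmul,
      extAB_tmul, one_mul, ← el_mul_el]
    ring

/-- For `p, q ∈ ℂ[a, b]`: apply `G` (extended linearly) in the variable `x` to `p(x, a) q(x, b)`. -/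
def contractSummand (G : R →ₗ[ℂ] S) (p q : S) : S := extAB G ((p ⊗ₜ[ℂ] (1 : R)) * outer q)

theorem contractSummand_add (G : R →ₗ[ℂ] S) (p p' q : S) :
    contractSummand G (p + p') q = contractSummand G p q + contractSummand G p' q := by
  simp only [contractSummand, TensorProduct.add_tmul, add_mul, map_add]

theorem contractSummand_add' (G : R →ₗ[ℂ] S) (p q q' : S) :
    contractSummand G p (q + q') = contractSummand G p q + contractSummand G p q' := by
  simp only [contractSummand, mul_add, map_add]

theorem contractSummand_middle (G : R →ₗ[ℂ] S) (r : R) (p q : S) :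
    contractSummand G ((r⊠(1 : R)) * p) q = contractSummand G p ((r⊠(1 : R)) * q) := by
  have h1 : (((r⊠(1 : R)) * p : S) ⊗ₜ[ℂ] (1 : R) : T) =
      ((r⊠(1 : R)) ⊗ₜ[ℂ] (1 : R)) * (p ⊗ₜ[ℂ] (1 : R)) := by
    rw [Algebra.TensorProduct.tmul_mul_tmul, one_mul]
  have h2 : outer (r⊠(1 : R)) = ((r⊠(1 : R)) ⊗ₜ[ℂ] (1 : R)) := rfl
  rw [contractSummand, contractSummand, h1, map_mul outer, h2]
  congr 1
  ring

theorem contractSummand_outer (G : R →ₗ[ℂ] S) (u v : R) (p q : S) :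
    contractSummand G (((1 : R)⊠u) * p) (((1 : R)⊠v) * q) =
      (u⊠v) * contractSummand G p q := by
  have h1 : ((((1 : R)⊠u) * p : S) ⊗ₜ[ℂ] (1 : R) : T) =
      (((1 : R)⊠u) ⊗ₜ[ℂ] (1 : R)) * (p ⊗ₜ[ℂ] (1 : R)) := by
    rw [Algebra.TensorProduct.tmul_mul_tmul, one_mul]
  have h2 : outer ((1 : R)⊠v) = (1 : S) ⊗ₜ[ℂ] v := rfl
  have h3 : (((1 : R)⊠u) ⊗ₜ[ℂ] v : T) =
      (((1 : R)⊠u) ⊗ₜ[ℂ] (1 : R)) * ((1 : S) ⊗ₜ[ℂ] v) := by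
    rw [Algebra.TensorProduct.tmul_mul_tmul, one_mul, mul_one]
  rw [contractSummand, contractSummand, ← extAB_mul, h1, map_mul outer, h2, h3]
  congr 1
  ring

/-- For a basis `b i` of `M`, the bimodule map `M^∨ ⊗_R M → R ⊗ R` that contracts `φ ⊗ m` over the
basis and applies `G` to the middle variable `x`: it sends `φ ⊗ m` to
`∑ i, G (φ(b i)(x, a) * m_i(x, b))`, where the `m_i` are the coordinates of `m`. -/
def contract {ι : Type} [Fintype ι] (G : R →ₗ[ℂ] S) (b : Module.Basis ι S M) :
    BTensor (BDual M) M →ₗ[S] S :=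
  BTensor.lift (fun φ m => ∑ i, contractSummand G (φ (b i)) (b.repr m i))
    (fun φ ψ m => by
      simp only [BDual.add_apply, contractSummand_add, Finset.sum_add_distrib])
    (fun φ m m' => by
      simp only [map_add, Finsupp.add_apply, contractSummand_add', Finset.sum_add_distrib])
    (fun r φ m => by
      refine Finset.sum_congr rfl fun i _ => ?_
      rw [BDual.smul_apply, swap_tmul, map_smul, Finsupp.smul_apply, smul_eq_mul,
        contractSummand_middle])
    (fun p q φ m => by
      rw [smul_eq_mul, Finset.mul_sum]
      refine Finset.sum_congr rfl fun i _ => ?_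
      rw [BDual.smul_apply, swap_tmul, map_smul, Finsupp.smul_apply, smul_eq_mul,
        contractSummand_outer])

/-- Expansion at infinity: `x` goes to the inverse of the variable `z` of the Laurent series ring. -/
def atInfinity : R →ₐ[ℂ] LaurentSeries ℂ := Polynomial.aeval (HahnSeries.single (-1 : ℤ) (1 : ℂ))

/-- The coefficient of `x⁻¹` in the expansion of `f / g` in powers of `x⁻¹`
(that is, `1 / (2 π i)` times the integral along a large circle). -/
def coeffInvX (f g : R) : ℂ := (atInfinity f / atInfinity g).coeff 1

/-- The map `𝓕`: `x ^ k` goes to the coefficient of `x⁻¹` in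
`(a - b - x) x ^ (k - 1) ∑ n, W(b) ^ n / W(x) ^ (n + 1)`.
For nonconstant `W` the terms with `n > k` do not contribute. -/
def residueF (W : R) : R →ₗ[ℂ] S :=
  (Polynomial.basisMonomials ℂ).constr ℂ (fun k =>
    ∑ n ∈ Finset.range (k + 1),
      (coeffInvX (X ^ k) (X * W ^ (n + 1)) • ab - coeffInvX (X ^ k) (W ^ (n + 1)) • (1 : S))
        * ((1 : R)⊠(W ^ n)))

/-- `p ↦ p(0)`. -/
def augment : R →ₗ[ℂ] S where
  toFun p := algebraMap ℂ S (p.eval 0)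
  map_add' p q := by rw [Polynomial.eval_add, map_add]
  map_smul' c p := by rw [Polynomial.eval_smul, smul_eq_mul, map_mul, ← Algebra.smul_def]; rfl

end BTensor


section Matrix
variable {A B C D : Type} [AddCommGroup A] [Module S A] [AddCommGroup B] [Module S B]
  [AddCommGroup C] [Module S C] [AddCommGroup D] [Module S D]

/-- The map of direct sums with matrix `(f g; h k)`. -/
def matMap (f : A →ₗ[S] C) (g : B →ₗ[S] C) (h : A →ₗ[S] D) (k : B →ₗ[S] D) :
    A × B →ₗ[S] C × D :=
  LinearMap.coprod (LinearMap.prod f h) (LinearMap.prod g k)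

theorem matMap_apply (f : A →ₗ[S] C) (g : B →ₗ[S] C) (h : A →ₗ[S] D) (k : B →ₗ[S] D)
    (x : A × B) : matMap f g h k x = (f x.1 + g x.2, h x.1 + k x.2) := rfl
end Matrix

/-- Factorisations of `W(a) - W(b)` in `R`-bimodules: `d₁ ∘ d₀` and `d₀ ∘ d₁` are
`m ↦ W.m - m.W`.  The bimodules need not be free here; matrix bi-factorisations of finite rank
are those with finitely generated free bimodules, see `IsMFbi`. -/
structure MBF (W : R) : Type 1 where
  X₀ : Type
  X₁ : Type
  [ac₀ : AddCommGroup X₀]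
  [ac₁ : AddCommGroup X₁]
  [mod₀ : Module S X₀]
  [mod₁ : Module S X₁]
  d₀ : X₀ →ₗ[S] X₁
  d₁ : X₁ →ₗ[S] X₀
  d₁_d₀ : ∀ m : X₀, d₁ (d₀ m) = (W⊠(1 : R)) • m - ((1 : R)⊠W) • m
  d₀_d₁ : ∀ m : X₁, d₀ (d₁ m) = (W⊠(1 : R)) • m - ((1 : R)⊠W) • m

attribute [instance] MBF.ac₀ MBF.ac₁ MBF.mod₀ MBF.mod₁

variable {W : R}

/-- Even (not necessarily closed) morphisms. -/
structure EvenMap (X Y : MBF W) where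
  f₀ : X.X₀ →ₗ[S] Y.X₀
  f₁ : X.X₁ →ₗ[S] Y.X₁

theorem EvenMap.ext {X Y : MBF W} {f g : EvenMap X Y} (h₀ : f.f₀ = g.f₀) (h₁ : f.f₁ = g.f₁) :
    f = g := by
  cases f; cases g; congr

def EvenMap.id (X : MBF W) : EvenMap X X := ⟨LinearMap.id, LinearMap.id⟩

def EvenMap.comp {X Y Z : MBF W} (g : EvenMap Y Z) (f : EvenMap X Y) : EvenMap X Z :=
  ⟨g.f₀ ∘ₗ f.f₀, g.f₁ ∘ₗ f.f₁⟩

/-- Closed even morphisms. -/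
structure ClosedMap (X Y : MBF W) extends EvenMap X Y where
  closed₀ : ∀ m, Y.d₀ (f₀ m) = f₁ (X.d₀ m)
  closed₁ : ∀ m, Y.d₁ (f₁ m) = f₀ (X.d₁ m)

theorem ClosedMap.ext {X Y : MBF W} {f g : ClosedMap X Y} (h : f.toEvenMap = g.toEvenMap) :
    f = g := by
  cases f; cases g; congr

def ClosedMap.id (X : MBF W) : ClosedMap X X := ⟨EvenMap.id X, fun _ => rfl, fun _ => rfl⟩

def ClosedMap.comp {X Y Z : MBF W} (g : ClosedMap Y Z) (f : ClosedMap X Y) : ClosedMap X Z where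
  toEvenMap := g.toEvenMap.comp f.toEvenMap
  closed₀ m := by
    change Z.d₀ (g.f₀ (f.f₀ m)) = g.f₁ (f.f₁ (X.d₀ m))
    rw [g.closed₀, f.closed₀]
  closed₁ m := by
    change Z.d₁ (g.f₁ (f.f₁ m)) = g.f₀ (f.f₀ (X.d₁ m))
    rw [g.closed₁, f.closed₁]

/-- `f - g` is the differential of an odd morphism. -/
def Homotopic {X Y : MBF W} (f g : ClosedMap X Y) : Prop :=
  ∃ (h₀ : X.X₀ →ₗ[S] Y.X₁) (h₁ : X.X₁ →ₗ[S] Y.X₀),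
    (∀ m, f.f₀ m - g.f₀ m = Y.d₁ (h₀ m) + h₁ (X.d₀ m)) ∧
    (∀ m, f.f₁ m - g.f₁ m = Y.d₀ (h₁ m) + h₀ (X.d₁ m))

theorem Homotopic.refl {X Y : MBF W} (f : ClosedMap X Y) : Homotopic f f :=
  ⟨0, 0, fun m => by simp, fun m => by simp⟩

theorem Homotopic.symm {X Y : MBF W} {f g : ClosedMap X Y} (h : Homotopic f g) :
    Homotopic g f := by
  obtain ⟨h₀, h₁, e₀, e₁⟩ := h
  refine ⟨-h₀, -h₁, fun m => ?_, fun m => ?_⟩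
  · rw [← neg_sub, e₀]; simp only [LinearMap.neg_apply, map_neg]; abel
  · rw [← neg_sub, e₁]; simp only [LinearMap.neg_apply, map_neg]; abel

theorem Homotopic.trans {X Y : MBF W} {f g k : ClosedMap X Y} (h : Homotopic f g)
    (h' : Homotopic g k) : Homotopic f k := by
  obtain ⟨h₀, h₁, e₀, e₁⟩ := h
  obtain ⟨k₀, k₁, e₀', e₁'⟩ := h'
  refine ⟨h₀ + k₀, h₁ + k₁, fun m => ?_, fun m => ?_⟩
  · rw [← sub_add_sub_cancel _ (g.f₀ m), e₀, e₀']
    simp only [LinearMap.add_apply, map_add]; abel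
  · rw [← sub_add_sub_cancel _ (g.f₁ m), e₁, e₁']
    simp only [LinearMap.add_apply, map_add]; abel

theorem Homotopic.comp_left {X Y Z : MBF W} {f g : ClosedMap X Y} (k : ClosedMap Y Z)
    (h : Homotopic f g) : Homotopic (k.comp f) (k.comp g) := by
  obtain ⟨h₀, h₁, e₀, e₁⟩ := h
  refine ⟨k.f₁ ∘ₗ h₀, k.f₀ ∘ₗ h₁, fun m => ?_, fun m => ?_⟩
  · change k.f₀ (f.f₀ m) - k.f₀ (g.f₀ m) = Z.d₁ (k.f₁ (h₀ m)) + k.f₀ (h₁ (X.d₀ m))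
    rw [← map_sub, e₀, map_add, k.closed₁]
  · change k.f₁ (f.f₁ m) - k.f₁ (g.f₁ m) = Z.d₀ (k.f₀ (h₁ m)) + k.f₁ (h₀ (X.d₁ m))
    rw [← map_sub, e₁, map_add, k.closed₀]

theorem Homotopic.comp_right {X Y Z : MBF W} {f g : ClosedMap Y Z} (h : Homotopic f g)
    (k : ClosedMap X Y) : Homotopic (f.comp k) (g.comp k) := by
  obtain ⟨h₀, h₁, e₀, e₁⟩ := h
  refine ⟨h₀ ∘ₗ k.f₀, h₁ ∘ₗ k.f₁, fun m => ?_, fun m => ?_⟩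
  · change f.f₀ (k.f₀ m) - g.f₀ (k.f₀ m) = Z.d₁ (h₀ (k.f₀ m)) + h₁ (k.f₁ (X.d₀ m))
    rw [e₀, k.closed₀]
  · change f.f₁ (k.f₁ m) - g.f₁ (k.f₁ m) = Z.d₀ (h₁ (k.f₁ m)) + h₀ (k.f₀ (X.d₁ m))
    rw [e₁, k.closed₁]

def homotopySetoid (X Y : MBF W) : Setoid (ClosedMap X Y) :=
  ⟨Homotopic, Homotopic.refl, Homotopic.symm, Homotopic.trans⟩

/-- Closed even morphisms up to homotopy. -/
def HoHom (X Y : MBF W) : Type := Quotient (homotopySetoid X Y)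

def hoMk {X Y : MBF W} (f : ClosedMap X Y) : HoHom X Y := Quotient.mk (homotopySetoid X Y) f

def HoHom.comp {X Y Z : MBF W} (f : HoHom X Y) (g : HoHom Y Z) : HoHom X Z :=
  Quotient.map₂ (sa := homotopySetoid X Y) (sb := homotopySetoid Y Z) (sc := homotopySetoid X Z)
    (fun f g => g.comp f)
    (fun _ _ h _ _ h' => (h.comp_left _).trans (h'.comp_right _)) f g

/-- The homotopy category. -/
instance : Category (MBF W) where
  Hom := HoHom
  id X := hoMk (ClosedMap.id X)
  comp := HoHom.comp
  id_comp f := by induction f using Quotient.ind; rfl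
  comp_id f := by induction f using Quotient.ind; rfl
  assoc f g h := by
    induction f using Quotient.ind
    induction g using Quotient.ind
    induction h using Quotient.ind
    rfl

/-- The homotopy class of a closed even morphism. -/
def ho {X Y : MBF W} (f : ClosedMap X Y) : X ⟶ Y := hoMk f


section smul
variable {M : Type} [AddCommGroup M] [Module S M]
/-- Multiplication by `s`. -/
def mulBy (M : Type) [AddCommGroup M] [Module S M] (s : S) : M →ₗ[S] M := LinearMap.lsmul S M s
theorem mulBy_apply (s : S) (m : M) : mulBy M s m = s • m := rfl
end smul

/-- The unit object `I = (R ⊗ R, R ⊗ R, (W(a) - W(b)) / (a - b), a - b)`. -/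
def MBF.unit (W : R) : MBF W where
  X₀ := S
  X₁ := S
  d₀ := mulBy S (dd W)
  d₁ := mulBy S ab
  d₁_d₀ m := by
    rw [mulBy_apply, mulBy_apply, smul_smul, ab_mul_dd, sub_smul]
  d₀_d₁ m := by
    rw [mulBy_apply, mulBy_apply, smul_smul, mul_comm, ab_mul_dd, sub_smul]

theorem tmul_W {M N : Type} [AddCommGroup M] [Module S M] [AddCommGroup N] [Module S N] (W : R)
    (m : M) (n : N) :
    tmul ((W⊠(1 : R)) • m - ((1 : R)⊠W) • m) n + tmul m ((W⊠(1 : R)) • n - ((1 : R)⊠W) • n) =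
      (W⊠(1 : R)) • tmul m n - ((1 : R)⊠W) • tmul m n := by
  rw [sub_tmul, tmul_sub, tmul_middle, smul_one_tmul, one_smul_tmul]; abel

theorem pair_ext {A B A' B' P : Type} [AddCommGroup A] [Module S A] [AddCommGroup B] [Module S B]
    [AddCommGroup A'] [Module S A'] [AddCommGroup B'] [Module S B'] [AddCommGroup P] [Module S P]
    {f g : (BTensor A B × BTensor A' B') →ₗ[S] P} (h : ∀ a b, f (tmul a b, 0) = g (tmul a b, 0))
    (h' : ∀ a b, f (0, tmul a b) = g (0, tmul a b)) : f = g :=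
  LinearMap.prod_ext (BTensor.hom_ext h) (BTensor.hom_ext h')

theorem square_ext {A B A' B' P : Type} [AddCommGroup A] [Module S A] [AddCommGroup B] [Module S B]
    [AddCommGroup A'] [Module S A'] [AddCommGroup B'] [Module S B'] [AddCommGroup P] [Module S P]
    {W : R} {D : (BTensor A B × BTensor A' B') →ₗ[S] P}
    {D' : P →ₗ[S] (BTensor A B × BTensor A' B')}
    (h : ∀ a b, D' (D (tmul a b, 0)) =
      ((W⊠(1 : R)) • tmul a b - ((1 : R)⊠W) • tmul a b, 0))
    (h' : ∀ a b, D' (D (0, tmul a b)) =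
      (0, (W⊠(1 : R)) • tmul a b - ((1 : R)⊠W) • tmul a b))
    (m : BTensor A B × BTensor A' B') :
    D' (D m) = (W⊠(1 : R)) • m - ((1 : R)⊠W) • m := by
  have key : D' ∘ₗ D = mulBy _ (W⊠(1 : R)) - mulBy _ ((1 : R)⊠W) := by
    refine pair_ext (fun a b => (h a b).trans ?_) (fun a b => (h' a b).trans ?_)
    · simp [mulBy_apply]
    · simp [mulBy_apply]
  exact LinearMap.congr_fun key m

/-- The differential of `X ⊗ Y` on `X₀Y₀ ⊕ X₁Y₁ → X₁Y₀ ⊕ X₀Y₁`. -/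
def tensorD₀ (X Y : MBF W) : BTensor X.X₀ Y.X₀ × BTensor X.X₁ Y.X₁ →ₗ[S]
    BTensor X.X₁ Y.X₀ × BTensor X.X₀ Y.X₁ :=
  matMap (BTensor.map X.d₀ LinearMap.id) (-BTensor.map LinearMap.id Y.d₁)
    (BTensor.map LinearMap.id Y.d₀) (BTensor.map X.d₁ LinearMap.id)

/-- The differential of `X ⊗ Y` on `X₁Y₀ ⊕ X₀Y₁ → X₀Y₀ ⊕ X₁Y₁`. -/
def tensorD₁ (X Y : MBF W) : BTensor X.X₁ Y.X₀ × BTensor X.X₀ Y.X₁ →ₗ[S]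
    BTensor X.X₀ Y.X₀ × BTensor X.X₁ Y.X₁ :=
  matMap (BTensor.map X.d₁ LinearMap.id) (BTensor.map LinearMap.id Y.d₁)
    (-BTensor.map LinearMap.id Y.d₀) (BTensor.map X.d₀ LinearMap.id)

theorem tensorD₀_fst (X Y : MBF W) (m : X.X₀) (n : Y.X₀) :
    tensorD₀ X Y (tmul m n, 0) = (tmul (X.d₀ m) n, tmul m (Y.d₀ n)) := by
  simp [tensorD₀, matMap_apply]
theorem tensorD₀_snd (X Y : MBF W) (m : X.X₁) (n : Y.X₁) :
    tensorD₀ X Y (0, tmul m n) = (-tmul m (Y.d₁ n), tmul (X.d₁ m) n) := by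
  simp [tensorD₀, matMap_apply]
theorem tensorD₁_fst (X Y : MBF W) (m : X.X₁) (n : Y.X₀) :
    tensorD₁ X Y (tmul m n, 0) = (tmul (X.d₁ m) n, -tmul m (Y.d₀ n)) := by
  simp [tensorD₁, matMap_apply]
theorem tensorD₁_snd (X Y : MBF W) (m : X.X₀) (n : Y.X₁) :
    tensorD₁ X Y (0, tmul m n) = (tmul m (Y.d₁ n), tmul (X.d₀ m) n) := by
  simp [tensorD₁, matMap_apply]
theorem tensorD₀_pair (X Y : MBF W) (m : X.X₀) (n : Y.X₀) (m' : X.X₁) (n' : Y.X₁) :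
    tensorD₀ X Y (tmul m n, tmul m' n') =
      (tmul (X.d₀ m) n - tmul m' (Y.d₁ n'), tmul m (Y.d₀ n) + tmul (X.d₁ m') n') := by
  simp [tensorD₀, matMap_apply, sub_eq_add_neg]
theorem tensorD₁_pair (X Y : MBF W) (m : X.X₁) (n : Y.X₀) (m' : X.X₀) (n' : Y.X₁) :
    tensorD₁ X Y (tmul m n, tmul m' n') =
      (tmul (X.d₁ m) n + tmul m' (Y.d₁ n'), -tmul m (Y.d₀ n) + tmul (X.d₀ m') n') := by
  simp [tensorD₁, matMap_apply]

/-- The tensor product of factorisations. -/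
def MBF.tensor (X Y : MBF W) : MBF W where
  X₀ := BTensor X.X₀ Y.X₀ × BTensor X.X₁ Y.X₁
  X₁ := BTensor X.X₁ Y.X₀ × BTensor X.X₀ Y.X₁
  d₀ := tensorD₀ X Y
  d₁ := tensorD₁ X Y
  d₁_d₀ := square_ext
    (fun m n => by
      rw [tensorD₀_fst, tensorD₁_pair, X.d₁_d₀, Y.d₁_d₀, tmul_W, neg_add_cancel])
    (fun m n => by
      rw [tensorD₀_snd, ← tmul_neg, tensorD₁_pair, X.d₀_d₁, map_neg, Y.d₀_d₁, tmul_neg, tmul_neg,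
        neg_neg, neg_add_cancel, add_comm (tmul m _), tmul_W])
  d₀_d₁ := square_ext
    (fun m n => by
      rw [tensorD₁_fst, ← tmul_neg, tensorD₀_pair, X.d₀_d₁, map_neg, Y.d₁_d₀, tmul_neg, tmul_neg,
        sub_neg_eq_add, add_neg_cancel, tmul_W])
    (fun m n => by
      rw [tensorD₁_snd, tensorD₀_pair, X.d₁_d₀, Y.d₀_d₁, sub_self, add_comm (tmul m _), tmul_W])

theorem pair_apply_ext {A B A' B' P : Type} [AddCommGroup A] [Module S A] [AddCommGroup B]
    [Module S B] [AddCommGroup A'] [Module S A'] [AddCommGroup B'] [Module S B'] [AddCommGroup P]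
    [Module S P] (f g : (BTensor A B × BTensor A' B') →ₗ[S] P)
    (h : ∀ a b, f (tmul a b, 0) = g (tmul a b, 0))
    (h' : ∀ a b, f (0, tmul a b) = g (0, tmul a b)) (m : BTensor A B × BTensor A' B') :
    f m = g m := LinearMap.congr_fun (pair_ext h h') m

def tensorF₀ {X Y X' Y' : MBF W} (f : EvenMap X X') (g : EvenMap Y Y') :
    BTensor X.X₀ Y.X₀ × BTensor X.X₁ Y.X₁ →ₗ[S] BTensor X'.X₀ Y'.X₀ × BTensor X'.X₁ Y'.X₁ :=
  matMap (BTensor.map f.f₀ g.f₀) 0 0 (BTensor.map f.f₁ g.f₁)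

def tensorF₁ {X Y X' Y' : MBF W} (f : EvenMap X X') (g : EvenMap Y Y') :
    BTensor X.X₁ Y.X₀ × BTensor X.X₀ Y.X₁ →ₗ[S] BTensor X'.X₁ Y'.X₀ × BTensor X'.X₀ Y'.X₁ :=
  matMap (BTensor.map f.f₁ g.f₀) 0 0 (BTensor.map f.f₀ g.f₁)

/-- The tensor product of even morphisms. -/
def EvenMap.tensor {X Y X' Y' : MBF W} (f : EvenMap X X') (g : EvenMap Y Y') :
    EvenMap (X.tensor Y) (X'.tensor Y') where
  f₀ := tensorF₀ f g
  f₁ := tensorF₁ f g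

/-- The tensor product of closed even morphisms. -/
def ClosedMap.tensor {X Y X' Y' : MBF W} (f : ClosedMap X X') (g : ClosedMap Y Y') :
    ClosedMap (X.tensor Y) (X'.tensor Y') where
  toEvenMap := f.toEvenMap.tensor g.toEvenMap
  closed₀ := pair_apply_ext (tensorD₀ X' Y' ∘ₗ tensorF₀ f.toEvenMap g.toEvenMap)
    (tensorF₁ f.toEvenMap g.toEvenMap ∘ₗ tensorD₀ X Y)
    (fun m n => by
      simp [tensorD₀, tensorF₀, tensorF₁, matMap_apply, f.closed₀, g.closed₀])
    (fun m n => by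
      simp [tensorD₀, tensorF₀, tensorF₁, matMap_apply, f.closed₁, g.closed₁])
  closed₁ := pair_apply_ext (tensorD₁ X' Y' ∘ₗ tensorF₁ f.toEvenMap g.toEvenMap)
    (tensorF₀ f.toEvenMap g.toEvenMap ∘ₗ tensorD₁ X Y)
    (fun m n => by
      simp [tensorD₁, tensorF₀, tensorF₁, matMap_apply, f.closed₁, g.closed₀])
    (fun m n => by
      simp [tensorD₁, tensorF₀, tensorF₁, matMap_apply, f.closed₀, g.closed₁])

theorem sub_tmul_tmul {M N : Type} [AddCommGroup M] [Module S M] [AddCommGroup N] [Module S N]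
    (a a' : M) (b : N) : tmul a b - tmul a' b = tmul (a - a') b := (sub_tmul _ _ _).symm
theorem tmul_sub_tmul {M N : Type} [AddCommGroup M] [Module S M] [AddCommGroup N] [Module S N]
    (a : M) (b b' : N) : tmul a b - tmul a b' = tmul a (b - b') := (tmul_sub _ _ _).symm

theorem Homotopic.tensor_left {X Y X' Y' : MBF W} {f f' : ClosedMap X X'} (h : Homotopic f f')
    (g : ClosedMap Y Y') : Homotopic (f.tensor g) (f'.tensor g) := by
  obtain ⟨h₀, h₁, e₀, e₁⟩ := h
  let k₀ : BTensor X.X₀ Y.X₀ × BTensor X.X₁ Y.X₁ →ₗ[S] BTensor X'.X₁ Y'.X₀ × BTensor X'.X₀ Y'.X₁ :=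
    matMap (BTensor.map h₀ g.f₀) 0 0 (BTensor.map h₁ g.f₁)
  let k₁ : BTensor X.X₁ Y.X₀ × BTensor X.X₀ Y.X₁ →ₗ[S] BTensor X'.X₀ Y'.X₀ × BTensor X'.X₁ Y'.X₁ :=
    matMap (BTensor.map h₁ g.f₀) 0 0 (BTensor.map h₀ g.f₁)
  exact ⟨k₀, k₁,
    pair_apply_ext (tensorF₀ f.toEvenMap g.toEvenMap - tensorF₀ f'.toEvenMap g.toEvenMap)
      (tensorD₁ X' Y' ∘ₗ k₀ + k₁ ∘ₗ tensorD₀ X Y)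
      (fun m n => by
        simp [k₀, k₁, tensorD₀, tensorD₁, tensorF₀, tensorF₁, matMap_apply, g.closed₀, sub_tmul_tmul,
          e₀, add_tmul])
      (fun m n => by
        simp [k₀, k₁, tensorD₀, tensorD₁, tensorF₀, tensorF₁, matMap_apply, g.closed₁, sub_tmul_tmul,
          e₁, add_tmul]),
    pair_apply_ext (tensorF₁ f.toEvenMap g.toEvenMap - tensorF₁ f'.toEvenMap g.toEvenMap)
      (tensorD₀ X' Y' ∘ₗ k₁ + k₀ ∘ₗ tensorD₁ X Y)
      (fun m n => by
        simp [k₀, k₁, tensorD₀, tensorD₁, tensorF₀, tensorF₁, matMap_apply, g.closed₀, sub_tmul_tmul,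
          e₁, add_tmul])
      (fun m n => by
        simp [k₀, k₁, tensorD₀, tensorD₁, tensorF₀, tensorF₁, matMap_apply, g.closed₁, sub_tmul_tmul,
          e₀, add_tmul])⟩

theorem Homotopic.tensor_right {X Y X' Y' : MBF W} (f : ClosedMap X X') {g g' : ClosedMap Y Y'}
    (h : Homotopic g g') : Homotopic (f.tensor g) (f.tensor g') := by
  obtain ⟨h₀, h₁, e₀, e₁⟩ := h
  let k₀ : BTensor X.X₀ Y.X₀ × BTensor X.X₁ Y.X₁ →ₗ[S] BTensor X'.X₁ Y'.X₀ × BTensor X'.X₀ Y'.X₁ :=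
    matMap 0 (-BTensor.map f.f₁ h₁) (BTensor.map f.f₀ h₀) 0
  let k₁ : BTensor X.X₁ Y.X₀ × BTensor X.X₀ Y.X₁ →ₗ[S] BTensor X'.X₀ Y'.X₀ × BTensor X'.X₁ Y'.X₁ :=
    matMap 0 (BTensor.map f.f₀ h₁) (-BTensor.map f.f₁ h₀) 0
  exact ⟨k₀, k₁,
    pair_apply_ext (tensorF₀ f.toEvenMap g.toEvenMap - tensorF₀ f.toEvenMap g'.toEvenMap)
      (tensorD₁ X' Y' ∘ₗ k₀ + k₁ ∘ₗ tensorD₀ X Y)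
      (fun m n => by
        simp [k₀, k₁, tensorD₀, tensorD₁, tensorF₀, tensorF₁, matMap_apply, f.closed₀, tmul_sub_tmul,
          e₀, tmul_add])
      (fun m n => by
        simp [k₀, k₁, tensorD₀, tensorD₁, tensorF₀, tensorF₁, matMap_apply, f.closed₁, tmul_sub_tmul,
          e₁, tmul_add]),
    pair_apply_ext (tensorF₁ f.toEvenMap g.toEvenMap - tensorF₁ f.toEvenMap g'.toEvenMap)
      (tensorD₀ X' Y' ∘ₗ k₁ + k₀ ∘ₗ tensorD₁ X Y)
      (fun m n => by
        simp [k₀, k₁, tensorD₀, tensorD₁, tensorF₀, tensorF₁, matMap_apply, f.closed₁, tmul_sub_tmul,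
          e₀, tmul_add])
      (fun m n => by
        simp [k₀, k₁, tensorD₀, tensorD₁, tensorF₀, tensorF₁, matMap_apply, f.closed₀, tmul_sub_tmul,
          e₁, tmul_add])⟩

/-- The tensor product on the homotopy category. -/
def tensorHom {X Y X' Y' : MBF W} (f : X ⟶ X') (g : Y ⟶ Y') : X.tensor Y ⟶ X'.tensor Y' :=
  Quotient.map₂ (sa := homotopySetoid X X') (sb := homotopySetoid Y Y')
    (sc := homotopySetoid (X.tensor Y) (X'.tensor Y')) (fun f g => f.tensor g)
    (fun _ _ h _ _ h' => (h.tensor_left _).trans (h'.tensor_right _)) f g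

section Assoc
variable {A B C D E F G H K L : Type}
  [AddCommGroup A] [Module S A] [AddCommGroup B] [Module S B]
  [AddCommGroup C] [Module S C] [AddCommGroup D] [Module S D]
  [AddCommGroup E] [Module S E] [AddCommGroup F] [Module S F]
  [AddCommGroup G] [Module S G] [AddCommGroup H] [Module S H]
  [AddCommGroup K] [Module S K] [AddCommGroup L] [Module S L]
  {P' : Type} [AddCommGroup P'] [Module S P']

/-- The rearrangement of `((AC ⊕ BD)E) ⊕ ((BC ⊕ AD)F)` into `A(CE ⊕ DF) ⊕ B(DE ⊕ CF)`. -/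
def assocMat (A B C D E F : Type)
    [AddCommGroup A] [Module S A] [AddCommGroup B] [Module S B]
    [AddCommGroup C] [Module S C] [AddCommGroup D] [Module S D]
    [AddCommGroup E] [Module S E] [AddCommGroup F] [Module S F] :
    BTensor (BTensor A C × BTensor B D) E × BTensor (BTensor B C × BTensor A D) F →ₗ[S]
      BTensor A (BTensor C E × BTensor D F) × BTensor B (BTensor D E × BTensor C F) :=
  matMap
    (BTensor.map LinearMap.id (LinearMap.inl S _ _) ∘ₗ assocFun ∘ₗ
      BTensor.map (LinearMap.fst S _ _) LinearMap.id)
    (BTensor.map LinearMap.id (LinearMap.inr S _ _) ∘ₗ assocFun ∘ₗ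
      BTensor.map (LinearMap.snd S _ _) LinearMap.id)
    (BTensor.map LinearMap.id (LinearMap.inl S _ _) ∘ₗ assocFun ∘ₗ
      BTensor.map (LinearMap.snd S _ _) LinearMap.id)
    (BTensor.map LinearMap.id (LinearMap.inr S _ _) ∘ₗ assocFun ∘ₗ
      BTensor.map (LinearMap.fst S _ _) LinearMap.id)

/-- The inverse rearrangement. -/
def assocInvMat (A B C D E F : Type)
    [AddCommGroup A] [Module S A] [AddCommGroup B] [Module S B]
    [AddCommGroup C] [Module S C] [AddCommGroup D] [Module S D]
    [AddCommGroup E] [Module S E] [AddCommGroup F] [Module S F] :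
    BTensor A (BTensor C E × BTensor D F) × BTensor B (BTensor D E × BTensor C F) →ₗ[S]
      BTensor (BTensor A C × BTensor B D) E × BTensor (BTensor B C × BTensor A D) F :=
  matMap
    (BTensor.map (LinearMap.inl S _ _) LinearMap.id ∘ₗ assocInv ∘ₗ
      BTensor.map LinearMap.id (LinearMap.fst S _ _))
    (BTensor.map (LinearMap.inr S _ _) LinearMap.id ∘ₗ assocInv ∘ₗ
      BTensor.map LinearMap.id (LinearMap.fst S _ _))
    (BTensor.map (LinearMap.inr S _ _) LinearMap.id ∘ₗ assocInv ∘ₗ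
      BTensor.map LinearMap.id (LinearMap.snd S _ _))
    (BTensor.map (LinearMap.inl S _ _) LinearMap.id ∘ₗ assocInv ∘ₗ
      BTensor.map LinearMap.id (LinearMap.snd S _ _))

theorem left_prod_ext {f g : BTensor (BTensor A B × BTensor C D) E →ₗ[S] F}
    (h : ∀ a b e, f (tmul (tmul a b, 0) e) = g (tmul (tmul a b, 0) e))
    (h' : ∀ c d e, f (tmul (0, tmul c d) e) = g (tmul (0, tmul c d) e)) : f = g := by
  refine BTensor.hom_ext fun m e => ?_
  obtain ⟨p, q⟩ := m
  have hp : f (tmul (p, 0) e) = g (tmul (p, 0) e) := by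
    induction p using BTensor.induct with
    | h0 => simp only [Prod.mk_zero_zero, zero_tmul, map_zero]
    | ht a b => exact h a b e
    | ha x y hx hy =>
      have : ((x + y, 0) : BTensor A B × BTensor C D) = (x, 0) + (y, 0) := by simp
      rw [this, add_tmul, map_add, map_add, hx, hy]
  have hq : f (tmul (0, q) e) = g (tmul (0, q) e) := by
    induction q using BTensor.induct with
    | h0 => simp only [Prod.mk_zero_zero, zero_tmul, map_zero]
    | ht a b => exact h' a b e
    | ha x y hx hy =>
      have : ((0, x + y) : BTensor A B × BTensor C D) = (0, x) + (0, y) := by simp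
      rw [this, add_tmul, map_add, map_add, hx, hy]
  have : ((p, q) : BTensor A B × BTensor C D) = (p, 0) + (0, q) := by simp
  rw [this, add_tmul, map_add, map_add, hp, hq]

theorem right_prod_ext {f g : BTensor E (BTensor A B × BTensor C D) →ₗ[S] F}
    (h : ∀ e a b, f (tmul e (tmul a b, 0)) = g (tmul e (tmul a b, 0)))
    (h' : ∀ e c d, f (tmul e (0, tmul c d)) = g (tmul e (0, tmul c d))) : f = g := by
  refine BTensor.hom_ext fun e m => ?_
  obtain ⟨p, q⟩ := m
  have hp : f (tmul e (p, 0)) = g (tmul e (p, 0)) := by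
    induction p using BTensor.induct with
    | h0 => simp only [Prod.mk_zero_zero, tmul_zero, map_zero]
    | ht a b => exact h e a b
    | ha x y hx hy =>
      have : ((x + y, 0) : BTensor A B × BTensor C D) = (x, 0) + (y, 0) := by simp
      rw [this, tmul_add, map_add, map_add, hx, hy]
  have hq : f (tmul e (0, q)) = g (tmul e (0, q)) := by
    induction q using BTensor.induct with
    | h0 => simp only [Prod.mk_zero_zero, tmul_zero, map_zero]
    | ht a b => exact h' e a b
    | ha x y hx hy =>
      have : ((0, x + y) : BTensor A B × BTensor C D) = (0, x) + (0, y) := by simp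
      rw [this, tmul_add, map_add, map_add, hx, hy]
  have : ((p, q) : BTensor A B × BTensor C D) = (p, 0) + (0, q) := by simp
  rw [this, tmul_add, map_add, map_add, hp, hq]

theorem left_pair_apply_ext
    (f g : (BTensor (BTensor A B × BTensor C D) E × BTensor (BTensor F G × BTensor H K) L)
      →ₗ[S] P')
    (h₁ : ∀ a b e, f (tmul (tmul a b, 0) e, 0) = g (tmul (tmul a b, 0) e, 0))
    (h₂ : ∀ a b e, f (tmul (0, tmul a b) e, 0) = g (tmul (0, tmul a b) e, 0))
    (h₃ : ∀ a b e, f (0, tmul (tmul a b, 0) e) = g (0, tmul (tmul a b, 0) e))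
    (h₄ : ∀ a b e, f (0, tmul (0, tmul a b) e) = g (0, tmul (0, tmul a b) e))
    (m : BTensor (BTensor A B × BTensor C D) E × BTensor (BTensor F G × BTensor H K) L) :
    f m = g m :=
  LinearMap.congr_fun (LinearMap.prod_ext (left_prod_ext h₁ h₂) (left_prod_ext h₃ h₄)) m

theorem right_pair_apply_ext
    (f g : (BTensor E (BTensor A B × BTensor C D) × BTensor L (BTensor F G × BTensor H K))
      →ₗ[S] P')
    (h₁ : ∀ e a b, f (tmul e (tmul a b, 0), 0) = g (tmul e (tmul a b, 0), 0))
    (h₂ : ∀ e a b, f (tmul e (0, tmul a b), 0) = g (tmul e (0, tmul a b), 0))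
    (h₃ : ∀ e a b, f (0, tmul e (tmul a b, 0)) = g (0, tmul e (tmul a b, 0)))
    (h₄ : ∀ e a b, f (0, tmul e (0, tmul a b)) = g (0, tmul e (0, tmul a b)))
    (m : BTensor E (BTensor A B × BTensor C D) × BTensor L (BTensor F G × BTensor H K)) :
    f m = g m :=
  LinearMap.congr_fun (LinearMap.prod_ext (right_prod_ext h₁ h₂) (right_prod_ext h₃ h₄)) m
end Assoc

def bigD₀ (X Y Z : MBF W) :
    BTensor (BTensor X.X₀ Y.X₀ × BTensor X.X₁ Y.X₁) Z.X₀ ×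
      BTensor (BTensor X.X₁ Y.X₀ × BTensor X.X₀ Y.X₁) Z.X₁ →ₗ[S]
    BTensor (BTensor X.X₁ Y.X₀ × BTensor X.X₀ Y.X₁) Z.X₀ ×
      BTensor (BTensor X.X₀ Y.X₀ × BTensor X.X₁ Y.X₁) Z.X₁ :=
  matMap (BTensor.map (tensorD₀ X Y) LinearMap.id) (-BTensor.map LinearMap.id Z.d₁)
    (BTensor.map LinearMap.id Z.d₀) (BTensor.map (tensorD₁ X Y) LinearMap.id)

def bigD₁ (X Y Z : MBF W) :
    BTensor (BTensor X.X₁ Y.X₀ × BTensor X.X₀ Y.X₁) Z.X₀ ×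
      BTensor (BTensor X.X₀ Y.X₀ × BTensor X.X₁ Y.X₁) Z.X₁ →ₗ[S]
    BTensor (BTensor X.X₀ Y.X₀ × BTensor X.X₁ Y.X₁) Z.X₀ ×
      BTensor (BTensor X.X₁ Y.X₀ × BTensor X.X₀ Y.X₁) Z.X₁ :=
  matMap (BTensor.map (tensorD₁ X Y) LinearMap.id) (BTensor.map LinearMap.id Z.d₁)
    (-BTensor.map LinearMap.id Z.d₀) (BTensor.map (tensorD₀ X Y) LinearMap.id)

def bigD'₀ (X Y Z : MBF W) :
    BTensor X.X₀ (BTensor Y.X₀ Z.X₀ × BTensor Y.X₁ Z.X₁) ×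
      BTensor X.X₁ (BTensor Y.X₁ Z.X₀ × BTensor Y.X₀ Z.X₁) →ₗ[S]
    BTensor X.X₁ (BTensor Y.X₀ Z.X₀ × BTensor Y.X₁ Z.X₁) ×
      BTensor X.X₀ (BTensor Y.X₁ Z.X₀ × BTensor Y.X₀ Z.X₁) :=
  matMap (BTensor.map X.d₀ LinearMap.id) (-BTensor.map LinearMap.id (tensorD₁ Y Z))
    (BTensor.map LinearMap.id (tensorD₀ Y Z)) (BTensor.map X.d₁ LinearMap.id)

def bigD'₁ (X Y Z : MBF W) :
    BTensor X.X₁ (BTensor Y.X₀ Z.X₀ × BTensor Y.X₁ Z.X₁) ×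
      BTensor X.X₀ (BTensor Y.X₁ Z.X₀ × BTensor Y.X₀ Z.X₁) →ₗ[S]
    BTensor X.X₀ (BTensor Y.X₀ Z.X₀ × BTensor Y.X₁ Z.X₁) ×
      BTensor X.X₁ (BTensor Y.X₁ Z.X₀ × BTensor Y.X₀ Z.X₁) :=
  matMap (BTensor.map X.d₁ LinearMap.id) (BTensor.map LinearMap.id (tensorD₁ Y Z))
    (-BTensor.map LinearMap.id (tensorD₀ Y Z)) (BTensor.map X.d₀ LinearMap.id)

theorem mk_zero_tmul_left {A B C : Type} [AddCommGroup A] [Module S A] [AddCommGroup B] [Module S B]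
   [AddCommGroup C] [Module S C] (a : A) (b : B) (c : C) :
   tmul (a, b) c = tmul (a, 0) c + tmul (0, b) c := by
  rw [← add_tmul]; simp

theorem mk_zero_tmul_right {A B C : Type} [AddCommGroup A] [Module S A] [AddCommGroup B] [Module S B]
   [AddCommGroup C] [Module S C] (a : A) (b : B) (c : C) :
   tmul c (a, b) = tmul c (a, 0) + tmul c (0, b) := by
  rw [← tmul_add]; simp

/-- The associator `α`. -/
def assocMap (X Y Z : MBF W) : ClosedMap ((X.tensor Y).tensor Z) (X.tensor (Y.tensor Z)) where
  f₀ := assocMat X.X₀ X.X₁ Y.X₀ Y.X₁ Z.X₀ Z.X₁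
  f₁ := assocMat X.X₁ X.X₀ Y.X₀ Y.X₁ Z.X₀ Z.X₁
  closed₀ := left_pair_apply_ext
    (bigD'₀ X Y Z ∘ₗ assocMat X.X₀ X.X₁ Y.X₀ Y.X₁ Z.X₀ Z.X₁)
    (assocMat X.X₁ X.X₀ Y.X₀ Y.X₁ Z.X₀ Z.X₁ ∘ₗ bigD₀ X Y Z)
    (fun a b e => by
      simp only [assocMat, bigD₀, bigD'₀, LinearMap.comp_apply, matMap_apply, map_zero, add_zero,
        zero_add, BTensor.map_tmul, LinearMap.fst_apply, LinearMap.snd_apply, LinearMap.inl_apply,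
        LinearMap.inr_apply, LinearMap.id_apply, assocFun_tmul, assocInv_tmul, tensorD₀_fst,
        tensorD₁_fst, tensorD₀_snd, tensorD₁_snd, LinearMap.neg_apply, neg_zero, zero_tmul,
        tmul_zero, neg_tmul, tmul_neg, map_neg]
      simp only [← tmul_neg, ← tmul_add, Prod.neg_mk, Prod.mk_add_mk, add_zero, zero_add, neg_zero,
        neg_neg])
    (fun a b e => by
      simp only [assocMat, bigD₀, bigD'₀, LinearMap.comp_apply, matMap_apply, map_zero, add_zero,
        zero_add, BTensor.map_tmul, LinearMap.fst_apply, LinearMap.snd_apply, LinearMap.inl_apply,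
        LinearMap.inr_apply, LinearMap.id_apply, assocFun_tmul, assocInv_tmul, tensorD₀_fst,
        tensorD₁_fst, tensorD₀_snd, tensorD₁_snd, LinearMap.neg_apply, neg_zero, zero_tmul,
        tmul_zero, neg_tmul, tmul_neg, map_neg]
      simp only [← tmul_neg, ← tmul_add, Prod.neg_mk, Prod.mk_add_mk, add_zero, zero_add, neg_zero,
        neg_neg])
    (fun a b e => by
      simp only [assocMat, bigD₀, bigD'₀, LinearMap.comp_apply, matMap_apply, map_zero, add_zero,
        zero_add, BTensor.map_tmul, LinearMap.fst_apply, LinearMap.snd_apply, LinearMap.inl_apply,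
        LinearMap.inr_apply, LinearMap.id_apply, assocFun_tmul, assocInv_tmul, tensorD₀_fst,
        tensorD₁_fst, tensorD₀_snd, tensorD₁_snd, LinearMap.neg_apply, neg_zero, zero_tmul,
        tmul_zero, neg_tmul, tmul_neg, map_neg]
      simp only [← tmul_neg, ← tmul_add, Prod.neg_mk, Prod.mk_add_mk, add_zero, zero_add, neg_zero,
        neg_neg])
    (fun a b e => by
      simp only [assocMat, bigD₀, bigD'₀, LinearMap.comp_apply, matMap_apply, map_zero, add_zero,
        zero_add, BTensor.map_tmul, LinearMap.fst_apply, LinearMap.snd_apply, LinearMap.inl_apply,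
        LinearMap.inr_apply, LinearMap.id_apply, assocFun_tmul, assocInv_tmul, tensorD₀_fst,
        tensorD₁_fst, tensorD₀_snd, tensorD₁_snd, LinearMap.neg_apply, neg_zero, zero_tmul,
        tmul_zero, neg_tmul, tmul_neg, map_neg]
      simp only [← tmul_neg, ← tmul_add, Prod.neg_mk, Prod.mk_add_mk, add_zero, zero_add, neg_zero,
        neg_neg])
  closed₁ := left_pair_apply_ext
    (bigD'₁ X Y Z ∘ₗ assocMat X.X₁ X.X₀ Y.X₀ Y.X₁ Z.X₀ Z.X₁)
    (assocMat X.X₀ X.X₁ Y.X₀ Y.X₁ Z.X₀ Z.X₁ ∘ₗ bigD₁ X Y Z)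
    (fun a b e => by
      simp only [assocMat, bigD₁, bigD'₁, LinearMap.comp_apply, matMap_apply, map_zero, add_zero,
        zero_add, BTensor.map_tmul, LinearMap.fst_apply, LinearMap.snd_apply, LinearMap.inl_apply,
        LinearMap.inr_apply, LinearMap.id_apply, assocFun_tmul, assocInv_tmul, tensorD₀_fst,
        tensorD₁_fst, tensorD₀_snd, tensorD₁_snd, LinearMap.neg_apply, neg_zero, zero_tmul,
        tmul_zero, neg_tmul, tmul_neg, map_neg]
      simp only [← tmul_neg, ← tmul_add, Prod.neg_mk, Prod.mk_add_mk, add_zero, zero_add, neg_zero,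
        neg_neg])
    (fun a b e => by
      simp only [assocMat, bigD₁, bigD'₁, LinearMap.comp_apply, matMap_apply, map_zero, add_zero,
        zero_add, BTensor.map_tmul, LinearMap.fst_apply, LinearMap.snd_apply, LinearMap.inl_apply,
        LinearMap.inr_apply, LinearMap.id_apply, assocFun_tmul, assocInv_tmul, tensorD₀_fst,
        tensorD₁_fst, tensorD₀_snd, tensorD₁_snd, LinearMap.neg_apply, neg_zero, zero_tmul,
        tmul_zero, neg_tmul, tmul_neg, map_neg]
      simp only [← tmul_neg, ← tmul_add, Prod.neg_mk, Prod.mk_add_mk, add_zero, zero_add, neg_zero,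
        neg_neg])
    (fun a b e => by
      simp only [assocMat, bigD₁, bigD'₁, LinearMap.comp_apply, matMap_apply, map_zero, add_zero,
        zero_add, BTensor.map_tmul, LinearMap.fst_apply, LinearMap.snd_apply, LinearMap.inl_apply,
        LinearMap.inr_apply, LinearMap.id_apply, assocFun_tmul, assocInv_tmul, tensorD₀_fst,
        tensorD₁_fst, tensorD₀_snd, tensorD₁_snd, LinearMap.neg_apply, neg_zero, zero_tmul,
        tmul_zero, neg_tmul, tmul_neg, map_neg]
      simp only [← tmul_neg, ← tmul_add, Prod.neg_mk, Prod.mk_add_mk, add_zero, zero_add, neg_zero,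
        neg_neg])
    (fun a b e => by
      simp only [assocMat, bigD₁, bigD'₁, LinearMap.comp_apply, matMap_apply, map_zero, add_zero,
        zero_add, BTensor.map_tmul, LinearMap.fst_apply, LinearMap.snd_apply, LinearMap.inl_apply,
        LinearMap.inr_apply, LinearMap.id_apply, assocFun_tmul, assocInv_tmul, tensorD₀_fst,
        tensorD₁_fst, tensorD₀_snd, tensorD₁_snd, LinearMap.neg_apply, neg_zero, zero_tmul,
        tmul_zero, neg_tmul, tmul_neg, map_neg]
      simp only [← tmul_neg, ← tmul_add, Prod.neg_mk, Prod.mk_add_mk, add_zero, zero_add, neg_zero,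
        neg_neg])

/-- The inverse associator. -/
def assocInvMap (X Y Z : MBF W) : ClosedMap (X.tensor (Y.tensor Z)) ((X.tensor Y).tensor Z) where
  f₀ := assocInvMat X.X₀ X.X₁ Y.X₀ Y.X₁ Z.X₀ Z.X₁
  f₁ := assocInvMat X.X₁ X.X₀ Y.X₀ Y.X₁ Z.X₀ Z.X₁
  closed₀ := right_pair_apply_ext
    (bigD₀ X Y Z ∘ₗ assocInvMat X.X₀ X.X₁ Y.X₀ Y.X₁ Z.X₀ Z.X₁)
    (assocInvMat X.X₁ X.X₀ Y.X₀ Y.X₁ Z.X₀ Z.X₁ ∘ₗ bigD'₀ X Y Z)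
    (fun a b e => by
      simp only [assocInvMat, bigD₀, bigD'₀, LinearMap.comp_apply, matMap_apply, map_zero, add_zero,
        zero_add, BTensor.map_tmul, LinearMap.fst_apply, LinearMap.snd_apply, LinearMap.inl_apply,
        LinearMap.inr_apply, LinearMap.id_apply, assocFun_tmul, assocInv_tmul, tensorD₀_fst,
        tensorD₁_fst, tensorD₀_snd, tensorD₁_snd, LinearMap.neg_apply, neg_zero, zero_tmul,
        tmul_zero, neg_tmul, tmul_neg, map_neg]
      simp only [← neg_tmul, ← add_tmul, Prod.neg_mk, Prod.mk_add_mk, add_zero, zero_add, neg_zero,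
        neg_neg])
    (fun a b e => by
      simp only [assocInvMat, bigD₀, bigD'₀, LinearMap.comp_apply, matMap_apply, map_zero, add_zero,
        zero_add, BTensor.map_tmul, LinearMap.fst_apply, LinearMap.snd_apply, LinearMap.inl_apply,
        LinearMap.inr_apply, LinearMap.id_apply, assocFun_tmul, assocInv_tmul, tensorD₀_fst,
        tensorD₁_fst, tensorD₀_snd, tensorD₁_snd, LinearMap.neg_apply, neg_zero, zero_tmul,
        tmul_zero, neg_tmul, tmul_neg, map_neg]
      simp only [← neg_tmul, ← add_tmul, Prod.neg_mk, Prod.mk_add_mk, add_zero, zero_add, neg_zero,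
        neg_neg])
    (fun a b e => by
      simp only [assocInvMat, bigD₀, bigD'₀, LinearMap.comp_apply, matMap_apply, map_zero, add_zero,
        zero_add, BTensor.map_tmul, LinearMap.fst_apply, LinearMap.snd_apply, LinearMap.inl_apply,
        LinearMap.inr_apply, LinearMap.id_apply, assocFun_tmul, assocInv_tmul, tensorD₀_fst,
        tensorD₁_fst, tensorD₀_snd, tensorD₁_snd, LinearMap.neg_apply, neg_zero, zero_tmul,
        tmul_zero, neg_tmul, tmul_neg, map_neg]
      simp only [← neg_tmul, ← add_tmul, Prod.neg_mk, Prod.mk_add_mk, add_zero, zero_add, neg_zero,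
        neg_neg])
    (fun a b e => by
      simp only [assocInvMat, bigD₀, bigD'₀, LinearMap.comp_apply, matMap_apply, map_zero, add_zero,
        zero_add, BTensor.map_tmul, LinearMap.fst_apply, LinearMap.snd_apply, LinearMap.inl_apply,
        LinearMap.inr_apply, LinearMap.id_apply, assocFun_tmul, assocInv_tmul, tensorD₀_fst,
        tensorD₁_fst, tensorD₀_snd, tensorD₁_snd, LinearMap.neg_apply, neg_zero, zero_tmul,
        tmul_zero, neg_tmul, tmul_neg, map_neg]
      simp only [← neg_tmul, ← add_tmul, Prod.neg_mk, Prod.mk_add_mk, add_zero, zero_add, neg_zero,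
        neg_neg])
  closed₁ := right_pair_apply_ext
    (bigD₁ X Y Z ∘ₗ assocInvMat X.X₁ X.X₀ Y.X₀ Y.X₁ Z.X₀ Z.X₁)
    (assocInvMat X.X₀ X.X₁ Y.X₀ Y.X₁ Z.X₀ Z.X₁ ∘ₗ bigD'₁ X Y Z)
    (fun a b e => by
      simp only [assocInvMat, bigD₁, bigD'₁, LinearMap.comp_apply, matMap_apply, map_zero, add_zero,
        zero_add, BTensor.map_tmul, LinearMap.fst_apply, LinearMap.snd_apply, LinearMap.inl_apply,
        LinearMap.inr_apply, LinearMap.id_apply, assocFun_tmul, assocInv_tmul, tensorD₀_fst,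
        tensorD₁_fst, tensorD₀_snd, tensorD₁_snd, LinearMap.neg_apply, neg_zero, zero_tmul,
        tmul_zero, neg_tmul, tmul_neg, map_neg]
      simp only [← neg_tmul, ← add_tmul, Prod.neg_mk, Prod.mk_add_mk, add_zero, zero_add, neg_zero,
        neg_neg])
    (fun a b e => by
      simp only [assocInvMat, bigD₁, bigD'₁, LinearMap.comp_apply, matMap_apply, map_zero, add_zero,
        zero_add, BTensor.map_tmul, LinearMap.fst_apply, LinearMap.snd_apply, LinearMap.inl_apply,
        LinearMap.inr_apply, LinearMap.id_apply, assocFun_tmul, assocInv_tmul, tensorD₀_fst,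
        tensorD₁_fst, tensorD₀_snd, tensorD₁_snd, LinearMap.neg_apply, neg_zero, zero_tmul,
        tmul_zero, neg_tmul, tmul_neg, map_neg]
      simp only [← neg_tmul, ← add_tmul, Prod.neg_mk, Prod.mk_add_mk, add_zero, zero_add, neg_zero,
        neg_neg])
    (fun a b e => by
      simp only [assocInvMat, bigD₁, bigD'₁, LinearMap.comp_apply, matMap_apply, map_zero, add_zero,
        zero_add, BTensor.map_tmul, LinearMap.fst_apply, LinearMap.snd_apply, LinearMap.inl_apply,
        LinearMap.inr_apply, LinearMap.id_apply, assocFun_tmul, assocInv_tmul, tensorD₀_fst,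
        tensorD₁_fst, tensorD₀_snd, tensorD₁_snd, LinearMap.neg_apply, neg_zero, zero_tmul,
        tmul_zero, neg_tmul, tmul_neg, map_neg]
      simp only [← neg_tmul, ← add_tmul, Prod.neg_mk, Prod.mk_add_mk, add_zero, zero_add, neg_zero,
        neg_neg])
    (fun a b e => by
      simp only [assocInvMat, bigD₁, bigD'₁, LinearMap.comp_apply, matMap_apply, map_zero, add_zero,
        zero_add, BTensor.map_tmul, LinearMap.fst_apply, LinearMap.snd_apply, LinearMap.inl_apply,
        LinearMap.inr_apply, LinearMap.id_apply, assocFun_tmul, assocInv_tmul, tensorD₀_fst,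
        tensorD₁_fst, tensorD₀_snd, tensorD₁_snd, LinearMap.neg_apply, neg_zero, zero_tmul,
        tmul_zero, neg_tmul, tmul_neg, map_neg]
      simp only [← neg_tmul, ← add_tmul, Prod.neg_mk, Prod.mk_add_mk, add_zero, zero_add, neg_zero,
        neg_neg])


theorem mu_ab : mu ab = 0 := by
  rw [ab, map_sub, mu_tmul, mu_tmul, mul_one, one_mul, sub_self]

theorem lUnit_tmul {M : Type} [AddCommGroup M] [Module S M] (s : S) (m : M) :
    lUnit M (tmul s m) = ((mu s)⊠(1 : R)) • m := rfl
theorem rUnit_tmul {M : Type} [AddCommGroup M] [Module S M] (m : M) (s : S) :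
    rUnit M (tmul m s) = ((1 : R)⊠(mu s)) • m := rfl

/-- The left unit map `λ`. -/
def lamMap (X : MBF W) : ClosedMap ((MBF.unit W).tensor X) X where
  f₀ := lUnit X.X₀ ∘ₗ LinearMap.fst S (BTensor S X.X₀) (BTensor S X.X₁)
  f₁ := lUnit X.X₁ ∘ₗ LinearMap.snd S (BTensor S X.X₀) (BTensor S X.X₁)
  closed₀ := pair_apply_ext
    (X.d₀ ∘ₗ lUnit X.X₀ ∘ₗ LinearMap.fst S (BTensor S X.X₀) (BTensor S X.X₁))
    ((lUnit X.X₁ ∘ₗ LinearMap.snd S (BTensor S X.X₀) (BTensor S X.X₁)) ∘ₗ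
      matMap (BTensor.map (mulBy S (dd W)) LinearMap.id) (-BTensor.map LinearMap.id X.d₁)
        (BTensor.map LinearMap.id X.d₀) (BTensor.map (mulBy S ab) LinearMap.id))
    (fun m n => by
      simp [matMap_apply, mulBy_apply, lUnit_tmul])
    (fun m n => by
      simp [matMap_apply, mulBy_apply, lUnit_tmul, mu_ab, zero_el])
  closed₁ := pair_apply_ext
    (X.d₁ ∘ₗ lUnit X.X₁ ∘ₗ LinearMap.snd S (BTensor S X.X₀) (BTensor S X.X₁))
    ((lUnit X.X₀ ∘ₗ LinearMap.fst S (BTensor S X.X₀) (BTensor S X.X₁)) ∘ₗ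
      matMap (BTensor.map (mulBy S ab) LinearMap.id) (BTensor.map LinearMap.id X.d₁)
        (-BTensor.map LinearMap.id X.d₀) (BTensor.map (mulBy S (dd W)) LinearMap.id))
    (fun m n => by
      simp [matMap_apply, mulBy_apply, lUnit_tmul, mu_ab, zero_el])
    (fun m n => by
      simp [matMap_apply, mulBy_apply, lUnit_tmul])

/-- The right unit map `ρ`. -/
def rhoMap (X : MBF W) : ClosedMap (X.tensor (MBF.unit W)) X where
  f₀ := rUnit X.X₀ ∘ₗ LinearMap.fst S (BTensor X.X₀ S) (BTensor X.X₁ S)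
  f₁ := rUnit X.X₁ ∘ₗ LinearMap.fst S (BTensor X.X₁ S) (BTensor X.X₀ S)
  closed₀ := pair_apply_ext
    (X.d₀ ∘ₗ rUnit X.X₀ ∘ₗ LinearMap.fst S (BTensor X.X₀ S) (BTensor X.X₁ S))
    ((rUnit X.X₁ ∘ₗ LinearMap.fst S (BTensor X.X₁ S) (BTensor X.X₀ S)) ∘ₗ
      matMap (BTensor.map X.d₀ LinearMap.id) (-BTensor.map LinearMap.id (mulBy S ab))
        (BTensor.map LinearMap.id (mulBy S (dd W))) (BTensor.map X.d₁ LinearMap.id))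
    (fun m n => by
      simp [matMap_apply, mulBy_apply, rUnit_tmul])
    (fun m n => by
      simp [matMap_apply, mulBy_apply, rUnit_tmul, mu_ab, el_zero])
  closed₁ := pair_apply_ext
    (X.d₁ ∘ₗ rUnit X.X₁ ∘ₗ LinearMap.fst S (BTensor X.X₁ S) (BTensor X.X₀ S))
    ((rUnit X.X₀ ∘ₗ LinearMap.fst S (BTensor X.X₀ S) (BTensor X.X₁ S)) ∘ₗ
      matMap (BTensor.map X.d₁ LinearMap.id) (BTensor.map LinearMap.id (mulBy S ab))
        (-BTensor.map LinearMap.id (mulBy S (dd W))) (BTensor.map X.d₀ LinearMap.id))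
    (fun m n => by
      simp [matMap_apply, mulBy_apply, rUnit_tmul])
    (fun m n => by
      simp [matMap_apply, mulBy_apply, rUnit_tmul, mu_ab, el_zero])

theorem swap_diff (W : R) : swap (W⊠(1 : R)) - swap ((1 : R)⊠W) =
    -((W⊠(1 : R)) - ((1 : R)⊠W)) := by
  rw [swap_tmul, swap_tmul, neg_sub]

/-- The dual `X^∨ = (X₁^∨, X₀^∨, d₀^∨, -d₁^∨)`. -/
def MBF.dual (X : MBF W) : MBF W where
  X₀ := BDual X.X₁
  X₁ := BDual X.X₀
  d₀ := BDual.map X.d₀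
  d₁ := -BDual.map X.d₁
  d₁_d₀ φ := BDual.ext fun m => by
    change -(φ (X.d₀ (X.d₁ m))) = swap (W⊠(1 : R)) * φ m - swap ((1 : R)⊠W) * φ m
    rw [X.d₀_d₁, map_sub, map_smul, map_smul, ← sub_mul, swap_diff, smul_eq_mul, smul_eq_mul,
      ← sub_mul, neg_mul]
  d₀_d₁ φ := BDual.ext fun m => by
    change -(φ (X.d₁ (X.d₀ m))) = swap (W⊠(1 : R)) * φ m - swap ((1 : R)⊠W) * φ m
    rw [X.d₁_d₀, map_sub, map_smul, map_smul, ← sub_mul, swap_diff, smul_eq_mul, smul_eq_mul,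
      ← sub_mul, neg_mul]

/-- The dual `φ^∨ = (φ₁^∨, φ₀^∨)` of a morphism. -/
def ClosedMap.dual {X Y : MBF W} (f : ClosedMap X Y) : ClosedMap Y.dual X.dual where
  f₀ := BDual.map f.f₁
  f₁ := BDual.map f.f₀
  closed₀ := fun (φ : BDual Y.X₁) => BDual.ext fun m => by
    change φ (f.f₁ (X.d₀ m)) = φ (Y.d₀ (f.f₀ m))
    rw [f.closed₀]
  closed₁ := fun (φ : BDual Y.X₀) => BDual.ext fun m => by
    change -(φ (f.f₀ (X.d₁ m))) = -(φ (Y.d₁ (f.f₁ m)))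
    rw [f.closed₁]

theorem Homotopic.dual {X Y : MBF W} {f g : ClosedMap X Y} (h : Homotopic f g) :
    Homotopic f.dual g.dual := by
  obtain ⟨h₀, h₁, e₀, e₁⟩ := h
  let k₀ : BDual Y.X₁ →ₗ[S] BDual X.X₀ := -BDual.map h₀
  let k₁ : BDual Y.X₀ →ₗ[S] BDual X.X₁ := BDual.map h₁
  refine ⟨k₀, k₁, fun (φ : BDual Y.X₁) => BDual.ext fun m => ?_,
    fun (φ : BDual Y.X₀) => BDual.ext fun m => ?_⟩
  · change φ (f.f₁ m) - φ (g.f₁ m) = -(-(φ (h₀ (X.d₁ m)))) + φ (Y.d₀ (h₁ m))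
    rw [← map_sub, e₁, map_add, neg_neg, add_comm]
  · change φ (f.f₀ m) - φ (g.f₀ m) = φ (h₁ (X.d₀ m)) + -(-(φ (Y.d₁ (h₀ m))))
    rw [← map_sub, e₀, map_add, neg_neg, add_comm]

/-- The duality functor on morphisms of the homotopy category. -/
def dualHom {X Y : MBF W} (f : X ⟶ Y) : Y.dual ⟶ X.dual :=
  Quotient.map (sa := homotopySetoid X Y) (sb := homotopySetoid Y.dual X.dual)
    (fun f => f.dual) (fun _ _ h => h.dual) f

theorem swap_swap (s : S) : swap (swap s) = s := by
  induction s using S_induct with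
  | ht p q => rw [swap_tmul, swap_tmul]
  | ha x y hx hy => rw [map_add, map_add, hx, hy]

/-- Polynomials in `a, b` of degree less than `d` in each of the two variables. -/
def boundedDegree (d : ℕ) : Submodule ℂ S :=
  Submodule.span ℂ {s | ∃ i < d, ∃ j < d, s = ((X : R) ^ i)⊠((X : R) ^ j)}


/-- The dual basis of `M^∨`: `dualBasis b j` sends `b i` to `δ i j`. -/
def dualBasis {ι M : Type} [Fintype ι] [AddCommGroup M] [Module S M] (b : Module.Basis ι S M) :
    Module.Basis ι S (BDual M) :=
  Module.Basis.ofEquivFun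
    { toFun := fun φ i => swap (φ (b i))
      map_add' := fun φ ψ => funext fun i => by
        rw [BDual.add_apply, map_add, Pi.add_apply]
      map_smul' := fun s φ => funext fun i => by
        rw [BDual.smul_apply, map_mul, swap_swap, Pi.smul_apply, smul_eq_mul, RingHom.id_apply]
      invFun := fun v => b.constr S (fun i => swap (v i))
      left_inv := fun φ => by
        have h : b.constr S (fun i => swap (swap (φ (b i)))) = (show M →ₗ[S] S from φ) :=
          b.ext fun i => by rw [Module.Basis.constr_basis, swap_swap]; rfl
        exact h
      right_inv := fun v => funext fun i => by
        change swap ((b.constr S (fun i => swap (v i))) (b i)) = v i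
        rw [Module.Basis.constr_basis, swap_swap] }

/-- Finite bases of the two bimodules of a factorisation, so that the differentials become matrices
over `ℂ[a, b]`. -/
structure Frame (Z : MBF W) where
  ι₀ : Type
  ι₁ : Type
  [fin₀ : Fintype ι₀]
  [fin₁ : Fintype ι₁]
  b₀ : Module.Basis ι₀ S Z.X₀
  b₁ : Module.Basis ι₁ S Z.X₁

attribute [instance] Frame.fin₀ Frame.fin₁

section Frame
variable {Z : MBF W}

/-- The dual bases of `Z^∨`. -/
def Frame.dual (F : Frame Z) : Frame Z.dual where
  ι₀ := F.ι₁
  ι₁ := F.ι₀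
  b₀ := dualBasis F.b₁
  b₁ := dualBasis F.b₀

/-- The matrix of `d₀`. -/
def Frame.D₀ (F : Frame Z) (i : F.ι₁) (j : F.ι₀) : S := F.b₁.repr (Z.d₀ (F.b₀ j)) i
/-- The matrix of `d₁`. -/
def Frame.D₁ (F : Frame Z) (i : F.ι₀) (j : F.ι₁) : S := F.b₀.repr (Z.d₁ (F.b₁ j)) i

/-- All matrix entries have degree less than `deg W` in each variable. -/
def Frame.LowDegree (F : Frame Z) : Prop :=
  (∀ i j, F.D₀ i j ∈ boundedDegree W.natDegree) ∧ (∀ i j, F.D₁ i j ∈ boundedDegree W.natDegree)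

/-- The explicit inverse of `λ_Z`. -/
def Frame.lamInv (F : Frame Z) : EvenMap Z ((MBF.unit W).tensor Z) where
  f₀ := F.b₀.constr S (M' := BTensor S Z.X₀ × BTensor S Z.X₁) fun j =>
    (tmul 1 (F.b₀ j), ∑ i, ddL (F.D₀ i j) • tmul 1 (F.b₁ i))
  f₁ := F.b₁.constr S (M' := BTensor S Z.X₀ × BTensor S Z.X₁) fun j =>
    (∑ i, ddL (F.D₁ i j) • tmul 1 (F.b₀ i), tmul 1 (F.b₁ j))

/-- The explicit inverse of `ρ_Z`. -/
def Frame.rhoInv (F : Frame Z) : EvenMap Z (Z.tensor (MBF.unit W)) where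
  f₀ := F.b₀.constr S (M' := BTensor Z.X₀ S × BTensor Z.X₁ S) fun j =>
    (tmul (F.b₀ j) 1, ∑ i, ddR (F.D₀ i j) • tmul (F.b₁ i) 1)
  f₁ := F.b₁.constr S (M' := BTensor Z.X₁ S × BTensor Z.X₀ S) fun j =>
    (tmul (F.b₁ j) 1, -∑ i, ddR (F.D₁ i j) • tmul (F.b₀ i) 1)

/-- The coevaluation, given by divided differences of the matrices of the differential. -/
def Frame.coev (F : Frame Z) : EvenMap (MBF.unit W) (Z.tensor Z.dual) where
  f₀ := LinearMap.toSpanSingleton S (BTensor Z.X₀ (BDual Z.X₁) × BTensor Z.X₁ (BDual Z.X₀))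
    (∑ j, ∑ i, ddO (F.D₁ i j) • tmul (F.b₀ i) (dualBasis F.b₁ j),
      ∑ j, ∑ i, ddO (F.D₀ i j) • tmul (F.b₁ i) (dualBasis F.b₀ j))
  f₁ := LinearMap.toSpanSingleton S (BTensor Z.X₁ (BDual Z.X₁) × BTensor Z.X₀ (BDual Z.X₀))
    (∑ j, tmul (F.b₁ j) (dualBasis F.b₁ j), ∑ j, tmul (F.b₀ j) (dualBasis F.b₀ j))

/-- `ev` is the evaluation given by the residue formulas: on
`Z₁^∨Z₀ ⊕ Z₀^∨Z₁` it is `(A, 0)` and on `Z₀^∨Z₀ ⊕ Z₁^∨Z₁` it is `(B, C)`.  As `a - b` is not a zero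
divisor, `B` is determined by the first condition, which says that `B` is the quotient by `a - b` of
the contraction of `d₁(x, a) d₀(x, b)` with `𝓕`. -/
def Frame.IsEv (F : Frame Z) (ev : ClosedMap (Z.dual.tensor Z) (MBF.unit W)) : Prop :=
  ∃ B : BTensor (BDual Z.X₀) Z.X₀ →ₗ[S] S,
    (∀ t, ab * B t = contract (residueF W) F.b₁ (BTensor.map (BDual.map Z.d₁) Z.d₀ t)) ∧
    (∀ (t : BTensor (BDual Z.X₁) Z.X₀) (u : BTensor (BDual Z.X₀) Z.X₁),
      (ev.f₀ (t, u) : S) = -contract (residueF W) F.b₁ (BTensor.map LinearMap.id Z.d₀ t)) ∧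
    (∀ (t : BTensor (BDual Z.X₀) Z.X₀) (u : BTensor (BDual Z.X₁) Z.X₁),
      (ev.f₁ (t, u) : S) = B t - contract augment F.b₁ u)
end Frame

section Zorro
variable {Z : MBF W}

/-- The first Zorro identity as an equality of even morphisms, not only up to homotopy. -/
def Frame.ZorroOneDG (F : Frame Z) (ev : ClosedMap (Z.dual.tensor Z) (MBF.unit W))
    (coev : ClosedMap (MBF.unit W) (Z.tensor Z.dual)) : Prop :=
  (rhoMap Z).toEvenMap.comp (((EvenMap.id Z).tensor ev.toEvenMap).comp
    ((assocMap Z Z.dual Z).toEvenMap.comp ((coev.toEvenMap.tensor (EvenMap.id Z)).comp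
      F.lamInv))) = EvenMap.id Z

/-- The second Zorro identity as an equality of even morphisms, not only up to homotopy. -/
def Frame.ZorroTwoDG (F : Frame Z) (ev : ClosedMap (Z.dual.tensor Z) (MBF.unit W))
    (coev : ClosedMap (MBF.unit W) (Z.tensor Z.dual)) : Prop :=
  (lamMap Z.dual).toEvenMap.comp ((ev.toEvenMap.tensor (EvenMap.id Z.dual)).comp
    ((assocInvMap Z.dual Z Z.dual).toEvenMap.comp
      (((EvenMap.id Z.dual).tensor coev.toEvenMap).comp F.dual.rhoInv))) = EvenMap.id Z.dual

/-- The first Zorro identity in the homotopy category,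
`ρ_X ∘ (id ⊗ ev) ∘ α ∘ (coev ⊗ id) ∘ λ_X⁻¹ = id_X`, including the invertibility of `λ_X`. -/
def ZorroOne (X : MBF W) (ev : X.dual.tensor X ⟶ MBF.unit W)
    (coev : MBF.unit W ⟶ X.tensor X.dual) : Prop :=
  ∃ _ : IsIso (ho (lamMap X)),
    inv (ho (lamMap X)) ≫ tensorHom coev (𝟙 X) ≫ ho (assocMap X X.dual X) ≫
      tensorHom (𝟙 X) ev ≫ ho (rhoMap X) = 𝟙 X

/-- The second Zorro identity in the homotopy category,
`λ_{X^∨} ∘ (ev ⊗ id) ∘ α⁻¹ ∘ (id ⊗ coev) ∘ ρ_{X^∨}⁻¹ = id_{X^∨}`, including the invertibility of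
`ρ_{X^∨}`. -/
def ZorroTwo (X : MBF W) (ev : X.dual.tensor X ⟶ MBF.unit W)
    (coev : MBF.unit W ⟶ X.tensor X.dual) : Prop :=
  ∃ _ : IsIso (ho (rhoMap X.dual)),
    inv (ho (rhoMap X.dual)) ≫ tensorHom (𝟙 X.dual) coev ≫ ho (assocInvMap X.dual X X.dual) ≫
      tensorHom ev (𝟙 X.dual) ≫ ho (lamMap X.dual) = 𝟙 X.dual

/-- The explicit maps `lamInv` and `rhoInv` are closed and inverse to `λ_Z` and `ρ_Z` in the homotopy
category. -/
def Frame.UnitInverses (F : Frame Z) : Prop :=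
  (∃ l : ClosedMap Z ((MBF.unit W).tensor Z), l.toEvenMap = F.lamInv ∧
    ho l ≫ ho (lamMap Z) = 𝟙 Z ∧ ho (lamMap Z) ≫ ho l = 𝟙 ((MBF.unit W).tensor Z)) ∧
  (∃ r : ClosedMap Z (Z.tensor (MBF.unit W)), r.toEvenMap = F.rhoInv ∧
    ho r ≫ ho (rhoMap Z) = 𝟙 Z ∧ ho (rhoMap Z) ≫ ho r = 𝟙 (Z.tensor (MBF.unit W)))

end Zorro

/-- The objects of `MF_bi(W)`: those isomorphic, in the homotopy category, to a matrix bi-factorisation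
with free bimodules of finite rank. -/
def IsMFbi (X : MBF W) : Prop :=
  ∃ Z : MBF W, Module.Free S Z.X₀ ∧ Module.Finite S Z.X₀ ∧ Module.Free S Z.X₁ ∧
    Module.Finite S Z.X₁ ∧ Nonempty (X ≅ Z)

end BiFact

end

noncomputable section

namespace BiFact

/-! The proof rests on two mechanisms: division and residues.

Division. A tensor product of free bimodules of finite rank is torsion-free over ℂ[a, x, b]
(`BTensor.smul_eq_zero`). An identity may therefore be checked after multiplying by a - x, x - b or
a - b, and a linear map with values divisible by such a factor can be divided by it. Divided
differences of matrices are characterised in this way. Division by a - x and x - b gives the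
homotopies that invert the unit maps. Division by a - b shows that one component of a closed map
into or out of I determines it, and that modulo a - b this component fixes the homotopy class
(`homotopic_of_mu_eq`, `homotopic_of_unit`).

Residues. The residue theorem says that 𝓕 sends (W(x) - W(b)) p(x) to (a - b) p(0) (`residueF_mul`).
For a = b, 𝓕 becomes minus the functional p ↦ ∮ p(x) / (W(x) - W(b)) dx. That functional kills
powers of x below deg W - 1 and sends (W(a) - W(x)) / (a - x) to 1 (`residueT_ddL_self`). The
evaluation is closed because d₁d₀ and d₀d₁ put the factor W(x) - W(b) under 𝓕.

Modulo a - b the evaluation has a basis-free form (`Frame.mu_evA`), and the degree 1 part of the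
coevaluation is the canonical element. Both are therefore dinatural up to homotopy, and this gives
independence of all choices.

In the Zorro composites λ or ρ sets the two outer variables of the evaluation equal. Hence only the
component A enters, and only through its residue. In matrix form one obtains the residue of the sum
of (D₁(a, b) - D₁(x, b)) / (a - x) times entries of D₀(x, b). The twisted Leibniz rule
(`sum_residueT_ddL_mul`), together with D₁D₀ = D₀D₁ = W(a) - W(b), turns this into 1 - d₁h in degree
0 and 1 - hd₁ in degree 1. Here h consists of the residues of (D₀(a, b) - D₀(x, b)) / (a - x). So h
is a homotopy to the identity, and it is zero if D₀ has low degree, which makes the identity strict.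
The second composite is the dual of the first. Naturality of λ, ρ and α carries the result to all of
MF_bi(W). -/

/-! ### Substitutions and non-zero-divisors in ℂ[a, b] and ℂ[a, x, b]. -/

instance : IsDomain S :=
  (polyEquivTensor ℂ R).symm.toMulEquiv.isDomain (B := (R)[X])

instance : IsDomain T :=
  (polyEquivTensor ℂ S).symm.toMulEquiv.isDomain (B := S[X])

/-- The substitution `a ↦ p`, `b ↦ q`. -/
def evalS (p q : R) : S →ₐ[ℂ] R :=
  (Algebra.TensorProduct.lift (aeval p) (aeval q) fun _ _ => mul_comm _ _).comp
    S.equiv.symm.toAlgHom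

theorem evalS_el (p q u v : R) : evalS p q (u⊠v) = aeval p u * aeval q v :=
  Algebra.TensorProduct.lift_tmul (aeval p) (aeval q) (fun _ _ => mul_comm _ _) u v

/-- The substitution `a ↦ p`, `x ↦ q`, `b ↦ r`. -/
def evalT (p q r : R) : T →ₐ[ℂ] R :=
  Algebra.TensorProduct.lift (evalS p q) (aeval r) fun _ _ => Commute.all _ _

theorem evalT_tmul (p q r : R) (s : S) (v : R) :
    evalT p q r (s ⊗ₜ v) = evalS p q s * aeval r v :=
  Algebra.TensorProduct.lift_tmul _ _ _ _ _

/-- The substitution a ↦ X, b ↦ 0 detects a - b. Similar substitutions detect its three images in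
ℂ[a, x, b]. -/
theorem ab_ne_zero : ab ≠ 0 := fun h => by
  have := congrArg (evalS X 0) h
  simp [ab, evalS_el] at this

theorem el_eq_mul (p q : R) : p⊠q = (p⊠1) * (1⊠q) := by
  rw [el_mul_el, mul_one, one_mul]

/-- The substitution `D ↦ D(a, x)`. -/
def inclAX : S →ₐ[ℂ] T := Algebra.TensorProduct.includeLeft

/-- The substitution `D ↦ D(x, b)`. -/
def inclXB : S →ₐ[ℂ] T :=
  (Algebra.TensorProduct.map rightIncl (AlgHom.id ℂ R)).comp S.equiv.symm.toAlgHom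

theorem inclAX_apply (s : S) : inclAX s = s ⊗ₜ 1 := rfl
theorem inclXB_el (p q : R) : inclXB (p⊠q) = (1⊠p) ⊗ₜ q := rfl
theorem outer_el (p q : R) : outer (p⊠q) = (p⊠1) ⊗ₜ q := rfl

theorem tmul_eq_outer_mul (s : S) (r : R) : (s ⊗ₜ r : T) = inclAX s * outer (1⊠r) := by
  rw [inclAX_apply, outer_el, Algebra.TensorProduct.tmul_mul_tmul, one_el_one, mul_one, one_mul]

theorem inclAX_ab_ne_zero : inclAX ab ≠ 0 := fun h => by
  have := congrArg (evalT X 0 0) h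
  simp [ab, inclAX_apply, evalT_tmul, evalS_el] at this

theorem inclXB_ab_ne_zero : inclXB ab ≠ 0 := fun h => by
  have := congrArg (evalT 0 X 0) h
  rw [ab, map_sub, inclXB_el, inclXB_el, map_sub, evalT_tmul, evalT_tmul, evalS_el, evalS_el] at this
  simp at this

theorem outer_ab_ne_zero : outer ab ≠ 0 := fun h => by
  have := congrArg (evalT X 0 0) h
  rw [ab, map_sub, outer_el, outer_el, map_sub, evalT_tmul, evalT_tmul, evalS_el, evalS_el] at this
  simp at this

/-! ### Tensor products of free bimodules as torsion-free ℂ[a, x, b]-modules. -/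

section
variable {M N M' N' : Type} [AddCommGroup M] [Module S M] [AddCommGroup N] [Module S N]
  [AddCommGroup M'] [Module S M'] [AddCommGroup N'] [Module S N']

theorem smul_eq_outer_smul (s : S) (z : BTensor M N) : s • z = outer s • z := rfl

theorem smul_of_eq_zero {t : T} (h : t = 0) (z : BTensor M N) : t • z = 0 := by
  subst h
  exact zero_smul T z

theorem smul_tmul_eq (s : S) (m : M) (n : N) : tmul (s • m) n = inclAX s • tmul m n := by
  rw [inclAX_apply, T_smul_tmul, one_el_one, one_smul]

theorem tmul_smul_eq (s : S) (m : M) (n : N) : tmul m (s • n) = inclXB s • tmul m n := by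
  induction s using S_induct with
  | ht p q => rw [inclXB_el, T_smul_tmul, tmul_middle, smul_smul, ← el_eq_mul]
  | ha x y hx hy => rw [add_smul, tmul_add, map_add, add_smul, hx, hy]

theorem sum_tmul {ι : Type*} (s : Finset ι) (f : ι → M) (n : N) :
    tmul (∑ i ∈ s, f i) n = ∑ i ∈ s, tmul (f i) n :=
  map_sum (AddMonoidHom.mk' (fun m => tmul m n) fun _ _ => add_tmul _ _ _) f s

theorem tmul_sum {ι : Type*} (s : Finset ι) (m : M) (f : ι → N) :
    tmul m (∑ i ∈ s, f i) = ∑ i ∈ s, tmul m (f i) :=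
  map_sum (AddMonoidHom.mk' (fun n => tmul m n) fun _ _ => tmul_add _ _ _) f s

/-- Divided differences involve the middle variable, so bimodule maps must be moved past scalars
from all of ℂ[a, x, b], not only from ℂ[a, b]. -/
theorem BTensor.map_smul_T (f : M →ₗ[S] M') (g : N →ₗ[S] N') (t : T) (z : BTensor M N) :
    BTensor.map f g (t • z) = t • BTensor.map f g z := by
  induction z using BTensor.induct with
  | h0 => simp
  | ha x y hx hy => simp only [smul_add, map_add, hx, hy]
  | ht m n =>
    induction t using T_induct with
    | ha x y hx hy => simp only [add_smul, map_add, hx, hy]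
    | ht p q r => simp only [T_smul_tmul, BTensor.map_tmul, map_smul]

section Coords
variable {ι κ : Type} [Fintype ι] [Fintype κ] (b : Module.Basis ι S M) (c : Module.Basis κ S N)

/-- The coordinates of an element of `M ⊗_R N` with respect to bases of `M` and `N`. -/
def coords : BTensor M N →+ (ι → κ → T) :=
  BTensor.liftAdd (fun m n i j => inclAX (b.repr m i) * inclXB (c.repr n j))
    (fun m m' n => by ext i j; simp [add_mul])
    (fun m n n' => by ext i j; simp [mul_add])
    (fun r m n => by
      ext i j
      -- The right variable of `M` and the left variable of `N` are the same x, which makes the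
      -- product of coordinates balanced.
      have h : inclAX (1⊠r) = inclXB (r⊠1) := rfl
      simp only [map_smul, Finsupp.smul_apply, smul_eq_mul, map_mul, h]
      ring)

omit [Fintype ι] [Fintype κ] in
theorem coords_tmul (m : M) (n : N) (i : ι) (j : κ) :
    coords b c (tmul m n) i j = inclAX (b.repr m i) * inclXB (c.repr n j) := rfl

omit [Fintype ι] [Fintype κ] in
theorem coords_smul (t : T) (z : BTensor M N) : coords b c (t • z) = t • coords b c z := by
  induction z using BTensor.induct with
  | h0 => simp
  | ha x y hx hy => simp only [smul_add, map_add, hx, hy]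
  | ht m n =>
    induction t using T_induct with
    | ha x y hx hy => simp only [add_smul, map_add, hx, hy]
    | ht p q r =>
      ext i j
      have h : inclXB (1⊠r) = outer (1⊠r) := rfl
      rw [T_smul_tmul, coords_tmul, map_smul, map_smul, Finsupp.smul_apply, Finsupp.smul_apply,
        smul_eq_mul, smul_eq_mul, map_mul, map_mul, Pi.smul_apply, Pi.smul_apply, smul_eq_mul,
        coords_tmul, tmul_eq_outer_mul, h]
      ring

/-- An element is thus determined by its coordinates. Together with `coords_smul` this suffices for
torsion-freeness. -/
theorem sum_coords_smul (z : BTensor M N) :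
    ∑ i, ∑ j, coords b c z i j • tmul (b i) (c j) = z := by
  induction z using BTensor.induct with
  | h0 =>
    rw [map_zero]
    exact Finset.sum_eq_zero fun i _ => Finset.sum_eq_zero fun j _ => smul_of_eq_zero rfl _
  | ha x y hx hy =>
    simp only [map_add, Pi.add_apply, add_smul, Finset.sum_add_distrib, hx, hy]
  | ht m n =>
    conv_rhs => rw [← b.sum_repr m, ← c.sum_repr n]
    simp only [sum_tmul, tmul_sum, smul_tmul_eq, tmul_smul_eq, coords_tmul, mul_smul,
      Finset.smul_sum]
    rw [Finset.sum_comm]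
    simp only [smul_comm (inclAX _) (inclXB _)]

include b c in
-- The coordinates of z are multiplied by t inside a domain, so they vanish with t z. This is what
-- permits division by a - x, x - b and a - b.
theorem BTensor.smul_eq_zero {t : T} (ht : t ≠ 0) {z : BTensor M N} (h : t • z = 0) : z = 0 := by
  have h' := coords_smul b c t z
  rw [h, map_zero] at h'
  rw [← sum_coords_smul b c z]
  refine Finset.sum_eq_zero fun i _ => Finset.sum_eq_zero fun j _ => ?_
  have h₀ : t * coords b c z i j = 0 := (congrFun (congrFun h' i) j).symm
  exact smul_of_eq_zero ((mul_eq_zero.1 h₀).resolve_left ht) _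

include b c in
theorem BTensor.smul_left_cancel {t : T} (ht : t ≠ 0) {z z' : BTensor M N} (h : t • z = t • z') :
    z = z' :=
  sub_eq_zero.1 (BTensor.smul_eq_zero b c ht (by rw [smul_sub, h, sub_self]))

end Coords
end

/-! ### Divided differences and divisibility by a - b. -/

theorem outer_dd_mul (p : R) (q : R) : inclAX ab * (dd p ⊗ₜ q) = outer (p⊠q) - inclXB (p⊠q) := by
  rw [inclAX_apply, Algebra.TensorProduct.tmul_mul_tmul, ab_mul_dd, one_mul, TensorProduct.sub_tmul]
  rfl

/-- As a - x is not a zero divisor, this determines `ddL`; identities between divided differences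
can be proved by multiplying through. -/
theorem ab_mul_ddL (s : S) : inclAX ab * ddL s = outer s - inclXB s := by
  induction s using S_induct with
  | ht p q => exact outer_dd_mul p q
  | ha x y hx hy => rw [map_add, mul_add, hx, hy, map_add, map_add]; ring

theorem ddR_el (p q : R) : ddR (p⊠q) = (inclAX (p⊠1)) * inclXB (dd q) := by
  change TensorProduct.map S.equiv.toLinearMap (LinearMap.id : R →ₗ[ℂ] R)
    ((TensorProduct.assoc ℂ R R R).symm (p ⊗ₜ (S.equiv.symm (dd q)))) = _
  induction dd q using S_induct with
  | ht u v =>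
    rw [inclXB_el, inclAX_apply, Algebra.TensorProduct.tmul_mul_tmul, el_mul_el, mul_one, one_mul,
      one_mul]
    rfl
  | ha x y hx hy => rw [map_add, TensorProduct.tmul_add, map_add, map_add, hx, hy, map_add, mul_add]

theorem ab_mul_ddR (s : S) : inclXB ab * ddR s = inclAX s - outer s := by
  induction s using S_induct with
  | ht p q =>
    have h : inclXB (q⊠1) = inclAX (1⊠q) := rfl
    have h' : inclXB (1⊠q) = outer (1⊠q) := rfl
    have h'' : inclAX (p⊠1) = outer (p⊠1) := rfl
    rw [ddR_el, mul_left_comm, ← map_mul, ab_mul_dd, map_sub, mul_sub, h, ← map_mul, ← el_eq_mul,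
      h', h'', ← map_mul, ← el_eq_mul]
  | ha x y hx hy => rw [map_add, mul_add, hx, hy, map_add, map_add]; ring

theorem swapMiddle_swapMiddle (t : T) : swapMiddle (swapMiddle t) = t := by
  induction t using T_induct with
  | ht p q r => rw [swapMiddle_tmul, swapMiddle_tmul]
  | ha x y hx hy => rw [map_add, map_add, hx, hy]

theorem swapMiddle_mul (t t' : T) : swapMiddle (t * t') = swapMiddle t * swapMiddle t' := by
  induction t using T_induct with
  | ha x y hx hy => rw [add_mul, map_add, map_add, add_mul, hx, hy]
  | ht p q r =>
    induction t' using T_induct with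
    | ha x y hx hy => rw [mul_add, map_add, map_add, mul_add, hx, hy]
    | ht p' q' r' =>
      simp only [swapMiddle_tmul, Algebra.TensorProduct.tmul_mul_tmul, el_mul_el]

theorem swapMiddle_inclAX (s : S) : swapMiddle (inclAX s) = outer s := by
  induction s using S_induct with
  | ht p q => rfl
  | ha x y hx hy => rw [map_add, map_add, hx, hy, map_add]

theorem swapMiddle_outer (s : S) : swapMiddle (outer s) = inclAX s := by
  rw [← swapMiddle_inclAX, swapMiddle_swapMiddle]

theorem swapMiddle_inclXB (s : S) : swapMiddle (inclXB s) = inclXB (swap s) := by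
  induction s using S_induct with
  | ht p q => rfl
  | ha x y hx hy => simp only [map_add, hx, hy]

/-- `ddO` is `ddL` followed by the exchange of x and b, which turns D(a, b) - D(x, b) into D(a, x) -
D(b, x). The term D(b, x) is `swap` of D, placed in the variables x, b. -/
theorem ab_mul_ddO (s : S) : outer ab * ddO s = inclAX s - inclXB (swap s) := by
  rw [← swapMiddle_inclAX, ddO, LinearMap.comp_apply, ← swapMiddle_mul, ab_mul_ddL, map_sub,
    swapMiddle_outer, swapMiddle_inclXB]

theorem swap_ab : swap ab = -ab := by
  rw [ab, map_sub, swap_tmul, swap_tmul, neg_sub]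

/-- Both p(a) - p(b) and a - b change sign. The symmetry is needed in left contractions, where the
two variables occur in the opposite order. -/
theorem swap_dd (p : R) : swap (dd p) = dd p := by
  refine mul_left_cancel₀ ab_ne_zero ?_
  have h := congrArg swap (ab_mul_dd p)
  rw [map_mul, map_sub, swap_ab, swap_tmul, swap_tmul] at h
  rw [ab_mul_dd, ← neg_sub (1⊠p), ← h]
  ring

/-- The kernel of multiplication is generated by a - b, because p(a) q(b) - p(b) q(b) = (p(a) -
p(b)) q(b). -/
theorem ab_dvd_iff {s : S} : ab ∣ s ↔ mu s = 0 := by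
  constructor
  · rintro ⟨t, rfl⟩
    rw [map_mul, mu_ab, zero_mul]
  · intro h
    have key : ∀ s : S, ab ∣ s - (1⊠mu s) := fun s => by
      induction s using S_induct with
      | ht p q =>
        refine ⟨dd p * (1⊠q), ?_⟩
        rw [← mul_assoc, ab_mul_dd, sub_mul, ← el_eq_mul, el_mul_el, one_mul, mu_tmul]
      | ha x y hx hy =>
        rw [map_add, el_add, add_sub_add_comm]
        exact dvd_add hx hy
    simpa [h, el_zero] using key s

/-- A map to `ℂ[a, b]` with values divisible by `a - b` is a multiple of `a - b`. -/
theorem exists_ab_mul {M : Type} [AddCommGroup M] [Module S M] (f : M →ₗ[S] S)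
    (h : ∀ m, mu (f m) = 0) : ∃ g : M →ₗ[S] S, ∀ m, ab * g m = f m := by
  -- Quotients by a - b are unique, so a pointwise choice is automatically linear.
  choose g hg using fun m => ab_dvd_iff.2 (h m)
  refine ⟨⟨⟨g, fun m m' => ?_⟩, fun s m => ?_⟩, fun m => (hg m).symm⟩
  · exact mul_left_cancel₀ ab_ne_zero (by rw [← hg, map_add, hg, hg, mul_add])
  · exact mul_left_cancel₀ ab_ne_zero (by
      rw [← hg, map_smul, hg, smul_eq_mul, RingHom.id_apply, smul_eq_mul]; ring)

/-! ### Division by a - x and x - b on tensor products with the unit. -/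

section Divide
variable {M N P : Type} [AddCommGroup M] [Module S M] [AddCommGroup N] [Module S N]
  [AddCommGroup P] [Module S P]

theorem smul_smul_comm (s : S) (t : T) (z : BTensor M N) : s • t • z = t • s • z :=
  smul_comm (outer s) t z

/-- A linear map to `M ⊗_R N` with values divisible by `t` is a multiple of `t`. -/
theorem exists_smul_eq {ι κ : Type} [Fintype ι] [Fintype κ] (b : Module.Basis ι S M)
    (c : Module.Basis κ S N) {t : T} (ht : t ≠ 0) (f : P →ₗ[S] BTensor M N)
    (h : ∀ p, ∃ z, t • z = f p) : ∃ g : P →ₗ[S] BTensor M N, ∀ p, t • g p = f p := by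
  choose g hg using h
  refine ⟨⟨⟨g, fun m m' => ?_⟩, fun s m => ?_⟩, hg⟩
  · exact BTensor.smul_left_cancel b c ht (by rw [hg, map_add, smul_add, hg, hg])
  · exact BTensor.smul_left_cancel b c ht (by
      rw [RingHom.id_apply, hg, map_smul, ← smul_smul_comm, hg])

theorem map_mulBy_left (s : S) (z : BTensor M N) :
    BTensor.map (mulBy M s) LinearMap.id z = inclAX s • z := by
  induction z using BTensor.induct with
  | h0 => simp
  | ha x y hx hy => rw [map_add, hx, hy, smul_add]
  | ht m n => rw [BTensor.map_tmul, mulBy_apply, LinearMap.id_apply, smul_tmul_eq]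

theorem map_mulBy_right (s : S) (z : BTensor M N) :
    BTensor.map LinearMap.id (mulBy N s) z = inclXB s • z := by
  induction z using BTensor.induct with
  | h0 => simp
  | ha x y hx hy => rw [map_add, hx, hy, smul_add]
  | ht m n => rw [BTensor.map_tmul, mulBy_apply, LinearMap.id_apply, tmul_smul_eq]

theorem lUnit_ab_smul (z : BTensor S M) : lUnit M (inclAX ab • z) = 0 := by
  induction z using BTensor.induct with
  | h0 => simp
  | ha x y hx hy => rw [smul_add, map_add, hx, hy, add_zero]
  | ht m n =>
    rw [← smul_tmul_eq, lUnit_tmul, smul_eq_mul, map_mul, mu_ab, zero_mul, zero_el, zero_smul]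

theorem rUnit_ab_smul (z : BTensor M S) : rUnit M (inclXB ab • z) = 0 := by
  induction z using BTensor.induct with
  | h0 => simp
  | ha x y hx hy => rw [smul_add, map_add, hx, hy, add_zero]
  | ht m n =>
    rw [← tmul_smul_eq, rUnit_tmul, smul_eq_mul, map_mul, mu_ab, zero_mul, el_zero, zero_smul]

theorem lUnit_map (f : M →ₗ[S] N) (z : BTensor S M) :
    lUnit N (BTensor.map LinearMap.id f z) = f (lUnit M z) := by
  induction z using BTensor.induct with
  | h0 => simp
  | ha x y hx hy => simp only [map_add, hx, hy]
  | ht m n => rw [BTensor.map_tmul, lUnit_tmul, lUnit_tmul, map_smul, LinearMap.id_apply]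

theorem rUnit_map (f : M →ₗ[S] N) (z : BTensor M S) :
    rUnit N (BTensor.map f LinearMap.id z) = f (rUnit M z) := by
  induction z using BTensor.induct with
  | h0 => simp
  | ha x y hx hy => simp only [map_add, hx, hy]
  | ht m n => rw [BTensor.map_tmul, rUnit_tmul, rUnit_tmul, map_smul, LinearMap.id_apply]

theorem ab_dvd_sub_left (s : S) : ab ∣ s - ((mu s)⊠1) := by
  rw [ab_dvd_iff, map_sub, mu_tmul, mul_one, sub_self]

theorem ab_dvd_sub_right (s : S) : ab ∣ s - (1⊠(mu s)) := by
  rw [ab_dvd_iff, map_sub, mu_tmul, one_mul, sub_self]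

/-- For u = s ⊗ m, the difference s(a, x) - s(x, x) is divisible by a - x. The factor s(x, x) can be
moved across the tensor sign to m, where it yields the value of the unit map. -/
theorem exists_ab_smul_left (u : BTensor S M) :
    ∃ v, inclAX ab • v = u - tmul 1 (lUnit M u) := by
  induction u using BTensor.induct with
  | h0 => exact ⟨0, by rw [smul_zero, map_zero, tmul_zero, sub_zero]⟩
  | ha x y hx hy =>
    obtain ⟨v, hv⟩ := hx
    obtain ⟨w, hw⟩ := hy
    exact ⟨v + w, by rw [smul_add, hv, hw, map_add, tmul_add]; abel⟩
  | ht s m =>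
    obtain ⟨t, ht⟩ := ab_dvd_sub_right s
    refine ⟨tmul t m, ?_⟩
    rw [← smul_tmul_eq, smul_eq_mul, ← ht, sub_tmul, lUnit_tmul, ← tmul_middle, smul_eq_mul,
      mul_one]

theorem exists_ab_smul_right (u : BTensor M S) :
    ∃ v, inclXB ab • v = u - tmul (rUnit M u) 1 := by
  induction u using BTensor.induct with
  | h0 => exact ⟨0, by rw [smul_zero, map_zero, zero_tmul, sub_zero]⟩
  | ha x y hx hy =>
    obtain ⟨v, hv⟩ := hx
    obtain ⟨w, hw⟩ := hy
    exact ⟨v + w, by rw [smul_add, hv, hw, map_add, add_tmul]; abel⟩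
  | ht m s =>
    obtain ⟨t, ht⟩ := ab_dvd_sub_left s
    refine ⟨tmul m t, ?_⟩
    rw [← tmul_smul_eq, smul_eq_mul, ← ht, tmul_sub, rUnit_tmul, tmul_middle, smul_eq_mul,
      mul_one]

/-- The basis `1` of `ℂ[a, b]`. -/
def unitBasis : Module.Basis Unit S S := Module.Basis.singleton Unit S

/-- Both u and σ(λ u) are congruent to 1 ⊗ λ u modulo a - x, because λ σ is the identity. So their
difference can be divided by a - x, the entry of the differential that the homotopy has to undo. -/
theorem exists_lUnit_homotopy {ι : Type} [Fintype ι] (b : Module.Basis ι S M)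
    (σ : M →ₗ[S] BTensor S M) (hσ : ∀ m, lUnit M (σ m) = m) :
    ∃ δ : BTensor S M →ₗ[S] BTensor S M, ∀ u, inclAX ab • δ u = u - σ (lUnit M u) := by
  refine exists_smul_eq unitBasis b inclAX_ab_ne_zero (LinearMap.id - σ ∘ₗ lUnit M) fun u => ?_
  obtain ⟨v, hv⟩ := exists_ab_smul_left u
  obtain ⟨w, hw⟩ := exists_ab_smul_left (σ (lUnit M u))
  refine ⟨v - w, ?_⟩
  rw [smul_sub, hv, hw, hσ]
  simp

theorem exists_rUnit_homotopy {ι : Type} [Fintype ι] (b : Module.Basis ι S M)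
    (σ : M →ₗ[S] BTensor M S) (hσ : ∀ m, rUnit M (σ m) = m) :
    ∃ δ : BTensor M S →ₗ[S] BTensor M S, ∀ u, inclXB ab • δ u = u - σ (rUnit M u) := by
  refine exists_smul_eq b unitBasis inclXB_ab_ne_zero (LinearMap.id - σ ∘ₗ rUnit M) fun u => ?_
  obtain ⟨v, hv⟩ := exists_ab_smul_right u
  obtain ⟨w, hw⟩ := exists_ab_smul_right (σ (rUnit M u))
  refine ⟨v - w, ?_⟩
  rw [smul_sub, hv, hw, hσ]
  simp

variable {κ : Type} [Fintype κ] (c : Module.Basis κ S N)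

/-- In σ n the coordinates of n stand in the outer variables a, b; in 1 ⊗ n they have been moved to
x, b. The difference is the numerator of the divided difference. -/
theorem ab_smul_sum_ddL (σ : N →ₗ[S] BTensor S N) (hσ : ∀ i, σ (c i) = tmul 1 (c i)) (n : N) :
    inclAX ab • ∑ i, ddL (c.repr n i) • tmul (1 : S) (c i) = σ n - tmul 1 n := by
  conv_rhs => rw [← c.sum_repr n, map_sum, tmul_sum, ← Finset.sum_sub_distrib]
  rw [Finset.smul_sum]
  refine Finset.sum_congr rfl fun i _ => ?_
  rw [smul_smul, ab_mul_ddL, sub_smul, map_smul, hσ, tmul_smul_eq, smul_eq_outer_smul]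

theorem ab_smul_sum_ddR (σ : N →ₗ[S] BTensor N S) (hσ : ∀ i, σ (c i) = tmul (c i) 1) (n : N) :
    inclXB ab • ∑ i, ddR (c.repr n i) • tmul (c i) (1 : S) = tmul n 1 - σ n := by
  conv_rhs => rw [← c.sum_repr n, map_sum, sum_tmul, ← Finset.sum_sub_distrib]
  rw [Finset.smul_sum]
  refine Finset.sum_congr rfl fun i _ => ?_
  rw [smul_smul, ab_mul_ddR, sub_smul, map_smul, hσ, smul_tmul_eq, smul_eq_outer_smul]

end Divide

/-! ### Inverses of the unit maps. -/

variable {W : R}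

theorem ho_eq_of_homotopic {X Y : MBF W} {f g : ClosedMap X Y} (h : Homotopic f g) :
    ho f = ho g := Quotient.sound (s := homotopySetoid X Y) h

/-- A strict section `l` of a closed map `p` for which `1 - l p` is a boundary is closed, and inverse
to `p` in the homotopy category. -/
theorem exists_inverse_of_homotopy {Y Z : MBF W} (p : ClosedMap Y Z) (l : EvenMap Z Y)
    (r₀ : ∀ n, p.f₀ (l.f₀ n) = n) (r₁ : ∀ n, p.f₁ (l.f₁ n) = n)
    (h₀ : Y.X₀ →ₗ[S] Y.X₁) (h₁ : Y.X₁ →ₗ[S] Y.X₀)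
    (e₀ : ∀ m, m - l.f₀ (p.f₀ m) = Y.d₁ (h₀ m) + h₁ (Y.d₀ m))
    (e₁ : ∀ m, m - l.f₁ (p.f₁ m) = Y.d₀ (h₁ m) + h₀ (Y.d₁ m)) :
    ∃ l' : ClosedMap Z Y, l'.toEvenMap = l ∧ ho l' ≫ ho p = 𝟙 Z ∧ ho p ≫ ho l' = 𝟙 Y := by
  -- Every m is p(y), and 1 - l p = dh + hd commutes with d because d² is multiplication by a
  -- scalar. Hence l p commutes with d, and therefore l does.
  have c₀ : ∀ m, Y.d₀ (l.f₀ m) = l.f₁ (Z.d₀ m) := fun m => by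
    obtain ⟨y, rfl⟩ : ∃ y, p.f₀ y = m := ⟨_, r₀ m⟩
    rw [p.closed₀, ← sub_sub_cancel y (l.f₀ (p.f₀ y)), e₀,
      ← sub_sub_cancel (Y.d₀ y) (l.f₁ (p.f₁ (Y.d₀ y))), e₁, Y.d₁_d₀]
    simp only [map_sub, map_add, Y.d₀_d₁, map_smul]
    abel
  have c₁ : ∀ m, Y.d₁ (l.f₁ m) = l.f₀ (Z.d₁ m) := fun m => by
    obtain ⟨y, rfl⟩ : ∃ y, p.f₁ y = m := ⟨_, r₁ m⟩
    rw [p.closed₁, ← sub_sub_cancel y (l.f₁ (p.f₁ y)), e₁,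
      ← sub_sub_cancel (Y.d₁ y) (l.f₀ (p.f₀ (Y.d₁ y))), e₀, Y.d₀_d₁]
    simp only [map_sub, map_add, Y.d₁_d₀, map_smul]
    abel
  let l' : ClosedMap Z Y := ⟨l, c₀, c₁⟩
  refine ⟨l', rfl, ?_, ?_⟩
  · have : p.comp l' = ClosedMap.id Z :=
      ClosedMap.ext (EvenMap.ext (LinearMap.ext r₀) (LinearMap.ext r₁))
    exact congrArg ho this
  · have : Homotopic (ClosedMap.id Y) (l'.comp p) := ⟨h₀, h₁, e₀, e₁⟩
    exact (ho_eq_of_homotopic this).symm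

section
variable {Z : MBF W} (F : Frame Z)

theorem Frame.lamInv_f₀_basis (j : F.ι₀) : F.lamInv.f₀ (F.b₀ j) =
    (tmul (1 : S) (F.b₀ j), ∑ i, ddL (F.D₀ i j) • tmul (1 : S) (F.b₁ i)) :=
  Module.Basis.constr_basis (M' := BTensor S Z.X₀ × BTensor S Z.X₁) _ _ _ _

theorem Frame.lamInv_f₁_basis (j : F.ι₁) : F.lamInv.f₁ (F.b₁ j) =
    (∑ i, ddL (F.D₁ i j) • tmul (1 : S) (F.b₀ i), tmul (1 : S) (F.b₁ j)) :=
  Module.Basis.constr_basis (M' := BTensor S Z.X₀ × BTensor S Z.X₁) _ _ _ _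

theorem Frame.rhoInv_f₀_basis (j : F.ι₀) : F.rhoInv.f₀ (F.b₀ j) =
    (tmul (F.b₀ j) (1 : S), ∑ i, ddR (F.D₀ i j) • tmul (F.b₁ i) (1 : S)) :=
  Module.Basis.constr_basis (M' := BTensor Z.X₀ S × BTensor Z.X₁ S) _ _ _ _

theorem Frame.rhoInv_f₁_basis (j : F.ι₁) : F.rhoInv.f₁ (F.b₁ j) =
    (tmul (F.b₁ j) (1 : S), -∑ i, ddR (F.D₁ i j) • tmul (F.b₀ i) (1 : S)) :=
  Module.Basis.constr_basis (M' := BTensor Z.X₁ S × BTensor Z.X₀ S) _ _ _ _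

/-- σ is the section e ↦ 1 ⊗ e on basis vectors, extended over the outer variables. It does not
commute with the differential, and the off-diagonal component ν compensates: (a - x) ν is the
commutator of σ with d. The quotients δ are the only entries of the homotopy. -/
theorem Frame.exists_lamInv : ∃ l : ClosedMap Z ((MBF.unit W).tensor Z), l.toEvenMap = F.lamInv ∧
    ho l ≫ ho (lamMap Z) = 𝟙 Z ∧ ho (lamMap Z) ≫ ho l = 𝟙 ((MBF.unit W).tensor Z) := by
  let l₀ : Z.X₀ →ₗ[S] BTensor S Z.X₀ × BTensor S Z.X₁ := F.lamInv.f₀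
  let l₁ : Z.X₁ →ₗ[S] BTensor S Z.X₀ × BTensor S Z.X₁ := F.lamInv.f₁
  let σ₀ := LinearMap.fst S _ _ ∘ₗ l₀
  let ν₀ := LinearMap.snd S _ _ ∘ₗ l₀
  let σ₁ := LinearMap.snd S _ _ ∘ₗ l₁
  let ν₁ := LinearMap.fst S _ _ ∘ₗ l₁
  have hσ₀ : ∀ j, σ₀ (F.b₀ j) = tmul 1 (F.b₀ j) := fun j => congrArg Prod.fst (F.lamInv_f₀_basis j)
  have hσ₁ : ∀ j, σ₁ (F.b₁ j) = tmul 1 (F.b₁ j) := fun j => congrArg Prod.snd (F.lamInv_f₁_basis j)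
  have s₀ : ∀ m, lUnit Z.X₀ (σ₀ m) = m := LinearMap.congr_fun
    (show lUnit Z.X₀ ∘ₗ σ₀ = LinearMap.id from F.b₀.ext fun j => by
      rw [LinearMap.comp_apply, hσ₀, lUnit_tmul, map_one, one_el_one, one_smul, LinearMap.id_apply])
  have s₁ : ∀ m, lUnit Z.X₁ (σ₁ m) = m := LinearMap.congr_fun
    (show lUnit Z.X₁ ∘ₗ σ₁ = LinearMap.id from F.b₁.ext fun j => by
      rw [LinearMap.comp_apply, hσ₁, lUnit_tmul, map_one, one_el_one, one_smul, LinearMap.id_apply])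
  have n₀ : ∀ m, inclAX ab • ν₀ m = σ₁ (Z.d₀ m) - BTensor.map LinearMap.id Z.d₀ (σ₀ m) := fun m => by
    rw [← map_mulBy_left]
    refine LinearMap.congr_fun (show BTensor.map (mulBy S ab) LinearMap.id ∘ₗ ν₀ =
      σ₁ ∘ₗ Z.d₀ - BTensor.map LinearMap.id Z.d₀ ∘ₗ σ₀ from F.b₀.ext fun j => ?_) m
    have h : ν₀ (F.b₀ j) = _ := congrArg Prod.snd (F.lamInv_f₀_basis j)
    change BTensor.map _ _ (ν₀ (F.b₀ j)) = σ₁ (Z.d₀ (F.b₀ j)) - BTensor.map _ _ (σ₀ (F.b₀ j))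
    rw [h, map_mulBy_left, hσ₀]
    exact ab_smul_sum_ddL F.b₁ σ₁ hσ₁ _
  have n₁ : ∀ m, inclAX ab • ν₁ m = σ₀ (Z.d₁ m) - BTensor.map LinearMap.id Z.d₁ (σ₁ m) := fun m => by
    rw [← map_mulBy_left]
    refine LinearMap.congr_fun (show BTensor.map (mulBy S ab) LinearMap.id ∘ₗ ν₁ =
      σ₀ ∘ₗ Z.d₁ - BTensor.map LinearMap.id Z.d₁ ∘ₗ σ₁ from F.b₁.ext fun j => ?_) m
    have h : ν₁ (F.b₁ j) = _ := congrArg Prod.fst (F.lamInv_f₁_basis j)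
    change BTensor.map _ _ (ν₁ (F.b₁ j)) = σ₀ (Z.d₁ (F.b₁ j)) - BTensor.map _ _ (σ₁ (F.b₁ j))
    rw [h, map_mulBy_left, hσ₁]
    exact ab_smul_sum_ddL F.b₀ σ₀ hσ₀ _
  obtain ⟨δ₀, hδ₀⟩ := exists_lUnit_homotopy F.b₀ σ₀ s₀
  obtain ⟨δ₁, hδ₁⟩ := exists_lUnit_homotopy F.b₁ σ₁ s₁
  -- δ leads from the summand with I₀ to the one with I₁. The differential I₁ → I₀ returns by
  -- multiplication with a - x, which recovers u - σ λ u.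
  let h₀ : BTensor S Z.X₀ × BTensor S Z.X₁ →ₗ[S] BTensor S Z.X₀ × BTensor S Z.X₁ :=
    LinearMap.prod (δ₀ ∘ₗ LinearMap.fst S _ _) 0
  let h₁ : BTensor S Z.X₀ × BTensor S Z.X₁ →ₗ[S] BTensor S Z.X₀ × BTensor S Z.X₁ :=
    LinearMap.prod 0 (δ₁ ∘ₗ LinearMap.snd S _ _)
  refine exists_inverse_of_homotopy (lamMap Z) F.lamInv s₀ s₁ h₀ h₁ ?_ ?_
  · rintro ⟨(u : BTensor S Z.X₀), (v : BTensor S Z.X₁)⟩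
    refine Prod.ext ?_ ?_
    · have key : u - σ₀ (lUnit Z.X₀ u) = BTensor.map (mulBy S ab) LinearMap.id (δ₀ u) +
            BTensor.map LinearMap.id Z.d₁ 0 + 0 := by
        rw [map_mulBy_left, hδ₀, map_zero, add_zero, add_zero]
      exact key
    · have key : v - ν₀ (lUnit Z.X₀ u) = -BTensor.map LinearMap.id Z.d₀ (δ₀ u) +
            BTensor.map (mulBy S (dd W)) LinearMap.id 0 +
            δ₁ (BTensor.map LinearMap.id Z.d₀ u + BTensor.map (mulBy S ab) LinearMap.id v) := by
        -- After multiplication by a - x all terms are expressed through σ, λ and d, and λ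
        -- annihilates multiples of a - x.
        refine BTensor.smul_left_cancel unitBasis F.b₁ inclAX_ab_ne_zero ?_
        rw [map_zero, add_zero, smul_sub, n₀, smul_add, hδ₁, smul_neg, ← BTensor.map_smul_T, hδ₀,
          map_mulBy_left, map_add (lUnit Z.X₁), lUnit_ab_smul, lUnit_map, add_zero, map_sub]
        abel
      exact key
  · rintro ⟨(u : BTensor S Z.X₀), (v : BTensor S Z.X₁)⟩
    refine Prod.ext ?_ ?_
    · have key : u - ν₁ (lUnit Z.X₁ v) = BTensor.map (mulBy S (dd W)) LinearMap.id 0 +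
            -BTensor.map LinearMap.id Z.d₁ (δ₁ v) +
            δ₀ (BTensor.map (mulBy S ab) LinearMap.id u + BTensor.map LinearMap.id Z.d₁ v) := by
        refine BTensor.smul_left_cancel unitBasis F.b₀ inclAX_ab_ne_zero ?_
        rw [map_zero, zero_add, smul_sub, n₁, smul_add, hδ₀, smul_neg, ← BTensor.map_smul_T, hδ₁,
          map_mulBy_left, map_add (lUnit Z.X₀), lUnit_ab_smul, lUnit_map, zero_add, map_sub]
        abel
      exact key
    · have key : v - σ₁ (lUnit Z.X₁ v) = BTensor.map LinearMap.id Z.d₀ 0 +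
            BTensor.map (mulBy S ab) LinearMap.id (δ₁ v) + 0 := by
        rw [map_mulBy_left, hδ₁, map_zero, zero_add, add_zero]
      exact key

/-- The mirror image of `Frame.exists_lamInv`, with division by x - b. -/
theorem Frame.exists_rhoInv : ∃ r : ClosedMap Z (Z.tensor (MBF.unit W)), r.toEvenMap = F.rhoInv ∧
    ho r ≫ ho (rhoMap Z) = 𝟙 Z ∧ ho (rhoMap Z) ≫ ho r = 𝟙 (Z.tensor (MBF.unit W)) := by
  let r₀ : Z.X₀ →ₗ[S] BTensor Z.X₀ S × BTensor Z.X₁ S := F.rhoInv.f₀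
  let r₁ : Z.X₁ →ₗ[S] BTensor Z.X₁ S × BTensor Z.X₀ S := F.rhoInv.f₁
  let σ₀ := LinearMap.fst S _ _ ∘ₗ r₀
  let ν₀ := LinearMap.snd S _ _ ∘ₗ r₀
  let σ₁ := LinearMap.fst S _ _ ∘ₗ r₁
  let ν₁ := LinearMap.snd S _ _ ∘ₗ r₁
  have hσ₀ : ∀ j, σ₀ (F.b₀ j) = tmul (F.b₀ j) 1 := fun j => congrArg Prod.fst (F.rhoInv_f₀_basis j)
  have hσ₁ : ∀ j, σ₁ (F.b₁ j) = tmul (F.b₁ j) 1 := fun j => congrArg Prod.fst (F.rhoInv_f₁_basis j)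
  have s₀ : ∀ m, rUnit Z.X₀ (σ₀ m) = m := LinearMap.congr_fun
    (show rUnit Z.X₀ ∘ₗ σ₀ = LinearMap.id from F.b₀.ext fun j => by
      rw [LinearMap.comp_apply, hσ₀, rUnit_tmul, map_one, one_el_one, one_smul, LinearMap.id_apply])
  have s₁ : ∀ m, rUnit Z.X₁ (σ₁ m) = m := LinearMap.congr_fun
    (show rUnit Z.X₁ ∘ₗ σ₁ = LinearMap.id from F.b₁.ext fun j => by
      rw [LinearMap.comp_apply, hσ₁, rUnit_tmul, map_one, one_el_one, one_smul, LinearMap.id_apply])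
  have n₀ : ∀ m, inclXB ab • ν₀ m = BTensor.map Z.d₀ LinearMap.id (σ₀ m) - σ₁ (Z.d₀ m) := fun m => by
    rw [← map_mulBy_right]
    refine LinearMap.congr_fun (show BTensor.map LinearMap.id (mulBy S ab) ∘ₗ ν₀ =
      BTensor.map Z.d₀ LinearMap.id ∘ₗ σ₀ - σ₁ ∘ₗ Z.d₀ from F.b₀.ext fun j => ?_) m
    have h : ν₀ (F.b₀ j) = _ := congrArg Prod.snd (F.rhoInv_f₀_basis j)
    change BTensor.map _ _ (ν₀ (F.b₀ j)) = BTensor.map _ _ (σ₀ (F.b₀ j)) - σ₁ (Z.d₀ (F.b₀ j))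
    rw [h, map_mulBy_right, hσ₀]
    exact ab_smul_sum_ddR F.b₁ σ₁ hσ₁ _
  have n₁ : ∀ m, inclXB ab • ν₁ m = σ₀ (Z.d₁ m) - BTensor.map Z.d₁ LinearMap.id (σ₁ m) := fun m => by
    rw [← map_mulBy_right]
    refine LinearMap.congr_fun (show BTensor.map LinearMap.id (mulBy S ab) ∘ₗ ν₁ =
      σ₀ ∘ₗ Z.d₁ - BTensor.map Z.d₁ LinearMap.id ∘ₗ σ₁ from F.b₁.ext fun j => ?_) m
    have h : ν₁ (F.b₁ j) = _ := congrArg Prod.snd (F.rhoInv_f₁_basis j)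
    change BTensor.map _ _ (ν₁ (F.b₁ j)) = σ₀ (Z.d₁ (F.b₁ j)) - BTensor.map _ _ (σ₁ (F.b₁ j))
    rw [h, map_mulBy_right, hσ₁, smul_neg, neg_eq_iff_eq_neg, neg_sub]
    exact ab_smul_sum_ddR F.b₀ σ₀ hσ₀ _
  obtain ⟨δ₀, hδ₀⟩ := exists_rUnit_homotopy F.b₀ σ₀ s₀
  obtain ⟨δ₁, hδ₁⟩ := exists_rUnit_homotopy F.b₁ σ₁ s₁
  let h₀ : BTensor Z.X₀ S × BTensor Z.X₁ S →ₗ[S] BTensor Z.X₁ S × BTensor Z.X₀ S :=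
    LinearMap.prod 0 (δ₀ ∘ₗ LinearMap.fst S _ _)
  -- The sign compensates that of the entry -1 ⊗ d₁ in the even differential of a tensor product.
  let h₁ : BTensor Z.X₁ S × BTensor Z.X₀ S →ₗ[S] BTensor Z.X₀ S × BTensor Z.X₁ S :=
    LinearMap.prod 0 (-(δ₁ ∘ₗ LinearMap.fst S _ _))
  refine exists_inverse_of_homotopy (rhoMap Z) F.rhoInv s₀ s₁ h₀ h₁ ?_ ?_
  · rintro ⟨(u : BTensor Z.X₀ S), (v : BTensor Z.X₁ S)⟩
    refine Prod.ext ?_ ?_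
    · have key : u - σ₀ (rUnit Z.X₀ u) = BTensor.map Z.d₁ LinearMap.id 0 +
            BTensor.map LinearMap.id (mulBy S ab) (δ₀ u) + 0 := by
        rw [map_mulBy_right, hδ₀, map_zero, zero_add, add_zero]
      exact key
    · have key : v - ν₀ (rUnit Z.X₀ u) = -BTensor.map LinearMap.id (mulBy S (dd W)) 0 +
            BTensor.map Z.d₀ LinearMap.id (δ₀ u) +
            -δ₁ (BTensor.map Z.d₀ LinearMap.id u + -BTensor.map LinearMap.id (mulBy S ab) v) := by
        refine BTensor.smul_left_cancel F.b₁ unitBasis inclXB_ab_ne_zero ?_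
        rw [map_zero, neg_zero, zero_add, smul_sub, n₀, smul_add, smul_neg, hδ₁, ← BTensor.map_smul_T,
          hδ₀, map_mulBy_right, map_add (rUnit Z.X₁), map_neg (rUnit Z.X₁), rUnit_ab_smul, rUnit_map,
          neg_zero, add_zero, map_sub]
        abel
      exact key
  · rintro ⟨(u : BTensor Z.X₁ S), (v : BTensor Z.X₀ S)⟩
    refine Prod.ext ?_ ?_
    · have key : u - σ₁ (rUnit Z.X₁ u) = BTensor.map Z.d₀ LinearMap.id 0 +
            -BTensor.map LinearMap.id (mulBy S ab) (-δ₁ u) + 0 := by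
        rw [map_mulBy_right, smul_neg, neg_neg, hδ₁, map_zero, zero_add, add_zero]
      exact key
    · have key : v - ν₁ (rUnit Z.X₁ u) = BTensor.map LinearMap.id (mulBy S (dd W)) 0 +
            BTensor.map Z.d₁ LinearMap.id (-δ₁ u) +
            δ₀ (BTensor.map Z.d₁ LinearMap.id u + BTensor.map LinearMap.id (mulBy S ab) v) := by
        refine BTensor.smul_left_cancel F.b₀ unitBasis inclXB_ab_ne_zero ?_
        rw [map_zero, zero_add, smul_sub, n₁, smul_add, hδ₀, ← BTensor.map_smul_T, smul_neg, hδ₁,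
          map_mulBy_right, map_add (rUnit Z.X₀), rUnit_ab_smul, rUnit_map, add_zero, map_neg, map_sub]
        abel
      exact key

theorem Frame.unitInverses : F.UnitInverses := ⟨F.exists_lamInv, F.exists_rhoInv⟩

end

/-! ### Expansions at infinity. -/

theorem atInfinity_C (c : ℂ) : atInfinity (C c) = HahnSeries.single 0 c := by
  rw [atInfinity, aeval_C, HahnSeries.algebraMap_apply']
  exact HahnSeries.ofPowerSeries_C c

theorem atInfinity_coeff (p : R) (z : ℤ) :
    (atInfinity p).coeff z = if z ≤ 0 then p.coeff z.natAbs else 0 := by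
  induction p using Polynomial.induction_on' with
  | add p q hp hq => rw [map_add, HahnSeries.coeff_add, hp, hq]; split_ifs <;> simp
  | monomial n c =>
    have h : atInfinity X = HahnSeries.single (-1 : ℤ) (1 : ℂ) := aeval_X _
    rw [← C_mul_X_pow_eq_monomial, map_mul, map_pow, atInfinity_C, h, HahnSeries.single_pow, one_pow,
      HahnSeries.coeff_single_zero_mul, HahnSeries.coeff_single, coeff_C_mul_X_pow]
    simp only [mul_ite, mul_one, mul_zero, nsmul_eq_mul]
    split_ifs <;> first | rfl | omega

theorem atInfinity_ne_zero {p : R} (hp : p ≠ 0) : atInfinity p ≠ 0 := fun h => by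
  have := atInfinity_coeff p (-p.natDegree)
  rw [h, HahnSeries.coeff_zero, if_pos (by omega), Int.natAbs_neg, Int.natAbs_natCast] at this
  exact hp (leadingCoeff_eq_zero.1 this.symm)

theorem atInfinity_order {p : R} (hp : p ≠ 0) : (atInfinity p).order = -p.natDegree := by
  have h := atInfinity_coeff p
  refine le_antisymm (HahnSeries.order_le_of_coeff_ne_zero ?_) ?_
  · rw [h, if_pos (by omega), Int.natAbs_neg, Int.natAbs_natCast]
    exact leadingCoeff_ne_zero.2 hp
  · by_contra! hlt
    have h1 := HahnSeries.coeff_order_eq_zero.not.2 (atInfinity_ne_zero hp)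
    rw [h, if_pos (by omega), coeff_eq_zero_of_natDegree_lt (by omega)] at h1
    exact h1 rfl

theorem coeffInvX_add (f g h : R) : coeffInvX (f + g) h = coeffInvX f h + coeffInvX g h := by
  rw [coeffInvX, map_add, add_div, HahnSeries.coeff_add]; rfl

theorem coeffInvX_smul (c : ℂ) (f h : R) : coeffInvX (c • f) h = c * coeffInvX f h := by
  rw [coeffInvX, smul_eq_C_mul, map_mul, mul_div_assoc, atInfinity_C,
    HahnSeries.coeff_single_zero_mul]; rfl

theorem coeffInvX_mul_mul {h : R} (hh : h ≠ 0) (f g : R) :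
    coeffInvX (h * f) (h * g) = coeffInvX f g := by
  rw [coeffInvX, map_mul, map_mul, mul_div_mul_left _ _ (atInfinity_ne_zero hh)]; rfl

theorem coeffInvX_one (f : R) : coeffInvX f 1 = 0 := by
  rw [coeffInvX, map_one, div_one, atInfinity_coeff, if_neg (by norm_num)]

theorem coeffInvX_X (f : R) : coeffInvX f X = f.eval 0 := by
  have h : atInfinity f = atInfinity f / atInfinity X * HahnSeries.single (-1 : ℤ) (1 : ℂ) := by
    have : HahnSeries.single (-1 : ℤ) (1 : ℂ) = atInfinity X := (aeval_X _).symm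
    rw [this, div_mul_cancel₀ _ (atInfinity_ne_zero X_ne_zero)]
  have h' := congrArg (fun s => HahnSeries.coeff s (1 + (-1))) h
  simp only [HahnSeries.coeff_mul_single_add, mul_one] at h'
  rw [coeffInvX, ← h', atInfinity_coeff, ← coeff_zero_eq_eval_zero]
  simp

/-- The quotient is O(x⁻²): orders at infinity are the negatives of degrees and add up under
multiplication. -/
theorem coeffInvX_eq_zero {f g : R} (hg : g ≠ 0) (h : f.natDegree + 1 < g.natDegree) :
    coeffInvX f g = 0 := by
  rcases eq_or_ne f 0 with rfl | hf
  · rw [coeffInvX, map_zero, zero_div, HahnSeries.coeff_zero]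
  have hg' := atInfinity_ne_zero hg
  have hq : atInfinity f / atInfinity g ≠ 0 := div_ne_zero (atInfinity_ne_zero hf) hg'
  have h1 := HahnSeries.order_mul hq hg'
  rw [div_mul_cancel₀ _ hg', atInfinity_order hf, atInfinity_order hg] at h1
  exact HahnSeries.coeff_eq_zero_of_lt_order (by omega)

/-- The expansion of f / g starts in x⁻¹ with the quotient of the leading coefficients. -/
theorem coeffInvX_of_natDegree_eq {f g : R} (hf : f ≠ 0) (h : g.natDegree = f.natDegree + 1) :
    coeffInvX f g * g.leadingCoeff = f.leadingCoeff := by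
  have hg : g ≠ 0 := fun h' => by simp [h'] at h
  have hg' := atInfinity_ne_zero hg
  have hq : atInfinity f / atInfinity g ≠ 0 := div_ne_zero (atInfinity_ne_zero hf) hg'
  have h1 := HahnSeries.order_mul hq hg'
  rw [div_mul_cancel₀ _ hg', atInfinity_order hf, atInfinity_order hg] at h1
  have h2 : (atInfinity f / atInfinity g).order = 1 := by omega
  have h3 := HahnSeries.coeff_mul_order_add_order (atInfinity f / atInfinity g) (atInfinity g)
  rw [div_mul_cancel₀ _ hg', HahnSeries.leadingCoeff_eq, HahnSeries.leadingCoeff_eq, h2,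
    atInfinity_order hg, atInfinity_coeff, atInfinity_coeff, if_pos (by omega), if_pos (by omega),
    Int.natAbs_neg, Int.natAbs_natCast] at h3
  have h4 : (1 + -(g.natDegree : ℤ)).natAbs = f.natDegree := by omega
  rw [h4] at h3
  exact h3.symm

/-! ### The functional 𝓕 and its restriction to the diagonal. -/

section
variable {W : R}

/-- For constant W the derivative is zero, and ℂ[x] is not finite-dimensional. Positive degree is
all that the proof extracts from the finiteness of the Jacobi ring. -/
theorem natDegree_pos_of_finite
    (hW : Module.Finite ℂ (R ⧸ Ideal.span {derivative W})) : 0 < W.natDegree := by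
  by_contra! h
  rw [derivative_of_natDegree_zero (Nat.le_zero.1 h), Ideal.span_singleton_eq_bot.2 rfl] at hW
  exact Polynomial.not_finite (R := ℂ) (Module.Finite.equiv
    ((Submodule.quotEquivOfEqBot (⊥ : Ideal R) rfl).restrictScalars ℂ))

/-- The linear extension of the `n`-th summand of `residueF`. -/
def residueTerm (W : R) (n : ℕ) : R →ₗ[ℂ] S where
  toFun p := (coeffInvX p (X * W ^ (n + 1)) • ab - coeffInvX p (W ^ (n + 1)) • (1 : S))
    * ((1 : R)⊠(W ^ n))
  map_add' p q := by rw [coeffInvX_add, coeffInvX_add, add_smul, add_smul]; ring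
  map_smul' c p := by
    rw [coeffInvX_smul, coeffInvX_smul, mul_smul, mul_smul, ← smul_sub, smul_mul_assoc]; rfl

theorem residueF_X_pow (W : R) (k : ℕ) :
    residueF W (X ^ k) = ∑ n ∈ Finset.range (k + 1), residueTerm W n (X ^ k) := by
  have h : (X : R) ^ k = Polynomial.basisMonomials ℂ k := by
    rw [Polynomial.coe_basisMonomials, Polynomial.X_pow_eq_monomial]
  conv_lhs => rw [h, residueF, Module.Basis.constr_basis]
  rfl

/-- W is not constant, so W^(n + 1) has degree at least n + 1 > deg p + 1, and the quotients are
O(x⁻²). -/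
theorem residueTerm_eq_zero (hW : 0 < W.natDegree) {n : ℕ} {p : R} (h : p.natDegree < n) :
    residueTerm W n p = 0 := by
  have hW0 : W ≠ 0 := fun h' => by simp [h'] at hW
  have h1 : n + 1 ≤ (n + 1) * W.natDegree := Nat.le_mul_of_pos_right _ hW
  change (_ • ab - _ • (1 : S)) * _ = _
  rw [coeffInvX_eq_zero (mul_ne_zero X_ne_zero (pow_ne_zero _ hW0)),
    coeffInvX_eq_zero (pow_ne_zero _ hW0), zero_smul, zero_smul, sub_zero, zero_mul]
  · rw [natDegree_pow]; omega
  · rw [natDegree_mul X_ne_zero (pow_ne_zero _ hW0), natDegree_pow, natDegree_X]; omega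

/-- Any cut-off above the degree is allowed, so 𝓕(p) and 𝓕(W p) can be compared over matching
ranges. -/
theorem residueF_eq_sum (hW : 0 < W.natDegree) (p : R) {N : ℕ} (h : p.natDegree < N) :
    residueF W p = ∑ n ∈ Finset.range N, residueTerm W n p := by
  have key : ∀ k < N, residueF W (X ^ k) = ∑ n ∈ Finset.range N, residueTerm W n (X ^ k) :=
    fun k hk => by
      rw [residueF_X_pow]
      refine Finset.sum_subset (Finset.range_mono hk) fun n _ hn => ?_
      exact residueTerm_eq_zero hW (by
        rw [natDegree_X_pow]
        rw [Finset.mem_range] at hn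
        omega)
  rw [p.as_sum_range' N h]
  simp only [← C_mul_X_pow_eq_monomial, ← smul_eq_C_mul, map_sum, map_smul]
  rw [Finset.sum_comm]
  refine Finset.sum_congr rfl fun k hk => ?_
  rw [key k (Finset.mem_range.1 hk), Finset.smul_sum]

/-- The residue theorem for `∮ (a - b - x) p(x) / x dx`. -/
theorem residueF_mul (hW : 0 < W.natDegree) (p : R) :
    residueF W (W * p) = (1⊠W) * residueF W p + augment p * ab := by
  have hW0 : W ≠ 0 := fun h' => by simp [h'] at hW
  -- The range for W p is taken one longer than that for p. Its term n + 1 is W(b) times term n of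
  -- p, and its term 0 is the contribution (a - b) p(0) of the pole at x = 0.
  have h1 : (W * p).natDegree < W.natDegree + p.natDegree + 2 :=
    natDegree_mul_le.trans_lt (by omega)
  rw [residueF_eq_sum hW _ h1, residueF_eq_sum hW p
    (show p.natDegree < W.natDegree + p.natDegree + 1 by omega), Finset.sum_range_succ',
    Finset.mul_sum]
  congr 1
  · refine Finset.sum_congr rfl fun n _ => ?_
    change (_ • ab - _ • (1 : S)) * _ = _ * ((_ • ab - _ • (1 : S)) * _)
    have h2 : X * W ^ (n + 1 + 1) = W * (X * W ^ (n + 1)) := by ring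
    have h3 : W ^ (n + 1 + 1) = W * W ^ (n + 1) := by ring
    have h4 : 1⊠(W ^ (n + 1)) = (1⊠W) * (1⊠(W ^ n)) := by rw [el_mul_el, one_mul, pow_succ']
    rw [h2, h3, coeffInvX_mul_mul hW0, coeffInvX_mul_mul hW0, h4]
    ring
  · change (_ • ab - _ • (1 : S)) * _ = algebraMap ℂ S (p.eval 0) * _
    have h2 : X * W ^ (0 + 1) = W * X := by ring
    have h3 : W ^ (0 + 1) = W * 1 := by ring
    rw [h2, h3, coeffInvX_mul_mul hW0, coeffInvX_mul_mul hW0, coeffInvX_one, coeffInvX_X, zero_smul,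
      sub_zero, pow_zero, one_el_one, mul_one, Algebra.smul_def]

/-- The functional `p ↦ ∮ p(x) / (W(x) - W(b)) dx`. -/
def residueL (W : R) : R →ₗ[ℂ] R := -(mu.toLinearMap ∘ₗ residueF W)

theorem mu_residueF (p : R) : mu (residueF W p) = -residueL W p := by
  simp [residueL]

theorem mu_residueTerm (n : ℕ) (p : R) :
    mu (residueTerm W n p) = -(coeffInvX p (W ^ (n + 1)) • W ^ n) := by
  change mu ((_ • ab - _ • (1 : S)) * _) = _
  rw [map_mul, map_sub, map_smul, map_smul, mu_ab, smul_zero, zero_sub, map_one, mu_tmul, one_mul,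
    neg_mul, smul_mul_assoc, one_mul]

theorem residueL_X_pow_eq_zero {k : ℕ} (hk : k + 1 < W.natDegree) : residueL W (X ^ k) = 0 := by
  have hW0 : W ≠ 0 := fun h' => by simp [h'] at hk
  rw [← neg_eq_zero, ← mu_residueF, residueF_X_pow, map_sum]
  refine Finset.sum_eq_zero fun n _ => ?_
  rw [mu_residueTerm, coeffInvX_eq_zero (pow_ne_zero _ hW0), zero_smul, neg_zero]
  have : W.natDegree ≤ (n + 1) * W.natDegree := Nat.le_mul_of_pos_left _ n.succ_pos
  rw [natDegree_X_pow, natDegree_pow]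
  omega

theorem residueL_X_pow_pred {k : ℕ} (hk : k + 1 = W.natDegree) :
    W.leadingCoeff • residueL W (X ^ k) = 1 := by
  have hW0 : W ≠ 0 := fun h' => by simp [h'] at hk
  -- Only n = 0 contributes, since x^(deg W - 1) / W starts in x⁻¹; for the other n the denominator
  -- has degree at least 2 deg W.
  rw [← neg_neg (residueL W _), ← mu_residueF, residueF_X_pow, map_sum, Finset.sum_range_succ']
  rw [Finset.sum_eq_zero, mu_residueTerm, zero_add, neg_neg, zero_add, pow_one, pow_zero, smul_smul,
    mul_comm, coeffInvX_of_natDegree_eq (pow_ne_zero _ X_ne_zero) (by rw [natDegree_X_pow, hk]),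
    leadingCoeff_X_pow, one_smul]
  intro n _
  rw [mu_residueTerm, coeffInvX_eq_zero (pow_ne_zero _ hW0), zero_smul, neg_zero]
  have : 2 * W.natDegree ≤ (n + 1 + 1) * W.natDegree := Nat.mul_le_mul_right _ (by omega)
  rw [natDegree_X_pow, natDegree_pow]
  omega

/-- The functional `t ↦ ∮ t(a, x, b) / (W(x) - W(b)) dx`. -/
def residueT (W : R) : T →ₗ[ℂ] S :=
  TensorProduct.lift (LinearMap.mk₂ ℂ
    (fun s r => S.equiv (TensorProduct.map LinearMap.id (residueL W) (S.equiv.symm s)) * (1⊠r))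
    (fun _ _ _ => by rw [map_add, map_add, map_add, add_mul])
    (fun _ _ _ => by rw [map_smul, map_smul, map_smul, smul_mul_assoc])
    (fun _ _ _ => by rw [el_add, mul_add])
    (fun _ _ _ => by rw [el_smul, mul_smul_comm]))

theorem residueT_tmul (p q r : R) : residueT W ((p⊠q) ⊗ₜ r) = p⊠(residueL W q * r) := by
  change (p⊠(residueL W q)) * (1⊠r) = _
  rw [el_mul_el, mul_one]

theorem residueT_outer_mul (s : S) (t : T) : residueT W (outer s * t) = s * residueT W t := by
  induction t using T_induct with
  | ha x y hx hy => rw [mul_add, map_add, hx, hy, map_add, mul_add]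
  | ht p q r =>
    induction s using S_induct with
    | ha x y hx hy => rw [map_add, add_mul, map_add, hx, hy, add_mul]
    | ht u v =>
      rw [outer_el, Algebra.TensorProduct.tmul_mul_tmul, el_mul_el, one_mul, residueT_tmul,
        residueT_tmul, el_mul_el, mul_left_comm]

theorem dd_X_pow (n : ℕ) :
    dd (X ^ n) = ∑ i ∈ Finset.range n, ((X : R) ^ i)⊠((X : R) ^ (n - 1 - i)) := by
  have h : (X : R) ^ n = Polynomial.basisMonomials ℂ n := by
    rw [Polynomial.coe_basisMonomials, Polynomial.X_pow_eq_monomial]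
  conv_lhs => rw [h, dd, Module.Basis.constr_basis]

/-- The divided difference (a^k - x^k) / (a - x) has degree at most k - 1 < deg W - 1 in x, and such
powers have residue zero. -/
theorem residueT_ddL_X_pow {k : ℕ} (hk : k < W.natDegree) (q : R) :
    residueT W (ddL ((X ^ k)⊠q)) = 0 := by
  rw [ddL_el, dd_X_pow, TensorProduct.sum_tmul, map_sum]
  refine Finset.sum_eq_zero fun i hi => ?_
  rw [Finset.mem_range] at hi
  rw [residueT_tmul, residueL_X_pow_eq_zero (by omega), zero_mul, el_zero]

theorem residueT_ddL_of_mem {s : S} (hs : s ∈ boundedDegree W.natDegree) :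
    residueT W (ddL s) = 0 := by
  induction hs using Submodule.span_induction with
  | mem s h =>
    obtain ⟨i, hi, j, _, rfl⟩ := h
    exact residueT_ddL_X_pow hi _
  | zero => rw [map_zero, map_zero]
  | add x y _ _ hx hy => rw [map_add, map_add, hx, hy, add_zero]
  | smul c x _ hx => rw [map_smul, map_smul, hx, smul_zero]

/-- Only the top power of W contributes, and within its divided difference only the summand x^(deg W
- 1) without a. The leading coefficient of W then cancels the one in the residue. -/
theorem residueT_ddL_self (hW : 0 < W.natDegree) : residueT W (ddL (W⊠1)) = 1 := by
  have h : W⊠1 = ∑ k ∈ Finset.range (W.natDegree + 1), W.coeff k • ((X ^ k : R)⊠1) := by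
    conv_lhs => rw [W.as_sum_range_C_mul_X_pow]
    have : ∀ (s : Finset ℕ) (f : ℕ → R), (∑ k ∈ s, f k)⊠1 = ∑ k ∈ s, ((f k)⊠1) :=
      fun s f => TensorProduct.sum_tmul _ _ _
    rw [this]
    exact Finset.sum_congr rfl fun k _ => by rw [← smul_eq_C_mul, smul_el]
  obtain ⟨d, hd⟩ : ∃ d, d + 1 = W.natDegree := ⟨W.natDegree - 1, by omega⟩
  rw [h, map_sum, map_sum, Finset.sum_range_succ, Finset.sum_eq_zero, zero_add, map_smul, map_smul,
    ← hd, ddL_el, dd_X_pow, TensorProduct.sum_tmul, map_sum, Finset.sum_range_succ',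
    Finset.sum_eq_zero, zero_add, residueT_tmul, mul_one, pow_zero, ← el_smul, Nat.add_sub_cancel,
    Nat.sub_zero, hd]
  · change 1⊠(W.leadingCoeff • _) = _
    rw [residueL_X_pow_pred hd, one_el_one]
  · intro i hi
    rw [Finset.mem_range] at hi
    rw [residueT_tmul, residueL_X_pow_eq_zero (by omega), zero_mul, el_zero]
  · intro k hk
    rw [map_smul, map_smul, residueT_ddL_X_pow (Finset.mem_range.1 hk), smul_zero]

end

/-! ### Contractions over a basis, and what remains of them on the diagonal. -/

section Contract
variable {M : Type} [AddCommGroup M] [Module S M] {ι : Type} [Fintype ι] (b : Module.Basis ι S M)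

/-- The contraction with `G` at `a = b`: the linear map `p(x) q(b) ↦ μ(G(p)) q`. -/
def diagExt (G : R →ₗ[ℂ] S) : S →ₗ[ℂ] R :=
  TensorProduct.lift ((LinearMap.mul ℂ R).compl₁₂ (mu.toLinearMap ∘ₗ G) LinearMap.id) ∘ₗ
    S.equiv.symm.toLinearMap

theorem diagExt_el (G : R →ₗ[ℂ] S) (p q : R) : diagExt G (p⊠q) = mu (G p) * q := rfl

theorem contractSummand_el (G : R →ₗ[ℂ] S) (u v u' v' : R) :
    contractSummand G (u⊠v) (u'⊠v') = G (u * u') * (v⊠v') := by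
  rw [contractSummand, outer_el, Algebra.TensorProduct.tmul_mul_tmul, el_mul_el, mul_one, one_mul,
    extAB_tmul]

/-- For a = b the factors p(x, a) and q(x, b) are polynomials in the same two variables, so only
their product matters. -/
theorem mu_contractSummand (G : R →ₗ[ℂ] S) (p q : S) :
    mu (contractSummand G p q) = diagExt G (p * q) := by
  induction p using S_induct with
  | ha x y hx hy => rw [contractSummand_add, map_add, hx, hy, add_mul, map_add]
  | ht u v =>
    induction q using S_induct with
    | ha x y hx hy => rw [contractSummand_add', map_add, hx, hy, mul_add, map_add]
    | ht u' v' => rw [contractSummand_el, map_mul, mu_tmul, el_mul_el, diagExt_el]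

theorem contract_tmul (G : R →ₗ[ℂ] S) (φ : BDual M) (m : M) :
    contract G b (tmul φ m) = ∑ i, contractSummand G (φ (b i)) (b.repr m i) := rfl

/-- Once only products matter, the sum over the basis reassembles φ(m). Modulo a - b the contraction
is therefore independent of the basis, the source of dinaturality. -/
theorem mu_contract (G : R →ₗ[ℂ] S) (φ : BDual M) (m : M) :
    mu (contract G b (tmul φ m)) = diagExt G (φ m) := by
  rw [contract_tmul, map_sum]
  conv_rhs => rw [← b.sum_repr m, map_sum, map_sum]
  refine Finset.sum_congr rfl fun i _ => ?_
  rw [mu_contractSummand, map_smul, smul_eq_mul, mul_comm]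

variable {W : R}

/-- W(x) - W(b) cancels the denominator of 𝓕; the remaining residue at x = 0 is a multiple of a - b,
hence zero on the diagonal. -/
theorem diagExt_residueF (hW : 0 < W.natDegree) (s : S) :
    diagExt (residueF W) ((W⊠1) * s - (1⊠W) * s) = 0 := by
  induction s using S_induct with
  | ha x y hx hy => rw [mul_add, mul_add, add_sub_add_comm, map_add, hx, hy, add_zero]
  | ht p q =>
    rw [el_mul_el, el_mul_el, one_mul, one_mul, map_sub, diagExt_el, diagExt_el, residueF_mul hW,
      map_add, map_mul, map_mul, mu_ab, mu_tmul]
    ring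

/-- The same cancellation off the diagonal: the residue at x = 0 survives and is a - b times the
value at x = 0. This explains the component C. -/
theorem contractSummand_residueF (hW : 0 < W.natDegree) (p q : S) :
    contractSummand (residueF W) p ((W⊠1) * q - (1⊠W) * q) =
      ab * contractSummand augment p q := by
  induction p using S_induct with
  | ha x y hx hy => rw [contractSummand_add, hx, hy, contractSummand_add, mul_add]
  | ht u v =>
    induction q using S_induct with
    | ha x y hx hy =>
      rw [mul_add, mul_add, add_sub_add_comm, contractSummand_add', hx, hy, contractSummand_add',
        mul_add]
    | ht u' v' =>
      have h : (W⊠1) * (u'⊠v') - (1⊠W) * (u'⊠v') = (W * u')⊠v' + u'⊠(-(W * v')) := by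
        rw [el_mul_el, el_mul_el, one_mul, one_mul, ← neg_one_smul ℂ, el_smul, neg_one_smul,
          sub_eq_add_neg]
      have h' : v⊠(-(W * v')) = -((1⊠W) * (v⊠v')) := by
        rw [el_mul_el, one_mul, ← neg_one_smul ℂ, el_smul, neg_one_smul]
      rw [h, contractSummand_add', contractSummand_el, contractSummand_el, contractSummand_el,
        mul_left_comm, residueF_mul hW, h']
      ring

theorem contract_residueF (hW : 0 < W.natDegree) (φ : BDual M) (m : M) :
    contract (residueF W) b (tmul φ ((W⊠1) • m - (1⊠W) • m)) =
      ab * contract augment b (tmul φ m) := by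
  rw [contract_tmul, contract_tmul, Finset.mul_sum]
  refine Finset.sum_congr rfl fun i _ => ?_
  rw [map_sub, map_smul, map_smul, Finsupp.sub_apply, Finsupp.smul_apply, Finsupp.smul_apply,
    smul_eq_mul, smul_eq_mul, contractSummand_residueF hW]

end Contract

variable {W : R}

/-! ### The evaluation. -/

section ToUnit
variable {Y : MBF W}

/-- Multiplying by a - b turns both sides into f₀ d₁ d₀, because (a - b) times the other
differential of I is W(a) - W(b). -/
theorem closed₀_of_closed₁_unit {f₀ : Y.X₀ →ₗ[S] S} {f₁ : Y.X₁ →ₗ[S] S}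
    (h : ∀ m, ab * f₁ m = f₀ (Y.d₁ m)) (m : Y.X₀) : dd W * f₀ m = f₁ (Y.d₀ m) := by
  refine mul_left_cancel₀ ab_ne_zero ?_
  rw [h, Y.d₁_d₀, ← mul_assoc, ab_mul_dd, map_sub, map_smul, map_smul, smul_eq_mul, smul_eq_mul,
    sub_mul]

/-- Closed maps to the unit object are homotopic when they agree in degree `0` on the diagonal. -/
theorem homotopic_of_mu_eq (f g : ClosedMap Y (MBF.unit W))
    (h : ∀ m, mu (f.f₀ m) = mu (g.f₀ m)) : Homotopic f g := by
  let f₀ : Y.X₀ →ₗ[S] S := f.f₀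
  let g₀ : Y.X₀ →ₗ[S] S := g.f₀
  let f₁ : Y.X₁ →ₗ[S] S := f.f₁
  let g₁ : Y.X₁ →ₗ[S] S := g.f₁
  have hf : ∀ m, ab * f₁ m = f₀ (Y.d₁ m) := f.closed₁
  have hg : ∀ m, ab * g₁ m = g₀ (Y.d₁ m) := g.closed₁
  obtain ⟨k, hk⟩ := exists_ab_mul (f₀ - g₀) fun m => by
    rw [LinearMap.sub_apply, map_sub, sub_eq_zero]
    exact h m
  -- The homotopy is the quotient of the degree 0 difference by a - b. In degree 1 the required
  -- identity is closedness, read after multiplication by a - b.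
  refine ⟨k, (0 : Y.X₁ →ₗ[S] S), fun m => ?_, fun m => ?_⟩
  · have key : f₀ m - g₀ m = ab * k m + 0 := by rw [hk, add_zero, LinearMap.sub_apply]
    exact key
  · have key : f₁ m - g₁ m = dd W * 0 + k (Y.d₁ m) := by
      refine mul_left_cancel₀ ab_ne_zero ?_
      rw [mul_zero, zero_add, hk, LinearMap.sub_apply, mul_sub, hf, hg]
    exact key

end ToUnit

section Ev
variable {Z : MBF W} (F : Frame Z) (hW : 0 < W.natDegree)

include hW in
-- On the diagonal the contraction depends only on φ(d₁ d₀ m) = (W(x) - W(b)) φ(m), whose residue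
-- vanishes. This is the divisibility by a - b that B needs.
theorem Frame.exists_evB : ∃ B : BTensor (BDual Z.X₀) Z.X₀ →ₗ[S] S,
    ∀ t, ab * B t = contract (residueF W) F.b₁ (BTensor.map (BDual.map Z.d₁) Z.d₀ t) := by
  refine exists_ab_mul (contract (residueF W) F.b₁ ∘ₗ BTensor.map (BDual.map Z.d₁) Z.d₀) fun t => ?_
  rw [LinearMap.comp_apply]
  induction t using BTensor.induct with
  | h0 => simp
  | ha x y hx hy => rw [map_add, map_add, map_add, hx, hy, add_zero]
  | ht φ m =>
    rw [BTensor.map_tmul, mu_contract, BDual.map_apply, Z.d₁_d₀, map_sub, map_smul, map_smul]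
    exact diagExt_residueF hW _

/-- The component `B` of the evaluation. -/
def Frame.evB : BTensor (BDual Z.X₀) Z.X₀ →ₗ[S] S := Classical.choose (F.exists_evB hW)

theorem Frame.ab_mul_evB (t : BTensor (BDual Z.X₀) Z.X₀) :
    ab * F.evB hW t = contract (residueF W) F.b₁ (BTensor.map (BDual.map Z.d₁) Z.d₀ t) :=
  Classical.choose_spec (F.exists_evB hW) t

/-- The component `A` of the evaluation. -/
def Frame.evA : BTensor (BDual Z.X₁) Z.X₀ →ₗ[S] S :=
  -(contract (residueF W) F.b₁ ∘ₗ BTensor.map LinearMap.id Z.d₀)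

theorem Frame.evA_apply (t : BTensor (BDual Z.X₁) Z.X₀) :
    F.evA t = -contract (residueF W) F.b₁ (BTensor.map LinearMap.id Z.d₀ t) := rfl

/-- The evaluation in degree `0`. -/
def Frame.ev₀ : BTensor (BDual Z.X₁) Z.X₀ × BTensor (BDual Z.X₀) Z.X₁ →ₗ[S] S :=
  F.evA ∘ₗ LinearMap.fst S _ _

/-- The evaluation in degree `1`. -/
def Frame.ev₁ : BTensor (BDual Z.X₀) Z.X₀ × BTensor (BDual Z.X₁) Z.X₁ →ₗ[S] S :=
  LinearMap.coprod (F.evB hW) (-contract augment F.b₁)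

/-- On the first summand this is the defining property of B, the signs of A and of -d₁^∨ cancelling.
On the second, d₀d₁ supplies W(x) - W(b), and the residue theorem produces a - b times C. -/
theorem Frame.ev_closed₁ (m : BTensor (BDual Z.X₀) Z.X₀ × BTensor (BDual Z.X₁) Z.X₁) :
    ab * F.ev₁ hW m = F.ev₀ (tensorD₁ Z.dual Z m) := by
  refine pair_apply_ext (mulBy S ab ∘ₗ F.ev₁ hW) (F.ev₀ ∘ₗ tensorD₁ Z.dual Z) (fun φ n => ?_)
    (fun φ n => ?_) m
  · have h : tensorD₁ Z.dual Z (tmul φ n, 0) = (tmul (-BDual.map Z.d₁ φ) n, -tmul φ (Z.d₀ n)) :=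
      tensorD₁_fst Z.dual Z φ n
    have key : ab * (F.evB hW (tmul φ n) + -contract augment F.b₁ 0) =
        F.evA (tmul (-BDual.map Z.d₁ φ) n) := by
      rw [map_zero, neg_zero, add_zero, F.ab_mul_evB, F.evA_apply, neg_tmul, map_neg, map_neg,
        neg_neg, BTensor.map_tmul, BTensor.map_tmul, LinearMap.id_apply]
    exact key.trans (congrArg (fun z => F.ev₀ z) h).symm
  · have h : tensorD₁ Z.dual Z (0, tmul φ n) = (tmul φ (Z.d₁ n), tmul (BDual.map Z.d₀ φ) n) :=
      tensorD₁_snd Z.dual Z φ n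
    have key : ab * (F.evB hW 0 + -contract augment F.b₁ (tmul φ n)) =
        F.evA (tmul φ (Z.d₁ n)) := by
      rw [map_zero, zero_add, F.evA_apply, BTensor.map_tmul, Z.d₀_d₁, LinearMap.id_apply,
        contract_residueF F.b₁ hW, mul_neg]
    exact key.trans (congrArg (fun z => F.ev₀ z) h).symm

/-- The evaluation. -/
def Frame.ev : ClosedMap (Z.dual.tensor Z) (MBF.unit W) where
  f₀ := F.ev₀
  f₁ := F.ev₁ hW
  closed₀ := closed₀_of_closed₁_unit (Y := Z.dual.tensor Z) (F.ev_closed₁ hW)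
  closed₁ := F.ev_closed₁ hW

theorem Frame.isEv : F.IsEv (F.ev hW) :=
  ⟨F.evB hW, F.ab_mul_evB hW, fun _ _ => rfl, fun _ _ => (sub_eq_add_neg _ _).symm⟩

/-- The right side mentions no basis. Dinaturality and both Zorro computations use A only through
this formula. -/
theorem Frame.mu_evA (φ : BDual Z.X₁) (m : Z.X₀) :
    mu (F.evA (tmul φ m)) = -diagExt (residueF W) (φ (Z.d₀ m)) := by
  rw [F.evA_apply, map_neg, BTensor.map_tmul, mu_contract, LinearMap.id_apply]

/-- The evaluation is dinatural up to homotopy. -/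
theorem Frame.ev_dinatural {Z' : MBF W} (F' : Frame Z') (φ : ClosedMap Z Z') :
    Homotopic ((F.ev hW).comp (φ.dual.tensor (ClosedMap.id Z)))
      ((F'.ev hW).comp ((ClosedMap.id Z'.dual).tensor φ)) := by
  refine homotopic_of_mu_eq _ _ fun (m : BTensor (BDual Z'.X₁) Z.X₀ × BTensor (BDual Z'.X₀) Z.X₁) => ?_
  -- Modulo a - b the two sides are the residues of ψ(φ₁ d₀ n) and ψ(d₀ φ₀ n), which agree because φ
  -- is closed.
  have h : ∀ t : BTensor (BDual Z'.X₁) Z.X₀,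
      mu (F.evA (BTensor.map (BDual.map φ.f₁) LinearMap.id t)) =
        mu (F'.evA (BTensor.map LinearMap.id φ.f₀ t)) := fun t => by
    induction t using BTensor.induct with
    | h0 => simp
    | ha x y hx hy => simp only [map_add, hx, hy]
    | ht ψ n =>
      rw [BTensor.map_tmul, BTensor.map_tmul, F.mu_evA, F'.mu_evA, LinearMap.id_apply,
        LinearMap.id_apply, BDual.map_apply, φ.closed₀]
  have e₁ : (F.ev₀ (matMap (BTensor.map (BDual.map φ.f₁) LinearMap.id) 0 0
      (BTensor.map (BDual.map φ.f₀) LinearMap.id) m)) =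
      F.evA (BTensor.map (BDual.map φ.f₁) LinearMap.id m.1) := by
    rw [matMap_apply, LinearMap.zero_apply, add_zero]; rfl
  have e₂ : (F'.ev₀ (matMap (BTensor.map LinearMap.id φ.f₀) 0 0
      (BTensor.map LinearMap.id φ.f₁) m)) =
      F'.evA (BTensor.map LinearMap.id φ.f₀ m.1) := by
    rw [matMap_apply, LinearMap.zero_apply, add_zero]; rfl
  exact (congrArg mu e₁).trans ((h m.1).trans (congrArg mu e₂).symm)

end Ev

/-! ### The coevaluation. -/

section DualBasis
variable {M N : Type} [AddCommGroup M] [Module S M] [AddCommGroup N] [Module S N]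
  {ι κ : Type} [Fintype ι] [Fintype κ] (b : Module.Basis ι S M) (c : Module.Basis κ S N)

/-- Scalars act on the dual through `swap`, so coordinates of a functional are its values with a and
b exchanged. -/
theorem dualBasis_repr (φ : BDual M) (i : ι) : (dualBasis b).repr φ i = swap (φ (b i)) := rfl

theorem dualBasis_apply (j : ι) (m : M) : dualBasis b j m = b.repr m j := by
  have h : (show M →ₗ[S] S from dualBasis b j) = b.coord j := b.ext fun i => by
    have h1 := dualBasis_repr b (dualBasis b j) i
    rw [Module.Basis.repr_self] at h1
    have h2 := congrArg swap h1
    rw [swap_swap] at h2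
    change dualBasis b j (b i) = _
    classical
    rw [← h2, Module.Basis.coord_apply, Module.Basis.repr_self, Finsupp.single_apply,
      Finsupp.single_apply]
    by_cases hij : j = i
    · rw [if_pos hij, if_pos hij.symm, map_one]
    · rw [if_neg hij, if_neg (Ne.symm hij), map_zero]
  exact LinearMap.congr_fun h m

theorem BDual.map_dualBasis (f : M →ₗ[S] N) (i : κ) :
    BDual.map f (dualBasis c i) = ∑ j, swap (c.repr (f (b j)) i) • dualBasis b j := by
  conv_lhs => rw [← (dualBasis b).sum_repr (BDual.map f (dualBasis c i))]
  refine Finset.sum_congr rfl fun j _ => ?_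
  rw [dualBasis_repr, BDual.map_apply, dualBasis_apply]

/-- The divided difference `(f(a, x) - f(b, x)) / (a - b)` as an element of `N ⊗_R M^∨`. -/
def ddElement (f : M →ₗ[S] N) : BTensor N (BDual M) :=
  ∑ j, ∑ i, ddO (c.repr (f (b j)) i) • tmul (c i) (dualBasis b j)

/-- The matrix of f acts in the variables a, x in the first sum. In the second it passes through the
dual and acts in b, x. For f = d this makes the coevaluation closed; for f a closed morphism it
provides the homotopy behind dinaturality. -/
theorem ab_smul_ddElement (f : M →ₗ[S] N) : ab • ddElement b c f =
    ∑ j, tmul (f (b j)) (dualBasis b j) - ∑ i, tmul (c i) (BDual.map f (dualBasis c i)) := by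
  have h₁ : ∀ j, tmul (f (b j)) (dualBasis b j) =
      ∑ i, inclAX (c.repr (f (b j)) i) • tmul (c i) (dualBasis b j) := fun j => by
    conv_lhs => rw [← c.sum_repr (f (b j)), sum_tmul]
    exact Finset.sum_congr rfl fun i _ => smul_tmul_eq _ _ _
  have h₂ : ∀ i, tmul (c i) (BDual.map f (dualBasis c i)) =
      ∑ j, inclXB (swap (c.repr (f (b j)) i)) • tmul (c i) (dualBasis b j) := fun i => by
    rw [BDual.map_dualBasis b c, tmul_sum]
    exact Finset.sum_congr rfl fun j _ => tmul_smul_eq _ _ _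
  rw [Finset.sum_congr rfl fun j _ => h₁ j, Finset.sum_congr rfl fun i _ => h₂ i,
    Finset.sum_comm (s := (Finset.univ : Finset κ)), ← Finset.sum_sub_distrib, ddElement,
    smul_eq_outer_smul, Finset.smul_sum]
  refine Finset.sum_congr rfl fun j _ => ?_
  rw [← Finset.sum_sub_distrib, Finset.smul_sum]
  refine Finset.sum_congr rfl fun i _ => ?_
  rw [smul_smul, ab_mul_ddO, sub_smul]

end DualBasis

section FromUnit
variable {Y : MBF W}

/-- Multiply by a - b: then both sides become d₀ d₁ y₁ = (W(a) - W(b)) y₁. -/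
theorem closed_of_unit (hY : ∀ y : Y.X₁, ab • y = 0 → y = 0) (y₀ : Y.X₀) (y₁ : Y.X₁)
    (h : Y.d₁ y₁ = ab • y₀) : Y.d₀ y₀ = dd W • y₁ := by
  rw [← sub_eq_zero]
  refine hY _ ?_
  rw [smul_sub, ← map_smul, ← h, Y.d₀_d₁, smul_smul, ab_mul_dd, sub_smul, sub_self]

/-- Closed maps from the unit object are homotopic when their difference in degree `1` is divisible
by `a - b`. -/
theorem homotopic_of_unit (hY : ∀ y : Y.X₀, ab • y = 0 → y = 0) (f g : ClosedMap (MBF.unit W) Y)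
    (y : Y.X₁) (h : ab • y = f.f₁ (1 : S) - g.f₁ (1 : S)) : Homotopic f g := by
  let f₀ : S →ₗ[S] Y.X₀ := f.f₀
  let g₀ : S →ₗ[S] Y.X₀ := g.f₀
  let f₁ : S →ₗ[S] Y.X₁ := f.f₁
  let g₁ : S →ₗ[S] Y.X₁ := g.f₁
  have hf : ∀ m : S, Y.d₁ (f₁ m) = f₀ (ab * m) := f.closed₁
  have hg : ∀ m : S, Y.d₁ (g₁ m) = g₀ (ab * m) := g.closed₁
  have h' : ab • y = f₁ 1 - g₁ 1 := h
  -- Closedness fixes the degree 0 values up to multiples of a - b, which can be cancelled, so y is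
  -- a homotopy in degree 0 as well.
  have key₀ : f₀ 1 - g₀ 1 = Y.d₁ y := by
    rw [← sub_eq_zero]
    refine hY _ ?_
    rw [smul_sub, smul_sub, ← map_smul Y.d₁, h', map_sub, hf, hg, ← map_smul, ← map_smul,
      smul_eq_mul, sub_self]
  have hs : ∀ {P : Type} [AddCommGroup P] [Module S P] (k : S →ₗ[S] P) (m : S), k m = m • k 1 :=
    fun k m => by rw [← map_smul, smul_eq_mul, mul_one]
  refine ⟨(LinearMap.toSpanSingleton S Y.X₁ y : S →ₗ[S] Y.X₁), (0 : S →ₗ[S] Y.X₀),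
    fun (m : S) => ?_, fun (m : S) => ?_⟩
  · have key : f₀ m - g₀ m = Y.d₁ (m • y) + 0 := by
      rw [hs f₀, hs g₀, ← smul_sub, key₀, map_smul, add_zero]
    exact key
  · have key : f₁ m - g₁ m = Y.d₀ 0 + (ab * m) • y := by
      rw [hs f₁, hs g₁, ← smul_sub, ← h', smul_smul, map_zero, zero_add, mul_comm]
    exact key

end FromUnit

section Coev
variable {Z : MBF W} (F : Frame Z)

theorem BTensor.pair_ab_smul_eq_zero {M N M' N' : Type} [AddCommGroup M] [Module S M]
    [AddCommGroup N] [Module S N] [AddCommGroup M'] [Module S M'] [AddCommGroup N'] [Module S N']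
    {ι κ ι' κ' : Type} [Fintype ι] [Fintype κ] [Fintype ι'] [Fintype κ'] (b : Module.Basis ι S M)
    (c : Module.Basis κ S N) (b' : Module.Basis ι' S M') (c' : Module.Basis κ' S N')
    (z : BTensor M N × BTensor M' N') (h : ab • z = 0) : z = 0 :=
  Prod.ext (BTensor.smul_eq_zero b c outer_ab_ne_zero (congrArg Prod.fst h))
    (BTensor.smul_eq_zero b' c' outer_ab_ne_zero (congrArg Prod.snd h))

/-- The value of the coevaluation at `1` in degree `0`. -/
def Frame.coevElt₀ : BTensor Z.X₀ (BDual Z.X₁) × BTensor Z.X₁ (BDual Z.X₀) :=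
  (ddElement F.b₁ F.b₀ Z.d₁, ddElement F.b₀ F.b₁ Z.d₀)

/-- The value of the coevaluation at `1` in degree `1`. -/
def Frame.coevElt₁ : BTensor Z.X₁ (BDual Z.X₁) × BTensor Z.X₀ (BDual Z.X₀) :=
  (∑ j, tmul (F.b₁ j) (dualBasis F.b₁ j), ∑ j, tmul (F.b₀ j) (dualBasis F.b₀ j))

/-- The signs in the tensor differential and in -d₁^∨ turn the two contributions in each component
into the difference computed by `ab_smul_ddElement`. -/
theorem Frame.d₁_coevElt₁ : tensorD₁ Z Z.dual F.coevElt₁ = ab • F.coevElt₀ := by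
  refine Prod.ext ?_ ?_
  · have key : BTensor.map Z.d₁ LinearMap.id (∑ j, tmul (F.b₁ j) (dualBasis F.b₁ j)) +
        BTensor.map LinearMap.id (-BDual.map Z.d₁) (∑ j, tmul (F.b₀ j) (dualBasis F.b₀ j)) =
        ab • ddElement F.b₁ F.b₀ Z.d₁ := by
      rw [ab_smul_ddElement, map_sum, map_sum, sub_eq_add_neg, ← Finset.sum_neg_distrib]
      simp only [BTensor.map_tmul, LinearMap.id_apply, LinearMap.neg_apply, tmul_neg]
    exact key
  · have key : -BTensor.map LinearMap.id (BDual.map Z.d₀) (∑ j, tmul (F.b₁ j) (dualBasis F.b₁ j)) +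
        BTensor.map Z.d₀ LinearMap.id (∑ j, tmul (F.b₀ j) (dualBasis F.b₀ j)) =
        ab • ddElement F.b₀ F.b₁ Z.d₀ := by
      rw [ab_smul_ddElement, map_sum, map_sum, sub_eq_neg_add]
      simp only [BTensor.map_tmul, LinearMap.id_apply]
    exact key

/-- The coevaluation as a closed map. -/
def Frame.coevMap : ClosedMap (MBF.unit W) (Z.tensor Z.dual) where
  toEvenMap := F.coev
  closed₀ := fun (s : S) => by
    let D : BTensor Z.X₀ (BDual Z.X₁) × BTensor Z.X₁ (BDual Z.X₀) →ₗ[S]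
      BTensor Z.X₁ (BDual Z.X₁) × BTensor Z.X₀ (BDual Z.X₀) := tensorD₀ Z Z.dual
    have h : D F.coevElt₀ = dd W • F.coevElt₁ :=
      closed_of_unit (Y := Z.tensor Z.dual) (BTensor.pair_ab_smul_eq_zero F.b₁ (dualBasis F.b₁)
        F.b₀ (dualBasis F.b₀)) F.coevElt₀ F.coevElt₁ F.d₁_coevElt₁
    have key : D (s • F.coevElt₀) = (dd W * s) • F.coevElt₁ := by
      rw [map_smul, h, smul_smul, mul_comm]
    exact key
  closed₁ := fun (s : S) => by
    let D : BTensor Z.X₁ (BDual Z.X₁) × BTensor Z.X₀ (BDual Z.X₀) →ₗ[S]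
      BTensor Z.X₀ (BDual Z.X₁) × BTensor Z.X₁ (BDual Z.X₀) := tensorD₁ Z Z.dual
    have h : D F.coevElt₁ = ab • F.coevElt₀ := F.d₁_coevElt₁
    have key : D (s • F.coevElt₁) = (ab * s) • F.coevElt₀ := by
      rw [map_smul, h, smul_smul, mul_comm]
    exact key

/-- The coevaluation is dinatural up to homotopy. -/
theorem Frame.coev_dinatural {Z' : MBF W} (F' : Frame Z') (φ : ClosedMap Z Z') :
    Homotopic ((φ.tensor (ClosedMap.id Z.dual)).comp F.coevMap)
      (((ClosedMap.id Z').tensor φ.dual).comp F'.coevMap) := by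
  -- The homotopy is given by the divided differences of the matrices of φ, in the same way as the
  -- coevaluation uses those of d.
  refine homotopic_of_unit (Y := Z'.tensor Z.dual) (BTensor.pair_ab_smul_eq_zero F'.b₀
    (dualBasis F.b₁) F'.b₁ (dualBasis F.b₀)) _ _
    ((ddElement F.b₁ F'.b₁ φ.f₁, ddElement F.b₀ F'.b₀ φ.f₀) :
      BTensor Z'.X₁ (BDual Z.X₁) × BTensor Z'.X₀ (BDual Z.X₀)) ?_
  have key : ((ab • ddElement F.b₁ F'.b₁ φ.f₁, ab • ddElement F.b₀ F'.b₀ φ.f₀) :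
      BTensor Z'.X₁ (BDual Z.X₁) × BTensor Z'.X₀ (BDual Z.X₀)) =
      matMap (BTensor.map φ.f₁ LinearMap.id) 0 0 (BTensor.map φ.f₀ LinearMap.id)
          ((1 : S) • F.coevElt₁) -
        matMap (BTensor.map LinearMap.id (BDual.map φ.f₁)) 0 0
          (BTensor.map LinearMap.id (BDual.map φ.f₀)) ((1 : S) • F'.coevElt₁) := by
    rw [one_smul, one_smul, matMap_apply, matMap_apply, ab_smul_ddElement, ab_smul_ddElement]
    simp only [Frame.coevElt₁, map_sum, BTensor.map_tmul, LinearMap.id_apply, LinearMap.zero_apply,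
      Finset.sum_const_zero, add_zero, zero_add, Prod.mk_sub_mk]
  exact key

end Coev

/-! ### Contractions occurring in the Zorro composites. -/

section Contractions
variable {A B C D E F : Type}
  [AddCommGroup A] [Module S A] [AddCommGroup B] [Module S B]
  [AddCommGroup C] [Module S C] [AddCommGroup D] [Module S D]
  [AddCommGroup E] [Module S E] [AddCommGroup F] [Module S F]

theorem BTensor.map_map (f : A →ₗ[S] B) (g : D →ₗ[S] E) (f' : B →ₗ[S] C) (g' : E →ₗ[S] F)
    (z : BTensor A D) :
    BTensor.map f' g' (BTensor.map f g z) = BTensor.map (f' ∘ₗ f) (g' ∘ₗ g) z := by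
  induction z using BTensor.induct with
  | h0 => simp
  | ha x y hx hy => simp only [map_add, hx, hy]
  | ht m n => rfl

theorem BTensor.map_zero_left (g : C →ₗ[S] D) (z : BTensor A C) :
    BTensor.map (0 : A →ₗ[S] B) g z = 0 := by
  induction z using BTensor.induct with
  | h0 => simp
  | ha x y hx hy => rw [map_add, hx, hy, add_zero]
  | ht m n => rw [BTensor.map_tmul, LinearMap.zero_apply, zero_tmul]

theorem BTensor.map_zero_right (f : A →ₗ[S] B) (z : BTensor A C) :
    BTensor.map f (0 : C →ₗ[S] D) z = 0 := by
  induction z using BTensor.induct with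
  | h0 => simp
  | ha x y hx hy => rw [map_add, hx, hy, add_zero]
  | ht m n => rw [BTensor.map_tmul, LinearMap.zero_apply, tmul_zero]

/-- Contraction of the last two factors, followed by the right unit map. -/
def contractRight (g : BTensor C E →ₗ[S] S) : BTensor (BTensor A C) E →ₗ[S] A :=
  rUnit A ∘ₗ BTensor.map LinearMap.id g ∘ₗ assocFun

/-- Contraction of the first two factors, followed by the left unit map. -/
def contractLeft (g : BTensor A C →ₗ[S] S) : BTensor A (BTensor C E) →ₗ[S] E :=
  lUnit E ∘ₗ BTensor.map g LinearMap.id ∘ₗ assocInv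

theorem contractRight_tmul (g : BTensor C E →ₗ[S] S) (a : A) (c : C) (e : E) :
    contractRight g (tmul (tmul a c) e) = (1⊠(mu (g (tmul c e)))) • a := rfl

theorem contractLeft_tmul (g : BTensor A C →ₗ[S] S) (a : A) (c : C) (e : E) :
    contractLeft g (tmul a (tmul c e)) = ((mu (g (tmul a c)))⊠1) • e := rfl

/-- The evaluation in degree 0 vanishes on its second summand, which discards one of the two entries
in this row of the associator. -/
theorem rUnit_assocMat (g : BTensor C E →ₗ[S] S)
    (z : BTensor (BTensor A C × BTensor B D) E × BTensor (BTensor B C × BTensor A D) F) :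
    rUnit A (BTensor.map LinearMap.id (g ∘ₗ LinearMap.fst S _ (BTensor D F))
      (assocMat A B C D E F z).1) =
      contractRight g (BTensor.map (LinearMap.fst S _ _) LinearMap.id z.1) := by
  rw [assocMat, matMap_apply, map_add, LinearMap.comp_apply, LinearMap.comp_apply,
    LinearMap.comp_apply, LinearMap.comp_apply, BTensor.map_map, BTensor.map_map,
    LinearMap.comp_assoc, LinearMap.comp_assoc, LinearMap.fst_comp_inl, LinearMap.fst_comp_inr,
    LinearMap.comp_zero, BTensor.map_zero_right, add_zero, LinearMap.comp_id, LinearMap.comp_id]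
  rfl

theorem lUnit_assocInvMat_fst (g : BTensor A C →ₗ[S] S)
    (z : BTensor A (BTensor C E × BTensor D F) × BTensor B (BTensor D E × BTensor C F)) :
    lUnit E (BTensor.map (g ∘ₗ LinearMap.fst S _ (BTensor B D)) LinearMap.id
      (assocInvMat A B C D E F z).1) =
      contractLeft g (BTensor.map LinearMap.id (LinearMap.fst S _ _) z.1) := by
  rw [assocInvMat, matMap_apply, map_add, LinearMap.comp_apply, LinearMap.comp_apply,
    LinearMap.comp_apply, LinearMap.comp_apply, BTensor.map_map, BTensor.map_map,
    LinearMap.comp_assoc, LinearMap.comp_assoc, LinearMap.fst_comp_inl, LinearMap.fst_comp_inr,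
    LinearMap.comp_zero, BTensor.map_zero_left, add_zero, LinearMap.comp_id, LinearMap.comp_id]
  rfl

theorem lUnit_assocInvMat_snd (g : BTensor B C →ₗ[S] S)
    (z : BTensor A (BTensor C E × BTensor D F) × BTensor B (BTensor D E × BTensor C F)) :
    lUnit F (BTensor.map (g ∘ₗ LinearMap.fst S _ (BTensor A D)) LinearMap.id
      (assocInvMat A B C D E F z).2) =
      contractLeft g (BTensor.map LinearMap.id (LinearMap.snd S _ _) z.2) := by
  rw [assocInvMat, matMap_apply, map_add, LinearMap.comp_apply, LinearMap.comp_apply,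
    LinearMap.comp_apply, LinearMap.comp_apply, BTensor.map_map, BTensor.map_map,
    LinearMap.comp_assoc, LinearMap.comp_assoc, LinearMap.fst_comp_inl, LinearMap.fst_comp_inr,
    LinearMap.comp_zero, BTensor.map_zero_left, zero_add, LinearMap.comp_id, LinearMap.comp_id]
  rfl

end Contractions

/-! ### The twisted Leibniz rule and scalars under a contraction. -/

section Residue
variable {W : R}

theorem diagExt_mul (G : R →ₗ[ℂ] S) (r : R) (s : S) : diagExt G ((1⊠r) * s) = r * diagExt G s := by
  induction s using S_induct with
  | ha x y hx hy => rw [mul_add, map_add, map_add, mul_add, hx, hy]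
  | ht p q => rw [el_mul_el, diagExt_el, diagExt_el, one_mul]; ring

/-- This links the residue over x in ℂ[a, x, b] with the diagonal value of the contraction; the sign
is the one between 𝓕 for a = b and `residueL`. -/
theorem residueT_mul_inclXB (u v r : R) (s : S) :
    residueT W ((u⊠v) ⊗ₜ r * inclXB s) = u⊠(r * -diagExt (residueF W) ((v⊠1) * s)) := by
  induction s using S_induct with
  | ha x y hx hy =>
    rw [map_add, mul_add, map_add, hx, hy, mul_add, map_add, neg_add, mul_add, el_add]
  | ht p q =>
    rw [inclXB_el, Algebra.TensorProduct.tmul_mul_tmul, el_mul_el, residueT_tmul, el_mul_el,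
      diagExt_el, mu_residueF, mul_one, one_mul]
    congr 1
    ring

/-- The divided difference is a twisted derivation: `ddL P` times Q(x, b) equals `ddL (P Q)` minus
P(a, b) times `ddL Q`. The product sum is c (W(a) - W(b)); its divided difference has residue c, and
P(a, b) leaves the residue as a scalar. -/
theorem sum_residueT_ddL_mul (hW : 0 < W.natDegree) {ι : Type} [Fintype ι] (P Q : ι → S) (c : ℂ)
    (h : ∑ i, P i * Q i = c • (W⊠1 - 1⊠W)) :
    ∑ i, residueT W (ddL (P i) * inclXB (Q i)) = c • 1 - ∑ i, P i * residueT W (ddL (Q i)) := by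
  -- The rule is verified after multiplication by a - x, where both sides telescope. The term W(b)
  -- does not involve a and drops out of the divided difference.
  have key : ∑ i, ddL (P i) * inclXB (Q i) = c • ddL (W⊠1) - ∑ i, outer (P i) * ddL (Q i) := by
    refine mul_left_cancel₀ inclAX_ab_ne_zero ?_
    have h₁ := congrArg outer h
    have h₂ := congrArg inclXB h
    have h₃ : outer (1⊠W) = inclXB (1⊠W) := rfl
    simp only [map_sum, map_mul, map_smul, map_sub] at h₁ h₂
    have h₄ : inclAX ab * ∑ i, ddL (P i) * inclXB (Q i) =
        ∑ i, outer (P i) * inclXB (Q i) - ∑ i, inclXB (P i) * inclXB (Q i) := by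
      rw [Finset.mul_sum, ← Finset.sum_sub_distrib]
      exact Finset.sum_congr rfl fun i _ => by rw [← mul_assoc, ab_mul_ddL, sub_mul]
    have h₅ : inclAX ab * ∑ i, outer (P i) * ddL (Q i) =
        ∑ i, outer (P i) * outer (Q i) - ∑ i, outer (P i) * inclXB (Q i) := by
      rw [Finset.mul_sum, ← Finset.sum_sub_distrib]
      exact Finset.sum_congr rfl fun i _ => by rw [mul_left_comm, ab_mul_ddL, mul_sub]
    rw [mul_sub, h₄, h₅, h₁, h₂, mul_smul_comm, ab_mul_ddL, h₃, smul_sub, smul_sub, smul_sub]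
    abel
  rw [← map_sum, key, map_sub, map_smul, residueT_ddL_self hW, map_sum]
  congr 1
  exact Finset.sum_congr rfl fun i _ => residueT_outer_mul _ _

variable {M N P : Type} [AddCommGroup M] [Module S M] [AddCommGroup N] [Module S N]
  [AddCommGroup P] [Module S P] {d : P →ₗ[S] N} {g : BTensor (BDual N) P →ₗ[S] S}

/-- The variable x lies between φ and n and is integrated, while the unit map identifies the
variable between m and φ with b. -/
theorem contractRight_smul_tmul
    (hg : ∀ φ m, mu (g (tmul φ m)) = -diagExt (residueF W) (φ (d m)))
    (t : T) (m : M) (φ : BDual N) (n : P) :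
    contractRight g (t • tmul (tmul m φ) n) = residueT W (t * inclXB (φ (d n))) • m := by
  induction t using T_induct with
  | ha x y hx hy => rw [add_smul, map_add, hx, hy, add_mul, map_add, add_smul]
  | ht u v r =>
    rw [T_smul_tmul, smul_tmul, contractRight_tmul, hg, map_smul, map_smul, BDual.smul_apply,
      swap_tmul, smul_eq_mul, diagExt_mul, residueT_mul_inclXB, smul_smul, el_mul_el,
      one_mul, mul_one, mul_neg]

/-- Here the middle variable of t lies between m and φ and becomes b, and its last variable is
integrated. Hence `swapMiddle`, which converts `ddO` back into `ddL`. -/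
theorem contractRight_tmul_smul
    (hg : ∀ φ m, mu (g (tmul φ m)) = -diagExt (residueF W) (φ (d m)))
    (t : T) (m : M) (φ : BDual N) (n : P) :
    contractRight g (tmul (t • tmul m φ) n) =
      residueT W (swapMiddle t * inclXB (φ (d n))) • m := by
  induction t using T_induct with
  | ha x y hx hy =>
    rw [add_smul, add_tmul, map_add, hx, hy, map_add, add_mul, map_add, add_smul]
  | ht u r v =>
    rw [T_smul_tmul, swapMiddle_tmul, el_eq_mul u r, mul_comm, mul_smul, tmul_middle,
      contractRight_tmul, hg, BDual.smul_apply, BDual.smul_apply, swap_tmul, swap_tmul, diagExt_mul,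
      residueT_mul_inclXB, smul_smul, el_mul_el, one_mul, mul_one, mul_neg]

theorem contractLeft_aux
    (hg : ∀ φ m, mu (g (tmul φ m)) = -diagExt (residueF W) (φ (d m)))
    (u v q : R) (φ : BDual N) (n : P) (m : M) :
    contractLeft g (tmul φ (tmul ((u⊠q) • n) ((1⊠v) • m))) =
      swap (residueT W ((v⊠u) ⊗ₜ q * inclXB (φ (d n)))) • m := by
  rw [contractLeft_tmul, hg, residueT_mul_inclXB, map_smul, map_smul, smul_eq_mul, el_eq_mul u q,
    mul_comm (u⊠1), mul_assoc, diagExt_mul, smul_smul, el_mul_el, one_mul, mul_one, swap_tmul,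
    mul_neg]

/-- In a left contraction the outer variables of the result are exchanged, hence the `swap`.
Symmetry of `dd` brings the integrated variable into the same position as for right contractions. -/
theorem contractLeft_ddR_smul
    (hg : ∀ φ m, mu (g (tmul φ m)) = -diagExt (residueF W) (φ (d m)))
    (D : S) (φ : BDual N) (n : P) (m : M) :
    contractLeft g (ddR (swap D) • tmul φ (tmul n m)) =
      swap (residueT W (ddL D * inclXB (φ (d n)))) • m := by
  induction D using S_induct with
  | ha x y hx hy =>
    rw [map_add, map_add, add_smul, map_add, hx, hy, map_add, add_mul, map_add, map_add, add_smul]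
  | ht p q =>
    rw [swap_tmul, ddR_el, ddL_el]
    conv_rhs => rw [← swap_dd p]
    induction dd p using S_induct with
    | ha x y hx hy =>
      rw [map_add, mul_add, add_smul, map_add, hx, hy, map_add, TensorProduct.add_tmul, add_mul,
        map_add, map_add, add_smul]
    | ht u v =>
      rw [inclXB_el, inclAX_apply, Algebra.TensorProduct.tmul_mul_tmul, el_mul_el, mul_one, one_mul,
        one_mul, T_smul_tmul, one_smul_tmul, contractLeft_tmul, hg, BDual.smul_apply, swap_tmul,
        swap_tmul, residueT_mul_inclXB, el_eq_mul u q, mul_comm (u⊠1), mul_assoc, diagExt_mul,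
        smul_smul, el_mul_el, one_mul, mul_one, swap_tmul, mul_neg]

/-- Both left contractions, of `ddR` from ρ⁻¹ and of `ddO` from the coevaluation, lead to the same
residue, so the two degrees of the second Zorro composite reduce to the same matrix identities. -/
theorem contractLeft_tmul_ddO_smul
    (hg : ∀ φ m, mu (g (tmul φ m)) = -diagExt (residueF W) (φ (d m)))
    (D : S) (φ : BDual N) (n : P) (m : M) :
    contractLeft g (tmul φ (ddO D • tmul n m)) =
      swap (residueT W (ddL D * inclXB (φ (d n)))) • m := by
  induction D using S_induct with
  | ha x y hx hy =>
    rw [map_add, map_add, add_smul, tmul_add, map_add, hx, hy, add_mul, map_add, map_add, add_smul]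
  | ht p q =>
    rw [ddO_el, ddL_el]
    conv_rhs => rw [← swap_dd p]
    induction dd p using S_induct with
    | ha x y hx hy =>
      rw [TensorProduct.add_tmul, map_add, add_smul, tmul_add, map_add, hx, hy, map_add,
        TensorProduct.add_tmul, add_mul, map_add, map_add, add_smul]
    | ht u v => rw [swapMiddle_tmul, T_smul_tmul, contractLeft_aux hg, swap_tmul]

end Residue

section Tails
variable {A B C D E F : Type}
  [AddCommGroup A] [Module S A] [AddCommGroup B] [Module S B]
  [AddCommGroup C] [Module S C] [AddCommGroup D] [Module S D]
  [AddCommGroup E] [Module S E] [AddCommGroup F] [Module S F]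

/-- The skeleton of the first Zorro composite: of all components of the evaluation, the coevaluation
and λ⁻¹, only one of each survives. In particular B and C play no role. -/
theorem rUnit_assocMat_matMap (g : BTensor C E →ₗ[S] S)
    (g' : BTensor D E × BTensor C F →ₗ[S] S) (c : S →ₗ[S] BTensor A C × BTensor B D)
    (c' : S →ₗ[S] BTensor B C × BTensor A D) (z : BTensor S E × BTensor S F) :
    rUnit A (matMap (BTensor.map LinearMap.id (g ∘ₗ LinearMap.fst S _ (BTensor D F))) 0 0
      (BTensor.map LinearMap.id g') (assocMat A B C D E F
        (matMap (BTensor.map c LinearMap.id) 0 0 (BTensor.map c' LinearMap.id) z))).1 =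
      contractRight g (BTensor.map (LinearMap.fst S _ _ ∘ₗ c) LinearMap.id z.1) := by
  rw [matMap_apply, LinearMap.zero_apply, add_zero, rUnit_assocMat, matMap_apply,
    LinearMap.zero_apply, add_zero, BTensor.map_map, LinearMap.comp_id]

theorem lUnit_assocInvMat_matMap_fst (g : BTensor A C →ₗ[S] S)
    (g' : BTensor B C × BTensor A D →ₗ[S] S) (c : S →ₗ[S] BTensor C E × BTensor D F)
    (c' : S →ₗ[S] BTensor D E × BTensor C F) (z : BTensor A S × BTensor B S) :
    lUnit E (matMap (BTensor.map (g ∘ₗ LinearMap.fst S _ (BTensor B D)) LinearMap.id) 0 0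
      (BTensor.map g' LinearMap.id) (assocInvMat A B C D E F
        (matMap (BTensor.map LinearMap.id c) 0 0 (BTensor.map LinearMap.id c') z))).1 =
      contractLeft g (BTensor.map LinearMap.id (LinearMap.fst S _ _ ∘ₗ c) z.1) := by
  rw [matMap_apply, LinearMap.zero_apply, add_zero, lUnit_assocInvMat_fst, matMap_apply,
    LinearMap.zero_apply, add_zero, BTensor.map_map, LinearMap.comp_id]

theorem lUnit_assocInvMat_matMap_snd (g : BTensor B C →ₗ[S] S)
    (g' : BTensor A C × BTensor B D →ₗ[S] S) (c : S →ₗ[S] BTensor C E × BTensor D F)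
    (c' : S →ₗ[S] BTensor D E × BTensor C F) (z : BTensor A S × BTensor B S) :
    lUnit F (matMap (BTensor.map g' LinearMap.id) 0 0
      (BTensor.map (g ∘ₗ LinearMap.fst S _ (BTensor A D)) LinearMap.id) (assocInvMat A B C D E F
        (matMap (BTensor.map LinearMap.id c) 0 0 (BTensor.map LinearMap.id c') z))).2 =
      contractLeft g (BTensor.map LinearMap.id (LinearMap.snd S _ _ ∘ₗ c') z.2) := by
  rw [matMap_apply, LinearMap.zero_apply, LinearMap.zero_apply, zero_add, lUnit_assocInvMat_snd,
    matMap_apply, LinearMap.zero_apply, LinearMap.zero_apply, zero_add, BTensor.map_map, LinearMap.comp_id]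

end Tails

/-! ### Matrix form of the residue identities. -/

section ResidueMap
variable {W : R} {M N : Type} [AddCommGroup M] [Module S M] [AddCommGroup N] [Module S N]
  {ι κ : Type} (b : Module.Basis ι S M) (c : Module.Basis κ S N)

theorem repr_map_eq_sum [Fintype ι] (f : M →ₗ[S] N) (m : M) (i : κ) :
    c.repr (f m) i = ∑ j, b.repr m j * c.repr (f (b j)) i := by
  conv_lhs => rw [← b.sum_repr m]
  simp only [map_sum, map_smul, Finsupp.coe_finsetSum, Finset.sum_apply, Finsupp.smul_apply,
    smul_eq_mul]

/-- The map whose matrix is obtained from that of `f` by taking residues of divided differences. -/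
def residueMap [Fintype κ] (W : R) (f : M →ₗ[S] N) : M →ₗ[S] N :=
  b.constr S fun j => ∑ i, residueT W (ddL (c.repr (f (b j)) i)) • c i

theorem repr_residueMap [Fintype κ] (f : M →ₗ[S] N) (i : κ) (j : ι) :
    c.repr (residueMap b c W f (b j)) i = residueT W (ddL (c.repr (f (b j)) i)) := by
  rw [residueMap, Module.Basis.constr_basis]
  exact c.repr_sum_self (fun i => residueT W (ddL (c.repr (f (b j)) i))) ▸ rfl

variable [Fintype κ] {f : M →ₗ[S] N} {g : N →ₗ[S] M}

/-- This is the Leibniz rule applied to the product g f. The Kronecker delta is the constant c,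
because g f is W(a) - W(b) times the identity. -/
theorem sum_residueT_left (hW : 0 < W.natDegree)
    (h : ∀ m, g (f m) = (W⊠1) • m - (1⊠W) • m) (k j : ι) :
    ∑ l, residueT W (ddL (b.repr (g (c l)) k) * inclXB (c.repr (f (b j)) l)) =
      b.repr (b j - g (residueMap b c W f (b j))) k := by
  classical
  rw [sum_residueT_ddL_mul hW _ _ (if j = k then 1 else 0), map_sub, Finsupp.sub_apply,
    Module.Basis.repr_self, Finsupp.single_apply, repr_map_eq_sum c b g]
  · congr 1
    · split_ifs <;> simp
    · exact Finset.sum_congr rfl fun l _ => by rw [repr_residueMap, mul_comm]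
  · rw [Finset.sum_congr rfl fun l _ => mul_comm _ _, ← repr_map_eq_sum c b g, h, map_sub, map_smul,
      map_smul, Finsupp.sub_apply, Finsupp.smul_apply, Finsupp.smul_apply, Module.Basis.repr_self,
      Finsupp.single_apply]
    split_ifs <;> simp

/-- The divided difference again falls on g, but now the sum runs over the basis of M and forms f g.
The correction therefore appears on the other side of g. -/
theorem sum_residueT_right [Fintype ι] (hW : 0 < W.natDegree)
    (h : ∀ n, f (g n) = (W⊠1) • n - (1⊠W) • n) (l j : κ) :
    ∑ k, residueT W (ddL (b.repr (g (c l)) k) * inclXB (c.repr (f (b k)) j)) =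
      c.repr (c l - residueMap b c W f (g (c l))) j := by
  classical
  rw [sum_residueT_ddL_mul hW _ _ (if l = j then 1 else 0), map_sub, Finsupp.sub_apply,
    Module.Basis.repr_self, Finsupp.single_apply, repr_map_eq_sum b c (residueMap b c W f)]
  · congr 1
    · split_ifs <;> simp
    · exact Finset.sum_congr rfl fun l _ => by rw [repr_residueMap]
  · rw [← repr_map_eq_sum b c f, h, map_sub, map_smul,
      map_smul, Finsupp.sub_apply, Finsupp.smul_apply, Finsupp.smul_apply, Module.Basis.repr_self,
      Finsupp.single_apply]
    split_ifs <;> simp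

end ResidueMap

/-! ### The Zorro identities for finite rank. -/

section Zorro
variable {W : R} {Z : MBF W} (F : Frame Z) (hW : 0 < W.natDegree)

/-- The defect of the Zorro identities before passing to homotopy classes. -/
def Frame.defect : Z.X₀ →ₗ[S] Z.X₁ := residueMap F.b₀ F.b₁ W Z.d₀

theorem Frame.defect_eq_zero (h : F.LowDegree) : F.defect = 0 := by
  refine F.b₀.ext fun j => F.b₁.ext_elem fun i => ?_
  rw [Frame.defect, repr_residueMap, LinearMap.zero_apply, map_zero, Finsupp.zero_apply]
  exact residueT_ddL_of_mem (h.1 i j)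

/-- The coevaluation in degree `0`. -/
def Frame.coev₀ : S →ₗ[S] BTensor Z.X₀ (BDual Z.X₁) × BTensor Z.X₁ (BDual Z.X₀) := F.coev.f₀

/-- The coevaluation in degree `1`. -/
def Frame.coev₁ : S →ₗ[S] BTensor Z.X₁ (BDual Z.X₁) × BTensor Z.X₀ (BDual Z.X₀) := F.coev.f₁

/-- The first Zorro composite. -/
def Frame.zorroOne : EvenMap Z Z :=
  (rhoMap Z).toEvenMap.comp (((EvenMap.id Z).tensor (F.ev hW).toEvenMap).comp
    ((assocMap Z Z.dual Z).toEvenMap.comp ((F.coevMap.toEvenMap.tensor (EvenMap.id Z)).comp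
      F.lamInv)))

/-- The second Zorro composite. -/
def Frame.zorroTwo : EvenMap Z.dual Z.dual :=
  (lamMap Z.dual).toEvenMap.comp (((F.ev hW).toEvenMap.tensor (EvenMap.id Z.dual)).comp
    ((assocInvMap Z.dual Z Z.dual).toEvenMap.comp
      (((EvenMap.id Z.dual).tensor F.coevMap.toEvenMap).comp F.dual.rhoInv)))

/-- In degree 0 the coevaluation supplies the divided difference of D₁, and A supplies D₀(x, b). The
residue of their product is evaluated by `sum_residueT_left`. -/
theorem Frame.zorroOne_f₀ : (F.zorroOne hW).f₀ = LinearMap.id - Z.d₁ ∘ₗ F.defect := by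
  refine F.b₀.ext fun j => ?_
  have h₁ := rUnit_assocMat_matMap F.evA (F.ev₁ hW) F.coev₀ F.coev₁
    ((tmul 1 (F.b₀ j), ∑ i, ddL (F.D₀ i j) • tmul 1 (F.b₁ i)) : BTensor S Z.X₀ × BTensor S Z.X₁)
  have h₂ : contractRight F.evA (BTensor.map (LinearMap.fst S _ _ ∘ₗ F.coev₀) LinearMap.id
      (tmul (1 : S) (F.b₀ j))) = F.b₀ j - Z.d₁ (F.defect (F.b₀ j)) := by
    have h₃ : (LinearMap.fst S _ _ ∘ₗ F.coev₀) (1 : S) = ddElement F.b₁ F.b₀ Z.d₁ :=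
      congrArg Prod.fst (one_smul S F.coevElt₀)
    rw [BTensor.map_tmul, h₃, ddElement, sum_tmul, map_sum, LinearMap.id_apply]
    simp only [sum_tmul, map_sum, contractRight_tmul_smul F.mu_evA, ddO, LinearMap.comp_apply,
      swapMiddle_swapMiddle, dualBasis_apply]
    rw [Finset.sum_comm, ← F.b₀.sum_repr (F.b₀ j - Z.d₁ (F.defect (F.b₀ j)))]
    refine Finset.sum_congr rfl fun k _ => ?_
    rw [← Finset.sum_smul, sum_residueT_left F.b₀ F.b₁ hW Z.d₁_d₀, Frame.defect]
  -- The composite unfolds definitionally to the displayed map applied to λ⁻¹ of a basis vector.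
  exact (congrArg (fun z => (rUnit Z.X₀ (matMap (BTensor.map LinearMap.id F.ev₀) 0 0
    (BTensor.map LinearMap.id (F.ev₁ hW)) (assocMat Z.X₀ Z.X₁ (BDual Z.X₁) (BDual Z.X₀) Z.X₀ Z.X₁
    (matMap (BTensor.map F.coev₀ LinearMap.id) 0 0 (BTensor.map F.coev₁ LinearMap.id) z))).1))
    (F.lamInv_f₀_basis j)).trans (h₁.trans h₂)

/-- In degree 1 the coevaluation is the canonical element, and the divided difference of D₁ comes
from the correction term of λ⁻¹ instead. -/
theorem Frame.zorroOne_f₁ : (F.zorroOne hW).f₁ = LinearMap.id - F.defect ∘ₗ Z.d₁ := by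
  refine F.b₁.ext fun j => ?_
  have h₁ := rUnit_assocMat_matMap F.evA (F.ev₁ hW) F.coev₁ F.coev₀
    ((∑ i, ddL (F.D₁ i j) • tmul 1 (F.b₀ i), tmul 1 (F.b₁ j)) : BTensor S Z.X₀ × BTensor S Z.X₁)
  have h₂ : contractRight F.evA (BTensor.map (LinearMap.fst S _ _ ∘ₗ F.coev₁) LinearMap.id
      (∑ i, ddL (F.D₁ i j) • tmul (1 : S) (F.b₀ i))) = F.b₁ j - F.defect (Z.d₁ (F.b₁ j)) := by
    have h₃ : (LinearMap.fst S _ _ ∘ₗ F.coev₁) (1 : S) =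
        ∑ l, tmul (F.b₁ l) (dualBasis F.b₁ l) := congrArg Prod.fst (one_smul S F.coevElt₁)
    simp only [map_sum, BTensor.map_smul_T, BTensor.map_tmul, h₃, LinearMap.id_apply, sum_tmul,
      Finset.smul_sum, contractRight_smul_tmul F.mu_evA, dualBasis_apply]
    rw [Finset.sum_comm, ← F.b₁.sum_repr (F.b₁ j - F.defect (Z.d₁ (F.b₁ j)))]
    refine Finset.sum_congr rfl fun k _ => ?_
    rw [← Finset.sum_smul, Frame.defect, ← sum_residueT_right F.b₀ F.b₁ hW Z.d₀_d₁]
    rfl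
  exact (congrArg (fun z => (rUnit Z.X₁ (matMap (BTensor.map LinearMap.id F.ev₀) 0 0
    (BTensor.map LinearMap.id (F.ev₁ hW)) (assocMat Z.X₁ Z.X₀ (BDual Z.X₁) (BDual Z.X₀) Z.X₀ Z.X₁
    (matMap (BTensor.map F.coev₁ LinearMap.id) 0 0 (BTensor.map F.coev₀ LinearMap.id) z))).1))
    (F.lamInv_f₁_basis j)).trans (h₁.trans h₂)

/-- The residues are those of `Frame.zorroOne_f₁` with a and b exchanged, so they are the
coordinates of the dual map. -/
theorem Frame.zorroTwo_f₀ :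
    (F.zorroTwo hW).f₀ = BDual.map (LinearMap.id - F.defect ∘ₗ Z.d₁) := by
  refine (dualBasis F.b₁).ext fun j => ?_
  have h₁ := lUnit_assocInvMat_matMap_fst F.evA (F.ev₁ hW) F.coev₀ F.coev₁
    ((tmul (dualBasis F.b₁ j) 1, ∑ i, ddR (F.dual.D₀ i j) • tmul (dualBasis F.b₀ i) 1) :
      BTensor (BDual Z.X₁) S × BTensor (BDual Z.X₀) S)
  have h₂ : contractLeft F.evA (BTensor.map LinearMap.id (LinearMap.fst S _ _ ∘ₗ F.coev₀)
      (tmul (dualBasis F.b₁ j) (1 : S))) =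
      BDual.map (LinearMap.id - F.defect ∘ₗ Z.d₁) (dualBasis F.b₁ j) := by
    have h₃ : (LinearMap.fst S _ _ ∘ₗ F.coev₀) (1 : S) = ddElement F.b₁ F.b₀ Z.d₁ :=
      congrArg Prod.fst (one_smul S F.coevElt₀)
    rw [BTensor.map_tmul, h₃, ddElement, tmul_sum, map_sum, LinearMap.id_apply]
    simp only [tmul_sum, map_sum, contractLeft_tmul_ddO_smul F.mu_evA, dualBasis_apply]
    rw [BDual.map_dualBasis F.b₁ F.b₁]
    refine Finset.sum_congr rfl fun l _ => ?_
    rw [← Finset.sum_smul, ← map_sum, sum_residueT_right F.b₀ F.b₁ hW Z.d₀_d₁]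
    rfl
  exact (congrArg (fun z => (lUnit (BDual Z.X₁) (matMap (BTensor.map F.ev₀ LinearMap.id) 0 0
    (BTensor.map (F.ev₁ hW) LinearMap.id)
    (assocInvMat (BDual Z.X₁) (BDual Z.X₀) Z.X₀ Z.X₁ (BDual Z.X₁) (BDual Z.X₀)
    (matMap (BTensor.map LinearMap.id F.coev₀) 0 0 (BTensor.map LinearMap.id F.coev₁) z))).1))
    (F.dual.rhoInv_f₀_basis j)).trans (h₁.trans h₂)

/-- The sign of -d₁^∨ cancels the one in the odd component of ρ⁻¹ for the dual. -/
theorem Frame.dual_D₁ (i : F.ι₁) (j : F.ι₀) : F.dual.D₁ i j = -swap (F.D₁ j i) := by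
  have h : swap (-(dualBasis F.b₀ j (Z.d₁ (F.b₁ i)))) = -swap (F.D₁ j i) := by
    rw [map_neg, dualBasis_apply]; rfl
  exact h

theorem Frame.zorroTwo_f₁ :
    (F.zorroTwo hW).f₁ = BDual.map (LinearMap.id - Z.d₁ ∘ₗ F.defect) := by
  refine (dualBasis F.b₀).ext fun j => ?_
  have h₁ := lUnit_assocInvMat_matMap_snd F.evA (F.ev₁ hW) F.coev₀ F.coev₁
    ((tmul (dualBasis F.b₀ j) 1, -∑ i, ddR (F.dual.D₁ i j) • tmul (dualBasis F.b₁ i) 1) :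
      BTensor (BDual Z.X₀) S × BTensor (BDual Z.X₁) S)
  have h₂ : contractLeft F.evA (BTensor.map LinearMap.id (LinearMap.snd S _ _ ∘ₗ F.coev₁)
      (-∑ i : F.ι₁, ddR (F.dual.D₁ i j) • tmul (dualBasis F.b₁ i) (1 : S))) =
      BDual.map (LinearMap.id - Z.d₁ ∘ₗ F.defect) (dualBasis F.b₀ j) := by
    have h₃ : (LinearMap.snd S _ _ ∘ₗ F.coev₁) (1 : S) =
        ∑ l, tmul (F.b₀ l) (dualBasis F.b₀ l) := congrArg Prod.snd (one_smul S F.coevElt₁)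
    simp only [F.dual_D₁, map_neg, neg_smul, Finset.sum_neg_distrib, neg_neg]
    simp only [map_sum, BTensor.map_smul_T, BTensor.map_tmul, h₃, LinearMap.id_apply, tmul_sum,
      Finset.smul_sum, contractLeft_ddR_smul F.mu_evA, dualBasis_apply]
    rw [Finset.sum_comm, BDual.map_dualBasis F.b₀ F.b₀]
    refine Finset.sum_congr rfl fun l _ => ?_
    rw [← Finset.sum_smul, ← map_sum, LinearMap.sub_apply, LinearMap.comp_apply, Frame.defect,
      LinearMap.id_apply, ← sum_residueT_left F.b₀ F.b₁ hW Z.d₁_d₀]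
    rfl
  exact (congrArg (fun z => (lUnit (BDual Z.X₀) (matMap (BTensor.map (F.ev₁ hW) LinearMap.id) 0 0
    (BTensor.map F.ev₀ LinearMap.id)
    (assocInvMat (BDual Z.X₀) (BDual Z.X₁) Z.X₀ Z.X₁ (BDual Z.X₁) (BDual Z.X₀)
    (matMap (BTensor.map LinearMap.id F.coev₀) 0 0 (BTensor.map LinearMap.id F.coev₁) z))).2))
    (F.dual.rhoInv_f₁_basis j)).trans (h₁.trans h₂)

theorem Frame.zorroOneDG (h : F.LowDegree) : F.ZorroOneDG (F.ev hW) F.coevMap :=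
  EvenMap.ext ((F.zorroOne_f₀ hW).trans (by
      rw [F.defect_eq_zero h, LinearMap.comp_zero, sub_zero]; rfl))
    ((F.zorroOne_f₁ hW).trans (by
      rw [F.defect_eq_zero h, LinearMap.zero_comp, sub_zero]; rfl))

theorem Frame.zorroTwoDG (h : F.LowDegree) : F.ZorroTwoDG (F.ev hW) F.coevMap :=
  EvenMap.ext ((F.zorroTwo_f₀ hW).trans (by
      rw [F.defect_eq_zero h, LinearMap.zero_comp, sub_zero]; rfl))
    ((F.zorroTwo_f₁ hW).trans (by
      rw [F.defect_eq_zero h, LinearMap.comp_zero, sub_zero]; rfl))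

/-- The deviations -d₁h and -hd₁ form the boundary of the odd map with components -h and 0, whatever
the degrees of the entries. -/
theorem Frame.zorroOne_homotopic (f : ClosedMap Z Z) (hf : f.toEvenMap = F.zorroOne hW) :
    Homotopic f (ClosedMap.id Z) := by
  have h₀ : f.f₀ = _ := (congrArg EvenMap.f₀ hf).trans (F.zorroOne_f₀ hW)
  have h₁ : f.f₁ = _ := (congrArg EvenMap.f₁ hf).trans (F.zorroOne_f₁ hW)
  refine ⟨-F.defect, 0, fun m => ?_, fun m => ?_⟩
  · have key : (LinearMap.id - Z.d₁ ∘ₗ F.defect : Z.X₀ →ₗ[S] Z.X₀) m - m = Z.d₁ (-F.defect m) + 0 := by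
      rw [LinearMap.sub_apply, LinearMap.comp_apply, LinearMap.id_apply, map_neg]; abel
    rw [h₀]; exact key
  · have key : (LinearMap.id - F.defect ∘ₗ Z.d₁ : Z.X₁ →ₗ[S] Z.X₁) m - m = Z.d₀ 0 + -F.defect (Z.d₁ m) := by
      rw [LinearMap.sub_apply, LinearMap.comp_apply, LinearMap.id_apply, map_zero]; abel
    rw [h₁]; exact key

theorem Frame.zorroTwo_homotopic (f : ClosedMap Z.dual Z.dual)
    (hf : f.toEvenMap = F.zorroTwo hW) : Homotopic f (ClosedMap.id Z.dual) := by
  have h₀ : f.f₀ = _ := (congrArg EvenMap.f₀ hf).trans (F.zorroTwo_f₀ hW)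
  have h₁ : f.f₁ = _ := (congrArg EvenMap.f₁ hf).trans (F.zorroTwo_f₁ hW)
  -- The sign is opposite to that in `Frame.zorroOne_homotopic` because the differential of the dual
  -- contains -d₁^∨.
  refine ⟨(BDual.map F.defect : BDual Z.X₁ →ₗ[S] BDual Z.X₀), (0 : BDual Z.X₀ →ₗ[S] BDual Z.X₁),
    fun (φ : BDual Z.X₁) => ?_, fun (φ : BDual Z.X₀) => ?_⟩
  · have key : BDual.map (LinearMap.id - F.defect ∘ₗ Z.d₁) φ - φ =
        -BDual.map Z.d₁ (BDual.map F.defect φ) + 0 := BDual.ext fun m => by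
      change φ (m - F.defect (Z.d₁ m)) - φ m = -φ (F.defect (Z.d₁ m)) + 0
      rw [map_sub]; abel
    rw [h₀]; exact key
  · have key : BDual.map (LinearMap.id - Z.d₁ ∘ₗ F.defect) φ - φ =
        BDual.map Z.d₀ 0 + BDual.map F.defect (-BDual.map Z.d₁ φ) := BDual.ext fun m => by
      change φ (m - Z.d₁ (F.defect m)) - φ m = 0 + -φ (Z.d₁ (F.defect m))
      rw [map_sub]; abel
    rw [h₁]; exact key

end Zorro

/-! ### Functoriality and naturality in the homotopy category. -/

section Functoriality
variable {W : R} {X Y Z X' Y' Z' X'' Y'' : MBF W}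

theorem ho_surjective (f : X ⟶ Y) : ∃ f' : ClosedMap X Y, ho f' = f := Quotient.exists_rep f

theorem ho_congr {f g : ClosedMap X Y} (h₀ : f.f₀ = g.f₀) (h₁ : f.f₁ = g.f₁) : ho f = ho g :=
  congrArg ho (ClosedMap.ext (EvenMap.ext h₀ h₁))

theorem tensorF₀_comp (f : EvenMap X X') (f' : EvenMap X' X'') (g : EvenMap Y Y')
    (g' : EvenMap Y' Y'') :
    tensorF₀ (f'.comp f) (g'.comp g) = tensorF₀ f' g' ∘ₗ tensorF₀ f g :=
  pair_ext (fun a b => by simp [tensorF₀, matMap_apply, EvenMap.comp])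
    (fun a b => by simp [tensorF₀, matMap_apply, EvenMap.comp])

theorem tensorF₁_comp (f : EvenMap X X') (f' : EvenMap X' X'') (g : EvenMap Y Y')
    (g' : EvenMap Y' Y'') :
    tensorF₁ (f'.comp f) (g'.comp g) = tensorF₁ f' g' ∘ₗ tensorF₁ f g :=
  pair_ext (fun a b => by simp [tensorF₁, matMap_apply, EvenMap.comp])
    (fun a b => by simp [tensorF₁, matMap_apply, EvenMap.comp])

theorem tensorF₀_id : tensorF₀ (EvenMap.id X) (EvenMap.id Y) = LinearMap.id :=
  pair_ext (fun a b => by simp [tensorF₀, matMap_apply, EvenMap.id])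
    (fun a b => by simp [tensorF₀, matMap_apply, EvenMap.id])

theorem tensorF₁_id : tensorF₁ (EvenMap.id X) (EvenMap.id Y) = LinearMap.id :=
  pair_ext (fun a b => by simp [tensorF₁, matMap_apply, EvenMap.id])
    (fun a b => by simp [tensorF₁, matMap_apply, EvenMap.id])

theorem tensorHom_comp (f : X ⟶ X') (f' : X' ⟶ X'') (g : Y ⟶ Y') (g' : Y' ⟶ Y'') :
    tensorHom f g ≫ tensorHom f' g' = tensorHom (f ≫ f') (g ≫ g') := by
  obtain ⟨f, rfl⟩ := ho_surjective f
  obtain ⟨f', rfl⟩ := ho_surjective f'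
  obtain ⟨g, rfl⟩ := ho_surjective g
  obtain ⟨g', rfl⟩ := ho_surjective g'
  exact (ho_congr (f := (f'.comp f).tensor (g'.comp g)) (g := (f'.tensor g').comp (f.tensor g))
    (tensorF₀_comp _ _ _ _) (tensorF₁_comp _ _ _ _)).symm

theorem tensorHom_comp_assoc (f : X ⟶ X') (f' : X' ⟶ X'') (g : Y ⟶ Y') (g' : Y' ⟶ Y'')
    (h : X''.tensor Y'' ⟶ Z) :
    tensorHom f g ≫ tensorHom f' g' ≫ h = tensorHom (f ≫ f') (g ≫ g') ≫ h := by
  rw [← Category.assoc, tensorHom_comp]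

theorem tensorHom_id (X Y : MBF W) : tensorHom (𝟙 X) (𝟙 Y) = 𝟙 (X.tensor Y) :=
  ho_congr (f := (ClosedMap.id X).tensor (ClosedMap.id Y)) (g := ClosedMap.id (X.tensor Y))
    tensorF₀_id tensorF₁_id

theorem dualHom_comp (f : X ⟶ Y) (g : Y ⟶ Z) : dualHom g ≫ dualHom f = dualHom (f ≫ g) := by
  obtain ⟨f, rfl⟩ := ho_surjective f
  obtain ⟨g, rfl⟩ := ho_surjective g
  rfl

theorem dualHom_id (X : MBF W) : dualHom (𝟙 X) = 𝟙 X.dual := rfl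

/-- The dual of an isomorphism. -/
def dualIso (θ : X ≅ Y) : X.dual ≅ Y.dual where
  hom := dualHom θ.inv
  inv := dualHom θ.hom
  hom_inv_id := by rw [dualHom_comp, θ.hom_inv_id, dualHom_id]
  inv_hom_id := by rw [dualHom_comp, θ.inv_hom_id, dualHom_id]

/-- The tensor product of isomorphisms. -/
def tensorIso (θ : X ≅ X') (η : Y ≅ Y') : X.tensor Y ≅ X'.tensor Y' where
  hom := tensorHom θ.hom η.hom
  inv := tensorHom θ.inv η.inv
  hom_inv_id := by rw [tensorHom_comp, θ.hom_inv_id, η.hom_inv_id, tensorHom_id]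
  inv_hom_id := by rw [tensorHom_comp, θ.inv_hom_id, η.inv_hom_id, tensorHom_id]

/-- The square commutes strictly on representatives, so no homotopy has to be constructed; the same
holds for ρ and α. -/
theorem lamMap_naturality (f : X ⟶ Y) :
    tensorHom (𝟙 (MBF.unit W)) f ≫ ho (lamMap Y) = ho (lamMap X) ≫ f := by
  obtain ⟨f, rfl⟩ := ho_surjective f
  refine ho_congr (f := (lamMap Y).comp ((ClosedMap.id (MBF.unit W)).tensor f))
    (g := f.comp (lamMap X)) ?_ ?_
  · exact pair_ext (f := (lUnit Y.X₀ ∘ₗ LinearMap.fst S (BTensor S Y.X₀) (BTensor S Y.X₁)) ∘ₗ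
        matMap (BTensor.map LinearMap.id f.f₀) 0 0 (BTensor.map LinearMap.id f.f₁))
      (g := f.f₀ ∘ₗ lUnit X.X₀ ∘ₗ LinearMap.fst S (BTensor S X.X₀) (BTensor S X.X₁))
      (fun a b => by simp [matMap_apply, lUnit_tmul]) (fun a b => by simp [matMap_apply])
  · exact pair_ext (f := (lUnit Y.X₁ ∘ₗ LinearMap.snd S (BTensor S Y.X₀) (BTensor S Y.X₁)) ∘ₗ
        matMap (BTensor.map LinearMap.id f.f₀) 0 0 (BTensor.map LinearMap.id f.f₁))
      (g := f.f₁ ∘ₗ lUnit X.X₁ ∘ₗ LinearMap.snd S (BTensor S X.X₀) (BTensor S X.X₁))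
      (fun a b => by simp [matMap_apply]) (fun a b => by simp [matMap_apply, lUnit_tmul])

theorem rhoMap_naturality (f : X ⟶ Y) :
    tensorHom f (𝟙 (MBF.unit W)) ≫ ho (rhoMap Y) = ho (rhoMap X) ≫ f := by
  obtain ⟨f, rfl⟩ := ho_surjective f
  refine ho_congr (f := (rhoMap Y).comp (f.tensor (ClosedMap.id (MBF.unit W))))
    (g := f.comp (rhoMap X)) ?_ ?_
  · exact pair_ext (f := (rUnit Y.X₀ ∘ₗ LinearMap.fst S (BTensor Y.X₀ S) (BTensor Y.X₁ S)) ∘ₗ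
        matMap (BTensor.map f.f₀ LinearMap.id) 0 0 (BTensor.map f.f₁ LinearMap.id))
      (g := f.f₀ ∘ₗ rUnit X.X₀ ∘ₗ LinearMap.fst S (BTensor X.X₀ S) (BTensor X.X₁ S))
      (fun a b => by simp [matMap_apply, rUnit_tmul]) (fun a b => by simp [matMap_apply])
  · exact pair_ext (f := (rUnit Y.X₁ ∘ₗ LinearMap.fst S (BTensor Y.X₁ S) (BTensor Y.X₀ S)) ∘ₗ
        matMap (BTensor.map f.f₁ LinearMap.id) 0 0 (BTensor.map f.f₀ LinearMap.id))
      (g := f.f₁ ∘ₗ rUnit X.X₁ ∘ₗ LinearMap.fst S (BTensor X.X₁ S) (BTensor X.X₀ S))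
      (fun a b => by simp [matMap_apply, rUnit_tmul]) (fun a b => by simp [matMap_apply])

end Functoriality

section Associator
variable {A B C D E F A' B' C' D' E' F' : Type}
  [AddCommGroup A] [Module S A] [AddCommGroup B] [Module S B]
  [AddCommGroup C] [Module S C] [AddCommGroup D] [Module S D]
  [AddCommGroup E] [Module S E] [AddCommGroup F] [Module S F]
  [AddCommGroup A'] [Module S A'] [AddCommGroup B'] [Module S B']
  [AddCommGroup C'] [Module S C'] [AddCommGroup D'] [Module S D']
  [AddCommGroup E'] [Module S E'] [AddCommGroup F'] [Module S F']

theorem assocInvMat_comp_assocMat :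
    assocInvMat A B C D E F ∘ₗ assocMat A B C D E F = LinearMap.id :=
  LinearMap.ext <| left_pair_apply_ext _ _
    (fun a b e => by simp [assocMat, assocInvMat, matMap_apply, zero_tmul, tmul_zero])
    (fun a b e => by simp [assocMat, assocInvMat, matMap_apply, zero_tmul, tmul_zero])
    (fun a b e => by simp [assocMat, assocInvMat, matMap_apply, zero_tmul, tmul_zero])
    (fun a b e => by simp [assocMat, assocInvMat, matMap_apply, zero_tmul, tmul_zero])

theorem assocMat_comp_assocInvMat :
    assocMat A B C D E F ∘ₗ assocInvMat A B C D E F = LinearMap.id :=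
  LinearMap.ext <| right_pair_apply_ext _ _
    (fun a b e => by simp [assocMat, assocInvMat, matMap_apply, zero_tmul, tmul_zero])
    (fun a b e => by simp [assocMat, assocInvMat, matMap_apply, zero_tmul, tmul_zero])
    (fun a b e => by simp [assocMat, assocInvMat, matMap_apply, zero_tmul, tmul_zero])
    (fun a b e => by simp [assocMat, assocInvMat, matMap_apply, zero_tmul, tmul_zero])

theorem assocMat_naturality (fA : A →ₗ[S] A') (fB : B →ₗ[S] B') (fC : C →ₗ[S] C')
    (fD : D →ₗ[S] D') (fE : E →ₗ[S] E') (fF : F →ₗ[S] F') :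
    assocMat A' B' C' D' E' F' ∘ₗ
        matMap (BTensor.map (matMap (BTensor.map fA fC) 0 0 (BTensor.map fB fD)) fE) 0 0
          (BTensor.map (matMap (BTensor.map fB fC) 0 0 (BTensor.map fA fD)) fF) =
      matMap (BTensor.map fA (matMap (BTensor.map fC fE) 0 0 (BTensor.map fD fF))) 0 0
          (BTensor.map fB (matMap (BTensor.map fD fE) 0 0 (BTensor.map fC fF))) ∘ₗ
        assocMat A B C D E F :=
  LinearMap.ext <| left_pair_apply_ext _ _
    (fun a b e => by simp [assocMat, matMap_apply, zero_tmul])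
    (fun a b e => by simp [assocMat, matMap_apply, zero_tmul])
    (fun a b e => by simp [assocMat, matMap_apply, zero_tmul])
    (fun a b e => by simp [assocMat, matMap_apply, zero_tmul])

end Associator

section AssociatorHo
variable {W : R} {X Y Z X' Y' Z' : MBF W}

theorem assocMap_assocInvMap (X Y Z : MBF W) :
    ho (assocMap X Y Z) ≫ ho (assocInvMap X Y Z) = 𝟙 ((X.tensor Y).tensor Z) :=
  ho_congr (f := (assocInvMap X Y Z).comp (assocMap X Y Z))
    (g := ClosedMap.id ((X.tensor Y).tensor Z))
    (assocInvMat_comp_assocMat (A := X.X₀) (B := X.X₁) (C := Y.X₀) (D := Y.X₁) (E := Z.X₀)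
      (F := Z.X₁))
    (assocInvMat_comp_assocMat (A := X.X₁) (B := X.X₀) (C := Y.X₀) (D := Y.X₁) (E := Z.X₀)
      (F := Z.X₁))

theorem assocInvMap_assocMap (X Y Z : MBF W) :
    ho (assocInvMap X Y Z) ≫ ho (assocMap X Y Z) = 𝟙 (X.tensor (Y.tensor Z)) :=
  ho_congr (f := (assocMap X Y Z).comp (assocInvMap X Y Z))
    (g := ClosedMap.id (X.tensor (Y.tensor Z)))
    (assocMat_comp_assocInvMat (A := X.X₀) (B := X.X₁) (C := Y.X₀) (D := Y.X₁) (E := Z.X₀)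
      (F := Z.X₁))
    (assocMat_comp_assocInvMat (A := X.X₁) (B := X.X₀) (C := Y.X₀) (D := Y.X₁) (E := Z.X₀)
      (F := Z.X₁))

/-- The associator as an isomorphism of the homotopy category. -/
def assocIso (X Y Z : MBF W) : (X.tensor Y).tensor Z ≅ X.tensor (Y.tensor Z) where
  hom := ho (assocMap X Y Z)
  inv := ho (assocInvMap X Y Z)
  hom_inv_id := assocMap_assocInvMap X Y Z
  inv_hom_id := assocInvMap_assocMap X Y Z

theorem assocMap_naturality (f : X ⟶ X') (g : Y ⟶ Y') (h : Z ⟶ Z') :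
    tensorHom (tensorHom f g) h ≫ ho (assocMap X' Y' Z') =
      ho (assocMap X Y Z) ≫ tensorHom f (tensorHom g h) := by
  obtain ⟨f, rfl⟩ := ho_surjective f
  obtain ⟨g, rfl⟩ := ho_surjective g
  obtain ⟨h, rfl⟩ := ho_surjective h
  exact ho_congr (f := (assocMap X' Y' Z').comp ((f.tensor g).tensor h))
    (g := (f.tensor (g.tensor h)).comp (assocMap X Y Z))
    (assocMat_naturality f.f₀ f.f₁ g.f₀ g.f₁ h.f₀ h.f₁)
    (assocMat_naturality f.f₁ f.f₀ g.f₀ g.f₁ h.f₀ h.f₁)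

/-- Invert the associators on both sides of the naturality square of α. -/
theorem assocInvMap_naturality (f : X ⟶ X') (g : Y ⟶ Y') (h : Z ⟶ Z') :
    tensorHom f (tensorHom g h) ≫ ho (assocInvMap X' Y' Z') =
      ho (assocInvMap X Y Z) ≫ tensorHom (tensorHom f g) h := by
  refine ((assocIso X' Y' Z').comp_inv_eq).2 ?_
  rw [Category.assoc]
  refine ((assocIso X Y Z).eq_inv_comp).2 ?_
  exact (assocMap_naturality f g h).symm

end AssociatorHo

/-! ### Transport of the Zorro identities along isomorphisms. -/

section Transport
variable {W : R} {X Z : MBF W}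

/-- By naturality λ_X = θ⁻¹ ∘ λ_Z ∘ (1 ⊗ θ), a composite of isomorphisms. -/
theorem isIso_lamMap_of_iso (θ : X ≅ Z) [IsIso (ho (lamMap Z))] : IsIso (ho (lamMap X)) := by
  have h : ho (lamMap X) = (tensorIso (Iso.refl _) θ ≪≫ asIso (ho (lamMap Z)) ≪≫ θ.symm).hom := by
    have h₁ := lamMap_naturality θ.hom
    change _ = tensorHom (𝟙 _) θ.hom ≫ ho (lamMap Z) ≫ θ.inv
    rw [← Category.assoc, h₁, Category.assoc, θ.hom_inv_id, Category.comp_id]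
  rw [h]
  infer_instance

theorem isIso_rhoMap_of_iso (θ : X ≅ Z) [IsIso (ho (rhoMap Z))] : IsIso (ho (rhoMap X)) := by
  have h : ho (rhoMap X) = (tensorIso θ (Iso.refl _) ≪≫ asIso (ho (rhoMap Z)) ≪≫ θ.symm).hom := by
    have h₁ := rhoMap_naturality θ.hom
    change _ = tensorHom θ.hom (𝟙 _) ≫ ho (rhoMap Z) ≫ θ.inv
    rw [← Category.assoc, h₁, Category.assoc, θ.hom_inv_id, Category.comp_id]
  rw [h]
  infer_instance

/-- Naturality moves θ and its inverse to the ends of the composite for Z; between coevaluation and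
evaluation they cancel, including on the dual factor. -/
theorem ZorroOne.of_iso (θ : X ≅ Z) {ev : Z.dual.tensor Z ⟶ MBF.unit W}
    {coev : MBF.unit W ⟶ Z.tensor Z.dual} (h : ZorroOne Z ev coev) :
    ZorroOne X (tensorHom (dualHom θ.inv) θ.hom ≫ ev)
      (coev ≫ tensorHom θ.inv (dualHom θ.hom)) := by
  obtain ⟨_, h⟩ := h
  have hX : IsIso (ho (lamMap X)) := isIso_lamMap_of_iso θ
  refine ⟨hX, ?_⟩
  rw [IsIso.inv_comp_eq, Category.comp_id] at h ⊢
  -- The untouched factor X is written as θ followed by its inverse, so that all three factors can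
  -- be carried through α together.
  have e₁ : tensorHom (coev ≫ tensorHom θ.inv (dualHom θ.hom)) (𝟙 X) =
      tensorHom (𝟙 _) θ.hom ≫ tensorHom coev (𝟙 Z) ≫
        tensorHom (tensorHom θ.inv (dualHom θ.hom)) θ.inv := by
    rw [tensorHom_comp, tensorHom_comp, Category.id_comp, Category.id_comp, θ.hom_inv_id]
  have e₂ : tensorHom θ.inv (tensorHom (dualHom θ.hom) θ.inv) ≫
      tensorHom (𝟙 X) (tensorHom (dualHom θ.inv) θ.hom ≫ ev) =
        tensorHom (𝟙 Z) ev ≫ tensorHom θ.inv (𝟙 _) := by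
    rw [tensorHom_comp, tensorHom_comp, tensorHom_comp_assoc, dualHom_comp, θ.inv_hom_id,
      dualHom_id, tensorHom_id, Category.id_comp, Category.id_comp, Category.comp_id,
      Category.comp_id]
  rw [e₁, Category.assoc, Category.assoc, ← Category.assoc (tensorHom (tensorHom _ _) _),
    assocMap_naturality, Category.assoc, ← Category.assoc (tensorHom θ.inv (tensorHom _ _)), e₂,
    Category.assoc, rhoMap_naturality, ← Category.assoc _ _ θ.inv]
  have e₃ : tensorHom coev (𝟙 Z) ≫ ho (assocMap Z Z.dual Z) ≫ tensorHom (𝟙 Z) ev ≫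
      ho (rhoMap Z) ≫ θ.inv = ho (lamMap Z) ≫ θ.inv := by
    rw [← h]; simp only [Category.assoc]
  simp only [Category.assoc]
  rw [e₃, ← Category.assoc, lamMap_naturality, Category.assoc, θ.hom_inv_id, Category.comp_id]

theorem ZorroTwo.of_iso (θ : X ≅ Z) {ev : Z.dual.tensor Z ⟶ MBF.unit W}
    {coev : MBF.unit W ⟶ Z.tensor Z.dual} (h : ZorroTwo Z ev coev) :
    ZorroTwo X (tensorHom (dualHom θ.inv) θ.hom ≫ ev)
      (coev ≫ tensorHom θ.inv (dualHom θ.hom)) := by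
  obtain ⟨_, h⟩ := h
  have hX : IsIso (ho (rhoMap X.dual)) := isIso_rhoMap_of_iso (dualIso θ)
  refine ⟨hX, ?_⟩
  rw [IsIso.inv_comp_eq, Category.comp_id] at h ⊢
  have d : dualHom θ.inv ≫ dualHom θ.hom = 𝟙 X.dual := (dualIso θ).hom_inv_id
  have d' : dualHom θ.hom ≫ dualHom θ.inv = 𝟙 Z.dual := (dualIso θ).inv_hom_id
  have e₁ : tensorHom (𝟙 X.dual) (coev ≫ tensorHom θ.inv (dualHom θ.hom)) =
      tensorHom (dualHom θ.inv) (𝟙 _) ≫ tensorHom (𝟙 Z.dual) coev ≫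
        tensorHom (dualHom θ.hom) (tensorHom θ.inv (dualHom θ.hom)) := by
    rw [tensorHom_comp, tensorHom_comp, Category.id_comp, Category.id_comp, d]
  have e₂ : tensorHom (tensorHom (dualHom θ.hom) θ.inv) (dualHom θ.hom) ≫
      tensorHom (tensorHom (dualHom θ.inv) θ.hom ≫ ev) (𝟙 X.dual) =
        tensorHom ev (𝟙 Z.dual) ≫ tensorHom (𝟙 _) (dualHom θ.hom) := by
    rw [tensorHom_comp, tensorHom_comp, tensorHom_comp_assoc, d', θ.inv_hom_id,
      tensorHom_id, Category.id_comp, Category.id_comp, Category.comp_id, Category.comp_id]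
  rw [e₁, Category.assoc, Category.assoc,
    ← Category.assoc (tensorHom (dualHom θ.hom) (tensorHom _ _)), assocInvMap_naturality,
    Category.assoc, ← Category.assoc (tensorHom (tensorHom _ _) (dualHom θ.hom)), e₂,
    Category.assoc, lamMap_naturality]
  have e₃ : tensorHom (𝟙 Z.dual) coev ≫ ho (assocInvMap Z.dual Z Z.dual) ≫
      tensorHom ev (𝟙 Z.dual) ≫ ho (lamMap Z.dual) ≫ dualHom θ.hom =
        ho (rhoMap Z.dual) ≫ dualHom θ.hom := by
    rw [← h]; simp only [Category.assoc]
  rw [e₃, ← Category.assoc, rhoMap_naturality, Category.assoc, d, Category.comp_id]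

end Transport

/-! ### Independence of choices and the general case. -/

section FiniteRank
variable {W : R} {Z : MBF W} (F : Frame Z) (hW : 0 < W.natDegree)

theorem Frame.zorroOne_ho : ZorroOne Z (ho (F.ev hW)) (ho F.coevMap) := by
  obtain ⟨l, hl, h₁, h₂⟩ := F.exists_lamInv
  have hi : IsIso (ho (lamMap Z)) := ⟨ho l, h₂, h₁⟩
  refine ⟨hi, ?_⟩
  rw [IsIso.inv_eq_of_hom_inv_id h₂]
  exact ho_eq_of_homotopic (f := (rhoMap Z).comp (((ClosedMap.id Z).tensor (F.ev hW)).comp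
    ((assocMap Z Z.dual Z).comp ((F.coevMap.tensor (ClosedMap.id Z)).comp l))))
    (g := ClosedMap.id Z) (F.zorroOne_homotopic hW _ (by rw [Frame.zorroOne, ← hl]; rfl))

theorem Frame.zorroTwo_ho : ZorroTwo Z (ho (F.ev hW)) (ho F.coevMap) := by
  obtain ⟨r, hr, h₁, h₂⟩ := F.dual.exists_rhoInv
  have hi : IsIso (ho (rhoMap Z.dual)) := ⟨ho r, h₂, h₁⟩
  refine ⟨hi, ?_⟩
  rw [IsIso.inv_eq_of_hom_inv_id h₂]
  exact ho_eq_of_homotopic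
    (f := (lamMap Z.dual).comp (((F.ev hW).tensor (ClosedMap.id Z.dual)).comp
    ((assocInvMap Z.dual Z Z.dual).comp (((ClosedMap.id Z.dual).tensor F.coevMap).comp r))))
    (g := ClosedMap.id Z.dual) (F.zorroTwo_homotopic hW _ (by rw [Frame.zorroTwo, ← hr]; rfl))

variable {X Z' : MBF W}

/-- Dinaturality is applied to φ = θ' ∘ θ⁻¹ : Z ⟶ Z' and precomposed with (θ'⁻¹)^∨ ⊗ θ. Then φ^∨ ∘
(θ'⁻¹)^∨ = (θ⁻¹)^∨ and φ ∘ θ = θ'. -/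
theorem Frame.ev_independent (F' : Frame Z') (θ : X ≅ Z) (θ' : X ≅ Z') :
    tensorHom (dualHom θ.inv) θ.hom ≫ ho (F.ev hW) =
      tensorHom (dualHom θ'.inv) θ'.hom ≫ ho (F'.ev hW) := by
  have h : ∀ φ : Z ⟶ Z', tensorHom (dualHom φ) (𝟙 Z) ≫ ho (F.ev hW) =
      tensorHom (𝟙 Z'.dual) φ ≫ ho (F'.ev hW) := fun φ => by
    obtain ⟨φ, rfl⟩ := ho_surjective φ
    exact ho_eq_of_homotopic (F.ev_dinatural hW F' φ)
  have key := congrArg (fun z => tensorHom (dualHom θ'.inv) θ.hom ≫ z) (h (θ.inv ≫ θ'.hom))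
  simp only [tensorHom_comp_assoc, dualHom_comp, Category.assoc, Iso.hom_inv_id_assoc,
    Iso.hom_inv_id, Category.comp_id] at key
  exact key

theorem Frame.coev_independent (F' : Frame Z') (θ : X ≅ Z) (θ' : X ≅ Z') :
    ho F.coevMap ≫ tensorHom θ.inv (dualHom θ.hom) =
      ho F'.coevMap ≫ tensorHom θ'.inv (dualHom θ'.hom) := by
  have h : ∀ φ : Z ⟶ Z', ho F.coevMap ≫ tensorHom φ (𝟙 Z.dual) =
      ho F'.coevMap ≫ tensorHom (𝟙 Z') (dualHom φ) := fun φ => by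
    obtain ⟨φ, rfl⟩ := ho_surjective φ
    exact ho_eq_of_homotopic (F.coev_dinatural F' φ)
  -- Postcomposition with θ'⁻¹ ⊗ θ^∨ turns the two sides into the transported coevaluations, since
  -- θ'⁻¹ ∘ φ = θ⁻¹ and θ^∨ ∘ φ^∨ = θ'^∨.
  have key := congrArg (fun z => z ≫ tensorHom θ'.inv (dualHom θ.hom)) (h (θ.inv ≫ θ'.hom))
  simp only [Category.assoc, tensorHom_comp, dualHom_comp, Iso.hom_inv_id_assoc,
    Iso.hom_inv_id, Category.comp_id, Category.id_comp] at key
  exact key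

theorem Frame.isMFbi {X Z : MBF W} (F : Frame Z) (θ : X ≅ Z) : IsMFbi X :=
  ⟨Z, .of_basis F.b₀, .of_basis F.b₀, .of_basis F.b₁, .of_basis F.b₁, ⟨θ⟩⟩

theorem IsMFbi.exists_frame (hX : IsMFbi X) : ∃ (Z : MBF W) (_ : Frame Z), Nonempty (X ≅ Z) := by
  obtain ⟨Z, _, _, _, _, θ⟩ := hX
  exact ⟨Z, { ι₀ := Module.Free.ChooseBasisIndex S Z.X₀
              ι₁ := Module.Free.ChooseBasisIndex S Z.X₁
              b₀ := Module.Free.chooseBasis S Z.X₀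
              b₁ := Module.Free.chooseBasis S Z.X₁ }, θ⟩

theorem IsMFbi.dual (hX : IsMFbi X) : IsMFbi X.dual := by
  obtain ⟨Z, F, ⟨θ⟩⟩ := hX.exists_frame
  exact F.dual.isMFbi (dualIso θ)

/-- The evaluation of an object of `MF_bi(W)`. -/
def IsMFbi.ev (hX : IsMFbi X) : X.dual.tensor X ⟶ MBF.unit W :=
  let F := hX.exists_frame.choose_spec.choose
  let θ := hX.exists_frame.choose_spec.choose_spec.some
  tensorHom (dualHom θ.inv) θ.hom ≫ ho (F.ev hW)

/-- The coevaluation of an object of `MF_bi(W)`. -/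
def IsMFbi.coev (hX : IsMFbi X) : MBF.unit W ⟶ X.tensor X.dual :=
  let F := hX.exists_frame.choose_spec.choose
  let θ := hX.exists_frame.choose_spec.choose_spec.some
  ho F.coevMap ≫ tensorHom θ.inv (dualHom θ.hom)

end FiniteRank

end BiFact

end

theorem theorem2p6 (W : Polynomial ℂ)
    (hW : Module.Finite ℂ (Polynomial ℂ ⧸ Ideal.span {Polynomial.derivative W})) :
    (∀ (Z : BiFact.MBF W) (F : BiFact.Frame Z), F.UnitInverses) ∧
    (∀ X Y Z : BiFact.MBF W,
      BiFact.ho (BiFact.assocMap X Y Z) ≫ BiFact.ho (BiFact.assocInvMap X Y Z) =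
          𝟙 ((X.tensor Y).tensor Z) ∧
        BiFact.ho (BiFact.assocInvMap X Y Z) ≫ BiFact.ho (BiFact.assocMap X Y Z) =
          𝟙 (X.tensor (Y.tensor Z))) ∧
    ∃ (ev : ∀ Z : BiFact.MBF W, BiFact.Frame Z →
          BiFact.ClosedMap (Z.dual.tensor Z) (BiFact.MBF.unit W))
      (coev : ∀ Z : BiFact.MBF W, BiFact.Frame Z →
          BiFact.ClosedMap (BiFact.MBF.unit W) (Z.tensor Z.dual)),
      (∀ (Z : BiFact.MBF W) (F : BiFact.Frame Z),
        F.IsEv (ev Z F) ∧ (coev Z F).toEvenMap = F.coev) ∧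
      (∀ (Z : BiFact.MBF W) (F : BiFact.Frame Z), F.LowDegree →
        F.ZorroOneDG (ev Z F) (coev Z F) ∧ F.ZorroTwoDG (ev Z F) (coev Z F)) ∧
      ∃ (evX : ∀ X : BiFact.MBF W, BiFact.IsMFbi X → (X.dual.tensor X ⟶ BiFact.MBF.unit W))
        (coevX : ∀ X : BiFact.MBF W, BiFact.IsMFbi X → (BiFact.MBF.unit W ⟶ X.tensor X.dual)),
        (∀ (X : BiFact.MBF W) (hX : BiFact.IsMFbi X) (Z : BiFact.MBF W) (F : BiFact.Frame Z)
          (θ : X ≅ Z),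
          evX X hX = BiFact.tensorHom (BiFact.dualHom θ.inv) θ.hom ≫ BiFact.ho (ev Z F) ∧
          coevX X hX = BiFact.ho (coev Z F) ≫ BiFact.tensorHom θ.inv (BiFact.dualHom θ.hom)) ∧
        ∀ (X : BiFact.MBF W) (hX : BiFact.IsMFbi X),
          BiFact.IsMFbi X.dual ∧ BiFact.ZorroOne X (evX X hX) (coevX X hX) ∧
            BiFact.ZorroTwo X (evX X hX) (coevX X hX) := by
  have hd := BiFact.natDegree_pos_of_finite hW
  refine ⟨fun Z F => F.unitInverses,
    fun X Y Z => ⟨BiFact.assocMap_assocInvMap X Y Z, BiFact.assocInvMap_assocMap X Y Z⟩,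
    fun Z F => F.ev hd, fun Z F => F.coevMap, fun Z F => ⟨F.isEv hd, rfl⟩,
    fun Z F h => ⟨F.zorroOneDG hd h, F.zorroTwoDG hd h⟩,
    fun X hX => hX.ev hd, fun X hX => hX.coev,
    -- The chosen object, bases and isomorphism inside `evX` and `coevX` are compared with arbitrary
    -- ones; the Zorro identities then need to be known only for the chosen ones.
    fun X hX Z F θ => ⟨BiFact.Frame.ev_independent _ hd F _ θ, BiFact.Frame.coev_independent _ F _ θ⟩,
    fun X hX => ⟨hX.dual, BiFact.ZorroOne.of_iso _ (BiFact.Frame.zorroOne_ho _ hd),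
      BiFact.ZorroTwo.of_iso _ (BiFact.Frame.zorroTwo_ho _ hd)⟩⟩
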